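/- Notation. Let $G$ be a finite abelian group. For $f,g:G\to\mathbb{R}$ write $\langle f,g\rangle=\sum_{x}f(x)g(x)$, $f\ast g(x)=\sum_y f(y)g(x-y)$, $f\circ g(x)=\sum_y f(y)g(y-x)$, $\|f\|_\infty=\max_x|f(x)|$, let $f^{(n)}$ be the $n$-fold convolution $f\ast\cdots\ast f$, and read $f\circ g\circ 1_\Gamma$ as $(f\circ g)\circ 1_\Gamma$. For a set $\Gamma\subset G$, $n\Gamma$ denotes the $n$-fold sumset $\Gamma+\cdots+\Gamma$. A set $\Delta$ is $\Gamma$-orthogonal if the translates $\gamma+\Gamma$ ($\gamma\in\Delta$) are pairwise disjoint. Let $E_4(\Delta;\Gamma)$ be the number of $(a_1,a_2,b_1,b_2)\in\Delta^4$ with $a_1+a_2-b_1-b_2\in\Gamma$. An additive framework $\widetilde\Gamma$ of height $h$ and tolerance $t$ is a chain of $h+2$ symmetric subsets of $G$ containing $0$, \[\Gamma_{\mathrm{top}}\supset\Gamma^{(1)}\supset\cdots\supset\Gamma^{(h)}\supset\Gamma^{(h+1)}=\Gamma_{\mathrm{bottom}},\] such that $2\Gamma^{(1)}-2\Gamma^{(1)}\subset\Gamma_{\mathrm{top}}$;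 for $1\le i<h$, $t\Gamma^{(i+1)}\subset\Gamma^{(i)}$ and $|\Gamma^{(i)}+t\Gamma^{(i+1)}|\le 2|\Gamma^{(i)}|$; and for $1\le i\le h$ and all $x\in\Gamma^{(i+1)}-\Gamma^{(i+1)}$, $1_{\Gamma^{(i)}}\circ 1_{\Gamma^{(i)}}(x)\ge\tfrac12|\Gamma^{(i)}|$. A set $\Delta\subset G$ is $(\tau,k)$-additively non-smoothing relative to $\widetilde\Gamma$ if $\Delta$ is $\Gamma_{\mathrm{top}}$-orthogonal; $E_4(\Delta';\Gamma_{\mathrm{bottom}})\ge\frac{\tau}{|\Delta|}|\Delta'|^4$ for every $\Delta'\subset\Delta$; $\|1_\Delta^{(m)}\circ1_\Delta^{(m)}\circ 1_{\Gamma_{\mathrm{top}}}\|_\infty\le\tau^{m-1-1/k}|\Delta|^{2m-1}$ for $m=2,3,4$; and $\log(\tau^{-1})\le\tau^{-1/k}$. It is $\kappa$-robustly $(\tau,k)$-additively non-smoothing relative to $\widetilde\Gamma$ if every $\Delta'\subset\Delta$ with $|\Delta'|\ge\kappa|\Delta|$ is $(\tau,k)$-additively non-smoothing relative to $\widetilde\Gamma$.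 Theorem. There are absolute constants $C>0$ and $A\in\mathbb{N}$, $A\geq 1$, such that the following holds. Let $G$ be any finite abelian group, let $h,t\ge 2$ be integers, let $k\ge2$ and $0<\tau\le\tfrac12$ be real, and let $\widetilde\Gamma$ be an additive framework in $G$ of height $h$ and tolerance $t$, where $h\le C^{-1}\log\log k/\log\log\log k$ (so in particular $k>e^e$) and $t\ge C\log k$. Put \[K=A\Bigl(t^h\,2^k\,\tau^{-\frac1{\log\log k}-\frac1h}\Bigr)^A.\] If $\Delta\subset G$ is $\tfrac12$-robustly $(\tau,k)$-additively non-smoothing relative to $\widetilde\Gamma$, then there are $X,H\subset\Delta$ and $\delta$ with $K^{-1}\tau\le\delta\le1$ such that \begin{enumerate} \item $K^{-1}\delta|\Delta|\le|H|\le K\delta|\Delta|$ and $K^{-1}\tau\delta^{-1}|\Delta|\le|X|\le K\tau\delta^{-1}|\Delta|$; \item $\langle 1_X\circ1_X,\ 1_H\circ1_H\circ1_{\Gamma_{\mathrm{top}}}\rangle\ge K^{-1}|H|^2|X|$; \item for some $z\in G$, $H+z\subset\{x: 1_X\circ1_X\circ1_{\Gamma_{\mathrm{top}}}(x)\ge K^{-1}|X|\}$.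 \end{enumerate} -/

import Mathlib

open scoped Pointwise

universe u

namespace AdditiveStructure

noncomputable section

/-- The indicator function of a finite set. -/
def ind {G : Type u} (A : Finset G) : G → ℝ := Set.indicator (A : Set G) 1

/-- The convolution `(f * g)(x) = ∑ y, f y * g (x - y)`. -/
def conv {G : Type u} [AddCommGroup G] [Fintype G] (f g : G → ℝ) : G → ℝ :=
  fun x => ∑ y, f y * g (x - y)

/-- The difference convolution `(f ∘ g)(x) = ∑ y, f y * g (y - x)` (of real-valued functions). -/
def dconv {G : Type u} [AddCommGroup G] [Fintype G] (f g : G → ℝ) : G → ℝ :=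
  fun x => ∑ y, f y * g (y - x)

/-- The inner product `⟨f, g⟩ = ∑ x, f x * g x` (of real-valued functions). -/
def inn {G : Type u} [Fintype G] (f g : G → ℝ) : ℝ := ∑ x, f x * g x

/-- The `n`-fold convolution `f^{(n)}`: `f^{(1)} = f`, `f^{(n+1)} = f^{(n)} * f`. By convention
`f^{(0)}` is the identity for convolution, the indicator function of `{0}`. -/
def iterConv {G : Type u} [AddCommGroup G] [Fintype G] (f : G → ℝ) : ℕ → G → ℝ
  | 0 => ind {0}
  | n + 1 => conv (iterConv f n) f

theorem iterConv_one {G : Type u} [AddCommGroup G] [Fintype G] (f : G → ℝ) :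
    iterConv f 1 = f := by
  classical
  funext x
  simp [iterConv, conv, ind, Set.indicator_apply]

/-- The `n`-fold sumset `nA = A + ⋯ + A` (with `0A = {0}`). This is not the dilate of `A` by `n`. -/
def sumset {G : Type u} [AddCommGroup G] [DecidableEq G] : ℕ → Finset G → Finset G
  | 0, _ => {0}
  | n + 1, A => sumset n A + A

/-- The `2m`-fold additive energy `E_{2m}(ω; ν)` of a real function `ω` with respect to `ν`,
`∑ ω(a₁) ⋯ ω(aₘ) ω(b₁) ⋯ ω(bₘ) ν(a₁ + ⋯ + aₘ - b₁ - ⋯ - bₘ)`. The parameter is `m`. -/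
def energy {G : Type u} [AddCommGroup G] [Fintype G] (m : ℕ) (ω ν : G → ℝ) : ℝ :=
  ∑ a : Fin m → G, ∑ b : Fin m → G,
    (∏ i, ω (a i)) * (∏ i, ω (b i)) * ν ((∑ i, a i) - ∑ i, b i)

/-- `Δ` is `Γ`-orthogonal: the translates `γ + Γ`, for `γ ∈ Δ`, are pairwise disjoint. -/
def IsOrthogonal {G : Type u} [AddCommGroup G] [DecidableEq G] (Δ Γ : Finset G) : Prop :=
  (Δ : Set G).PairwiseDisjoint fun γ => γ +ᵥ Γ

/-- An additive framework of height `h` and tolerance `t`: a chain of `h + 2` symmetric sets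
containing `0`. The top set is `Γ 0`, the levels are `Γ 1, …, Γ (h + 1)`, and `Γ (h + 1)` is the
bottom set. No condition is made on (and no use is made of) `Γ i` for `i > h + 1`. -/
structure AdditiveFramework (G : Type u) [AddCommGroup G] [Fintype G] [DecidableEq G]
    (h t : ℕ) where
  Γ : ℕ → Finset G
  neg_eq : ∀ i ≤ h + 1, -Γ i = Γ i
  zero_mem : ∀ i ≤ h + 1, (0 : G) ∈ Γ i
  succ_subset : ∀ i ≤ h, Γ (i + 1) ⊆ Γ i
  two_sub_two_subset : sumset 2 (Γ 1) - sumset 2 (Γ 1) ⊆ Γ 0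
  sumset_subset : ∀ i, 1 ≤ i → i < h → sumset t (Γ (i + 1)) ⊆ Γ i
  card_add_sumset_le : ∀ i, 1 ≤ i → i < h →
    (Γ i + sumset t (Γ (i + 1))).card ≤ 2 * (Γ i).card
  le_dconv : ∀ i, 1 ≤ i → i ≤ h → ∀ x ∈ Γ (i + 1) - Γ (i + 1),
    (1 / 2 : ℝ) * (Γ i).card ≤ dconv (ind (Γ i)) (ind (Γ i)) x

/-- The top set of an additive framework. -/
def AdditiveFramework.top {G : Type u} [AddCommGroup G] [Fintype G] [DecidableEq G] {h t : ℕ}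
    (F : AdditiveFramework G h t) : Finset G := F.Γ 0

/-- The bottom set of an additive framework. -/
def AdditiveFramework.bottom {G : Type u} [AddCommGroup G] [Fintype G] [DecidableEq G] {h t : ℕ}
    (F : AdditiveFramework G h t) : Finset G := F.Γ (h + 1)

/-- `Δ` is `(τ, k)`-additively non-smoothing relative to the additive framework `F`. The norm on
`G → ℝ` is the supremum norm. -/
structure IsNonSmoothing {G : Type u} [AddCommGroup G] [Fintype G] [DecidableEq G] {h t : ℕ}
    (F : AdditiveFramework G h t) (τ k : ℝ) (Δ : Finset G) : Prop where
  orthogonal : IsOrthogonal Δ F.top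
  le_energy : ∀ Δ' ⊆ Δ,
    τ / (Δ.card : ℝ) * (Δ'.card : ℝ) ^ 4 ≤ energy 2 (ind Δ') (ind F.bottom)
  norm_two : ‖dconv (dconv (iterConv (ind Δ) 2) (iterConv (ind Δ) 2)) (ind F.top)‖
    ≤ τ ^ (1 - 1 / k) * (Δ.card : ℝ) ^ 3
  norm_three : ‖dconv (dconv (iterConv (ind Δ) 3) (iterConv (ind Δ) 3)) (ind F.top)‖
    ≤ τ ^ (2 - 1 / k) * (Δ.card : ℝ) ^ 5
  norm_four : ‖dconv (dconv (iterConv (ind Δ) 4) (iterConv (ind Δ) 4)) (ind F.top)‖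
    ≤ τ ^ (3 - 1 / k) * (Δ.card : ℝ) ^ 7
  log_le : Real.log τ⁻¹ ≤ τ ^ (-(1 / k))

/-- `Δ` is `κ`-robustly `(τ, k)`-additively non-smoothing relative to `F`: all subsets of `Δ` of
size at least `κ|Δ|` are `(τ, k)`-additively non-smoothing relative to `F`. -/
def IsRobustlyNonSmoothing {G : Type u} [AddCommGroup G] [Fintype G] [DecidableEq G] {h t : ℕ}
    (F : AdditiveFramework G h t) (κ τ k : ℝ) (Δ : Finset G) : Prop :=
  ∀ Δ' ⊆ Δ, κ * (Δ.card : ℝ) ≤ (Δ'.card : ℝ) → IsNonSmoothing F τ k Δ'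

/-- The permitted loss `A P ^ A`, polynomial in `P = t ^ h 2 ^ k τ ^ (-1 / log log k - 1 / h)`. -/
def loss (A h t : ℕ) (k τ : ℝ) : ℝ :=
  A * ((t : ℝ) ^ h * (2 : ℝ) ^ k * τ ^ (-(1 / Real.log (Real.log k)) - 1 / (h : ℝ))) ^ A

end

end AdditiveStructure

namespace AdditiveStructure

open Classical Finset

universe v

/-! ### Double counting and pigeonhole principles. -/

section Counting

variable {α β ι : Type*}

/-! Write N = |Δ| and let "close" mean differing by an element of a ball, the balls being sumsets of
the bottom set. Balls of radius at most `t` lie in the top set, so Δ is separated by them. All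
estimates below hold up to the permitted loss. The energy lower bound gives a height ρ such that
about τN²/ρ pairs in Δ have a difference with at least ρN representations. The m = 2 norm bound,
after discarding half of Δ, gives ∑_b rep(a - b) ≤ τN² for each a. The m = 4 bound controls the
eightfold energy by τ³N⁷.

Consider cherries (a, b, b') with both a - b and a - b' popular. There are about τ²N³/ρ² of them,
and a typical one has about σN translates in Δ. Pairs of pairs parallel to the two legs have a
difference of differences close to b - b', which has at least σN representations. Cauchy–Schwarz
against the eightfold energy (`sq_card_cherries_mul_le`) shows that height σ again carries about
τN²/σ pairs (`level_of_cherries`), so the passage from ρ to σ can be iterated. It cannot lose a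
factor M ≈ τ^(-1/h) in each of h steps, since at most N² pairs exist. Hence ρ ≤ Mσ at some step
(`exists_pair`).

At such a step the estimates are nearly tight (`exists_pair_of_cherries`). Fix an apex a, and let Ω
be a regular set of translates (c, b, b'). Let H be the set of first points b of a large class of
parallel pairs (b, b'), and let f(x) count the ways of writing x ≈ c + b' - a. A further
Cauchy–Schwarz (`sq_le_sum_min_representations`) shows that differences of H are often differences x
- x', weighted by min(f(x), f(x')). As f is at most about |H|, some superlevel set X of f satisfies
|X||H| ≥ τN² and is almost invariant under typical differences of H. Fixing one element of H puts a
translate of a large part of H in a symmetry set of X. Trimming H makes |X||H| of the right size,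
and the energy statement follows from the symmetry statement by Cauchy–Schwarz
(`exists_pair_of_symmetric`).

When log log k ≤ 4 the permitted loss exceeds a suitable power of 1/τ, and a large subset of Δ
serves as X directly (`exists_pair_trivial`). -/

theorem card_mul_le_card_mul_of_rel (S : Finset α) (T : Finset β) (r : α → β → Prop)
    [∀ s t, Decidable (r s t)] {m M : ℝ}
    (hM : 0 ≤ M) (h₁ : ∀ s ∈ S, m ≤ #{t ∈ T | r s t})
    (h₂ : ∀ t ∈ T, ∀ s ∈ S, r s t → (#{s' ∈ S | r s' t} : ℝ) ≤ M) :
    (#S : ℝ) * m ≤ #T * M := by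
  have key : ∑ s ∈ S, (#{t ∈ T | r s t} : ℝ) = ∑ t ∈ T, (#{s ∈ S | r s t} : ℝ) := by
    exact_mod_cast Finset.sum_card_bipartiteAbove_eq_sum_card_bipartiteBelow (s := S) (t := T) r
  have h₃ : ∀ t ∈ T, (#{s' ∈ S | r s' t} : ℝ) ≤ M := by
    intro t ht
    rcases ({s' ∈ S | r s' t} : Finset α).eq_empty_or_nonempty with h | ⟨s, hs⟩
    · simpa [h] using hM
    · rw [mem_filter] at hs
      exact h₂ t ht s hs.1 hs.2
  calc (#S : ℝ) * m = ∑ s ∈ S, m := by simp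
    _ ≤ ∑ s ∈ S, (#{t ∈ T | r s t} : ℝ) := sum_le_sum h₁
    _ = ∑ t ∈ T, (#{s ∈ S | r s t} : ℝ) := key
    _ ≤ ∑ t ∈ T, M := sum_le_sum h₃
    _ = #T * M := by simp

/-- If each `w ∈ W` is incident with at least `M` elements of `P`, then many pairs of elements
of `W` have a common neighbour. -/
theorem sq_card_mul_le_of_incidence (W : Finset α) (P : Finset β) (r : α → β → Prop)
    [∀ s t, Decidable (r s t)] {M : ℝ}
    (hM : 0 < M) (h : ∀ w ∈ W, M ≤ #{p ∈ P | r w p}) (Q : Finset (α × α))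
    (hQ : ∀ w ∈ W, ∀ w' ∈ W, ∀ p ∈ P, r w p → r w' p → (w, w') ∈ Q) :
    (#W : ℝ) ^ 2 * M ≤ #P * #Q := by
  set n : α → ℝ := fun w => #{p ∈ P | r w p} with hn
  have npos : ∀ w ∈ W, 0 < n w := fun w hw => hM.trans_le (h w hw)
  -- Weighting each incidence by the inverse degree of `w` gives every `w` total weight 1, and a
  -- pair with common neighbours contributes at most `M⁻¹`. Degrees are bounded only from below, so
  -- unweighted codegrees would not be controlled.
  set g : β → ℝ := fun p => ∑ w ∈ W with r w p, (n w)⁻¹ with hg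
  have h₁ : (#W : ℝ) = ∑ p ∈ P, g p := by
    simp only [hg, sum_filter]
    rw [sum_comm]
    calc (#W : ℝ) = ∑ w ∈ W, (1 : ℝ) := by simp
      _ = _ := by
        refine sum_congr rfl fun w hw => ?_
        rw [← sum_filter, sum_const, nsmul_eq_mul]
        exact (mul_inv_cancel₀ (npos w hw).ne').symm
  have h₂ : (#W : ℝ) ^ 2 ≤ #P * ∑ p ∈ P, g p ^ 2 := by
    rw [h₁]; exact sq_sum_le_card_mul_sum_sq
  have h₃ : ∑ p ∈ P, g p ^ 2 =
      ∑ w ∈ W, ∑ w' ∈ W, (#{p ∈ P | r w p ∧ r w' p} : ℝ) * ((n w)⁻¹ * (n w')⁻¹) := by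
    simp only [hg, sum_filter, sq, sum_mul_sum]
    rw [sum_comm]
    refine sum_congr rfl fun w _ => ?_
    rw [sum_comm]
    refine sum_congr rfl fun w' _ => ?_
    rw [← nsmul_eq_mul, ← sum_const, sum_filter]
    refine sum_congr rfl fun p _ => ?_
    by_cases h1 : r w p <;> by_cases h2 : r w' p <;> simp [h1, h2]
  have h₄ : ∀ w ∈ W, ∀ w' ∈ W,
      (#{p ∈ P | r w p ∧ r w' p} : ℝ) * ((n w)⁻¹ * (n w')⁻¹) ≤
        if (w, w') ∈ Q then M⁻¹ else 0 := by
    intro w hw w' hw'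
    split_ifs with hq
    · have : (#{p ∈ P | r w p ∧ r w' p} : ℝ) ≤ n w := by
        simp only [hn]
        exact_mod_cast card_le_card fun p hp => by
          simp only [mem_filter] at hp ⊢; exact ⟨hp.1, hp.2.1⟩
      calc _ ≤ n w * ((n w)⁻¹ * (n w')⁻¹) := by
            have := npos w hw; have := npos w' hw'; gcongr
        _ = (n w')⁻¹ := by rw [← mul_assoc, mul_inv_cancel₀ (npos w hw).ne', one_mul]
        _ ≤ M⁻¹ := inv_anti₀ hM (h w' hw')
    · have : ({p ∈ P | r w p ∧ r w' p} : Finset β) = ∅ := by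
        refine filter_eq_empty_iff.2 fun p hp hpp => hq (hQ w hw w' hw' p hp hpp.1 hpp.2)
      simp [this]
  have h₅ : ∑ p ∈ P, g p ^ 2 ≤ #Q * M⁻¹ := by
    rw [h₃, ← sum_product']
    calc _ ≤ ∑ x ∈ W ×ˢ W, (if x ∈ Q then M⁻¹ else 0) := by
          refine sum_le_sum fun x hx => ?_
          rw [mem_product] at hx
          exact h₄ x.1 hx.1 x.2 hx.2
      _ = #{x ∈ W ×ˢ W | x ∈ Q} * M⁻¹ := by rw [← sum_filter, sum_const, nsmul_eq_mul]
      _ ≤ _ := by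
        gcongr
        exact fun x hx => (mem_filter.1 hx).2
  calc (#W : ℝ) ^ 2 * M ≤ (#P * (#Q * M⁻¹)) * M := by
        gcongr; exact h₂.trans (by gcongr)
    _ = #P * #Q := by field_simp

theorem sq_card_le_card_mul_card_fiber_pairs [DecidableEq β] (S : Finset α) (T : Finset β) (g : α → β)
    (hg : ∀ s ∈ S, g s ∈ T) :
    (#S : ℝ) ^ 2 ≤ #T * #{x ∈ S ×ˢ S | g x.1 = g x.2} := by
  have := sq_card_mul_le_of_incidence S T (fun s t => g s = t) (M := 1) one_pos
    (fun s hs => by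
      have : (1 : ℕ) ≤ #{t ∈ T | g s = t} :=
        card_pos.2 ⟨g s, mem_filter.2 ⟨hg s hs, rfl⟩⟩
      exact_mod_cast this)
    {x ∈ S ×ˢ S | g x.1 = g x.2}
    (fun w hw w' hw' p _ h h' => by
      simp only [mem_filter, mem_product]
      exact ⟨⟨hw, hw'⟩, h.trans h'.symm⟩)
  simpa using this

/-- A finite set has a large subset all of whose nonempty fibres over finitely many maps are
large. -/
theorem exists_subset_fibers_large [Fintype ι] [DecidableEq β] (Ω : Finset α) (π : ι → α → β) (θ : ι → ℝ)
    (h : ∑ i, θ i * #(Ω.image (π i)) ≤ #Ω / 2) (hθ : ∀ i, 0 ≤ θ i) :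
    ∃ Ω' ⊆ Ω, (#Ω : ℝ) / 2 ≤ #Ω' ∧
      ∀ i, ∀ x ∈ Ω', θ i ≤ #{y ∈ Ω' | π i y = π i x} := by
  -- At a maximiser no nonempty fibre can be smaller than `θ i`: deleting it would cost fewer than
  -- `θ i` elements and remove an image point worth `θ i`. Comparison with `Ω` itself bounds the
  -- size from below.
  let val : Finset α → ℝ := fun S => #S - ∑ i, θ i * #(S.image (π i))
  obtain ⟨Ω', hΩ', hmax⟩ := Ω.powerset.exists_max_image val ⟨Ω, by simp⟩
  rw [mem_powerset] at hΩ'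
  refine ⟨Ω', hΩ', ?_, fun i x hx => ?_⟩
  · have h1 := hmax Ω (by simp)
    have h2 : (0 : ℝ) ≤ ∑ i, θ i * #(Ω'.image (π i)) :=
      sum_nonneg fun i _ => mul_nonneg (hθ i) (Nat.cast_nonneg _)
    simp only [val] at h1
    linarith
  · by_contra! hlt
    set D := {y ∈ Ω' | ¬ π i y = π i x} with hD
    have hDs : D ⊆ Ω' := filter_subset _ _
    have h1 := hmax D (mem_powerset.2 (hDs.trans hΩ'))
    have h2 : (#{y ∈ Ω' | π i y = π i x} : ℝ) + #D = #Ω' := by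
      exact_mod_cast card_filter_add_card_filter_not (s := Ω') (fun y => π i y = π i x)
    have h3 : ∀ j, θ j * #(D.image (π j)) ≤ θ j * #(Ω'.image (π j)) := fun j =>
      mul_le_mul_of_nonneg_left (by exact_mod_cast card_le_card (image_subset_image hDs)) (hθ j)
    have h4 : θ i * #(D.image (π i)) + θ i ≤ θ i * #(Ω'.image (π i)) := by
      have : #(D.image (π i)) + 1 ≤ #(Ω'.image (π i)) := by
        refine card_lt_card ⟨image_subset_image hDs, fun hsub => ?_⟩
        obtain ⟨y, hy, hyx⟩ := mem_image.1 (hsub (mem_image_of_mem _ hx))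
        exact (mem_filter.1 hy).2 hyx
      have h5 : ((#(D.image (π i)) : ℝ) + 1) ≤ #(Ω'.image (π i)) := by exact_mod_cast this
      have := mul_le_mul_of_nonneg_left h5 (hθ i)
      linarith
    have h6 : ∑ j, θ j * (#(D.image (π j)) : ℝ) + θ i ≤ ∑ j, θ j * (#(Ω'.image (π j)) : ℝ) := by
      have e₁ := add_sum_erase univ (fun j => θ j * (#(D.image (π j)) : ℝ)) (mem_univ i)
      have e₂ := add_sum_erase univ (fun j => θ j * (#(Ω'.image (π j)) : ℝ)) (mem_univ i)
      have := sum_le_sum fun j (_ : j ∈ univ.erase i) => h3 j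
      linarith
    simp only [val] at h1
    linarith

/-- The intervals [2^-(j+1), 2^-j] with j ≤ L / log 2 cover all values of `F`. There are at most 2L
+ 2 of them, so one carries its share of the weight. -/
theorem exists_dyadic_class (S : Finset α) (F w : α → ℝ) (hw : ∀ x ∈ S, 0 ≤ w x) {lo L : ℝ}
    (hlo : 0 < lo) (hlo' : ∀ x ∈ S, lo ≤ F x) (hF : ∀ x ∈ S, F x ≤ 1)
    (hL : Real.log lo⁻¹ ≤ L) (hL0 : 0 ≤ L) :
    ∃ ρ : ℝ, 0 < ρ ∧ ρ ≤ 1 ∧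
      ∑ x ∈ S, w x ≤ (2 * L + 2) * ∑ x ∈ S with ρ ≤ F x ∧ F x ≤ 2 * ρ, w x := by
  set J : ℕ := ⌊L / Real.log 2⌋₊ with hJ
  have hl2 : (0.69 : ℝ) < Real.log 2 := lt_trans (by norm_num) Real.log_two_gt_d9
  have hJ1 : (J : ℝ) + 1 ≤ 2 * L + 2 := by
    have h1 : (J : ℝ) ≤ L / Real.log 2 := Nat.floor_le (by positivity)
    have h2 : L / Real.log 2 ≤ 2 * L := by
      rw [div_le_iff₀ (by linarith)]; nlinarith
    linarith
  set c : ℕ → ℝ := fun j => ((2 : ℝ) ^ (j + 1))⁻¹ with hc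
  have cover : ∀ x ∈ S, ∃ j ∈ range (J + 1), c j ≤ F x ∧ F x ≤ 2 * c j := by
    intro x hx
    have hFpos : 0 < F x := hlo.trans_le (hlo' x hx)
    set y := Real.log (F x)⁻¹ / Real.log 2 with hy
    have hy0 : 0 ≤ y := div_nonneg (Real.log_nonneg (one_le_inv₀ hFpos |>.2 (hF x hx)))
      (by linarith)
    refine ⟨⌊y⌋₊, ?_, ?_, ?_⟩
    · rw [mem_range, Nat.lt_succ_iff]
      refine Nat.floor_mono ?_
      have : Real.log (F x)⁻¹ ≤ L :=
        (Real.log_le_log (inv_pos.2 hFpos) (inv_anti₀ hlo (hlo' x hx))).trans hL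
      exact div_le_div_of_nonneg_right this (by linarith)
    · have h1 : y < ⌊y⌋₊ + 1 := Nat.lt_floor_add_one y
      have h2 : Real.log (F x)⁻¹ ≤ Real.log (2 ^ (⌊y⌋₊ + 1)) := by
        rw [Real.log_pow]
        rw [hy, div_lt_iff₀ (by linarith)] at h1
        push_cast
        exact h1.le
      have h3 := (Real.log_le_log_iff (inv_pos.2 hFpos) (by positivity)).1 h2
      exact inv_le_of_inv_le₀ hFpos h3
    · have h1 : (⌊y⌋₊ : ℝ) ≤ y := Nat.floor_le hy0
      have h2 : Real.log (2 ^ ⌊y⌋₊) ≤ Real.log (F x)⁻¹ := by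
        rw [Real.log_pow]
        rwa [hy, le_div_iff₀ (by linarith)] at h1
      have h3 := (Real.log_le_log_iff (by positivity) (inv_pos.2 hFpos)).1 h2
      have h4 : 2 * c ⌊y⌋₊ = ((2 : ℝ) ^ ⌊y⌋₊)⁻¹ := by
        simp only [hc, pow_succ]; field_simp
      rw [h4]
      exact le_inv_of_le_inv₀ (by positivity) h3
  by_contra! hcon
  have hc0 : ∀ j, 0 < c j := fun j => by positivity
  have hc1 : ∀ j, c j ≤ 1 := fun j => inv_le_one_of_one_le₀ (one_le_pow₀ (by norm_num))
  have h1 : ∑ x ∈ S, w x ≤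
      ∑ j ∈ range (J + 1), ∑ x ∈ S with c j ≤ F x ∧ F x ≤ 2 * c j, w x := by
    simp only [sum_filter]
    rw [sum_comm]
    refine sum_le_sum fun x hx => ?_
    obtain ⟨j, hj, hjx⟩ := cover x hx
    have := single_le_sum (s := range (J + 1))
      (f := fun j => if c j ≤ F x ∧ F x ≤ 2 * c j then w x else 0)
      (fun i _ => by split_ifs; exacts [hw x hx, le_rfl]) hj
    simpa [hjx] using this
  have h2 : ∀ j, (2 * L + 2) * ∑ x ∈ S with c j ≤ F x ∧ F x ≤ 2 * c j, w x < ∑ x ∈ S, w x :=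
    fun j => hcon (c j) (hc0 j) (hc1 j)
  have h3 : (2 * L + 2) * ∑ x ∈ S, w x < (J + 1) * ∑ x ∈ S, w x := by
    calc _ ≤ (2 * L + 2) *
          ∑ j ∈ range (J + 1), ∑ x ∈ S with c j ≤ F x ∧ F x ≤ 2 * c j, w x := by gcongr
      _ = ∑ j ∈ range (J + 1), (2 * L + 2) * ∑ x ∈ S with c j ≤ F x ∧ F x ≤ 2 * c j, w x := by
        rw [mul_sum]
      _ < ∑ j ∈ range (J + 1), ∑ x ∈ S, w x :=
        sum_lt_sum_of_nonempty (by simp) fun j _ => h2 j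
      _ = _ := by simp
  have h4 : 0 ≤ ∑ x ∈ S, w x := sum_nonneg hw
  nlinarith

end Counting

/-! ### Approximate differences, translates and the eightfold energy. -/

section Setup

variable {G : Type v} [AddCommGroup G]

/-- An increasing family of symmetric sets that behaves like the balls of a norm. -/
structure IsBallFamily (B : ℕ → Set G) : Prop where
  mono : ∀ {r s : ℕ}, r ≤ s → B r ⊆ B s
  neg : ∀ {r : ℕ} {x : G}, x ∈ B r → -x ∈ B r
  add : ∀ {r s : ℕ} {x y : G}, x ∈ B r → y ∈ B s → x + y ∈ B (r + s)

namespace IsBallFamily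

variable {B : ℕ → Set G} (hB : IsBallFamily B)
include hB

theorem of_add {r s u : ℕ} {x y z : G} (hx : x ∈ B r) (hy : y ∈ B s) (h : z = x + y)
    (hu : r + s ≤ u) : z ∈ B u := h ▸ hB.mono hu (hB.add hx hy)

theorem of_sub {r s u : ℕ} {x y z : G} (hx : x ∈ B r) (hy : y ∈ B s) (h : z = x - y)
    (hu : r + s ≤ u) : z ∈ B u :=
  hB.of_add hx (hB.neg hy) (h.trans (sub_eq_add_neg x y)) hu

end IsBallFamily

/-- The number of representations of `z` as a difference of elements of `Δ`, up to `B r`. -/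
noncomputable def rep (B : ℕ → Set G) (Δ : Finset G) (r : ℕ) (z : G) : ℕ :=
  #{p ∈ Δ ×ˢ Δ | p.1 - p.2 - z ∈ B r}

/-- `d` completes `c` to a pair with `c - d` close to `z`. -/
def HasPartner (B : ℕ → Set G) (Δ : Finset G) (r : ℕ) (z c : G) : Prop :=
  ∃ d ∈ Δ, c - d - z ∈ B r

/-- The number of translates in `Δ` of the triple `(a, b, b')`, up to `B r`. -/
noncomputable def starRep (B : ℕ → Set G) (Δ : Finset G) (r : ℕ) (x : G × G × G) : ℕ :=
  #{c ∈ Δ | HasPartner B Δ r (x.1 - x.2.1) c ∧ HasPartner B Δ r (x.1 - x.2.2) c}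

/-- The pairs in `Δ` whose difference has at least `m` representations. -/
noncomputable def level (B : ℕ → Set G) (Δ : Finset G) (r : ℕ) (m : ℝ) : Finset (G × G) :=
  {p ∈ Δ ×ˢ Δ | m ≤ rep B Δ r (p.1 - p.2)}

/-- The difference of differences attached to two pairs. -/
def crossDiff (w : (G × G) × (G × G)) : G := (w.2.1 - w.2.2) - (w.1.1 - w.1.2)

/-- `N` is kept apart from `#Δ` so that passing to a subset does not change the normalisation. All
losses are collected in `Λ`; since `Λ` is at least 100, numerical constants are absorbed into its
powers. -/
structure Setup (B : ℕ → Set G) (Δ : Finset G) (R : ℕ) (N τ Λ : ℝ) : Prop where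
  ball : IsBallFamily B
  sep : ∀ a ∈ Δ, ∀ b ∈ Δ, a - b ∈ B R → a = b
  card_le : (#Δ : ℝ) ≤ N
  N_pos : 0 < N
  τ_pos : 0 < τ
  τ_le : τ ≤ 1
  le_Λ : 100 ≤ Λ
  log_le : Real.log τ⁻¹ ≤ Λ
  row : ∀ a ∈ Δ, ∑ b ∈ Δ, (rep B Δ R (a - b) : ℝ) ≤ Λ * τ * N ^ 2
  energy_le : (#{x ∈ ((Δ ×ˢ Δ) ×ˢ (Δ ×ˢ Δ)) ×ˢ ((Δ ×ˢ Δ) ×ˢ (Δ ×ˢ Δ)) |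
    crossDiff x.1 - crossDiff x.2 ∈ B R} : ℝ) ≤ Λ * τ ^ 3 * N ^ 7

variable {B : ℕ → Set G} {Δ : Finset G} {R : ℕ} {N τ Λ : ℝ}

theorem rep_mono (hB : IsBallFamily B) {r s : ℕ} {z w : G} (h : z - w ∈ B s) {u : ℕ}
    (hu : r + s ≤ u) : rep B Δ r z ≤ rep B Δ u w := by
  refine card_le_card fun p hp => ?_
  rw [mem_filter] at hp ⊢
  exact ⟨hp.1, hB.of_add hp.2 h (by abel) hu⟩

namespace Setup

variable (S : Setup B Δ R N τ Λ)
include S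

theorem Λ_pos : 0 < Λ := by linarith [S.le_Λ]

theorem eq_of_sub_mem {a b : G} (ha : a ∈ Δ) (hb : b ∈ Δ) {r : ℕ} (h : a - b ∈ B r)
    (hr : r ≤ R) : a = b := S.sep a ha b hb (S.ball.mono hr h)

theorem rep_le {r : ℕ} (hr : 2 * r ≤ R) (z : G) : (rep B Δ r z : ℝ) ≤ N := by
  refine le_trans ?_ S.card_le
  have : rep B Δ r z ≤ #Δ := by
    refine card_le_card_of_injOn (fun p => p.1) (fun p hp => ?_) fun p hp q hq hpq => ?_
    · exact (mem_product.1 (mem_filter.1 hp).1).1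
    · simp only [coe_filter, Set.mem_ofPred_eq, mem_product] at hp hq
      refine Prod.ext hpq (S.eq_of_sub_mem hp.1.2 hq.1.2 (r := 2 * r) ?_ hr)
      refine S.ball.of_sub hq.2 hp.2 ?_ (by omega)
      dsimp only at hpq
      rw [hpq]; abel
  exact_mod_cast this

omit S in
theorem card_hasPartner_le (r : ℕ) (z : G) : #{c ∈ Δ | HasPartner B Δ r z c} ≤ rep B Δ r z := by
  have : {c ∈ Δ | HasPartner B Δ r z c} ⊆
      ({p ∈ Δ ×ˢ Δ | p.1 - p.2 - z ∈ B r}).image Prod.fst := by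
    intro c hc
    obtain ⟨hc, d, hd, h⟩ := mem_filter.1 hc
    exact mem_image.2 ⟨(c, d), mem_filter.2 ⟨mem_product.2 ⟨hc, hd⟩, h⟩, rfl⟩
  exact (card_le_card this).trans card_image_le

/-- If c, d, d' is a translate of the triple, then d - d' is close to the difference of its last two
points. By separation d determines c. -/
theorem starRep_le_rep {r : ℕ} (hr : 4 * r ≤ R) (x : G × G × G) :
    starRep B Δ r x ≤ rep B Δ (2 * r) (x.2.1 - x.2.2) := by
  have h : ∀ c ∈ ({c ∈ Δ | HasPartner B Δ r (x.1 - x.2.1) c ∧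
      HasPartner B Δ r (x.1 - x.2.2) c} : Finset G),
      ∃ p : G × G, p.1 ∈ Δ ∧ p.2 ∈ Δ ∧ c - p.1 - (x.1 - x.2.1) ∈ B r ∧
        c - p.2 - (x.1 - x.2.2) ∈ B r := by
    intro c hc
    obtain ⟨_, ⟨d, hd, h⟩, ⟨d', hd', h'⟩⟩ := mem_filter.1 hc
    exact ⟨(d, d'), hd, hd', h, h'⟩
  choose! p hp using h
  refine card_le_card_of_injOn p (fun c hc => ?_) fun c hc c' hc' heq => ?_
  · obtain ⟨h1, h2, h3, h4⟩ := hp c hc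
    exact mem_filter.2 ⟨mem_product.2 ⟨h1, h2⟩, S.ball.of_sub h4 h3 (by abel) (by omega)⟩
  · obtain ⟨-, -, h3, -⟩ := hp c hc
    obtain ⟨-, -, h3', -⟩ := hp c' hc'
    refine S.eq_of_sub_mem (mem_filter.1 hc).1 (mem_filter.1 hc').1 (r := 2 * r) ?_ (by omega)
    refine S.ball.of_sub h3 h3' ?_ (by omega)
    rw [heq]; abel

theorem sum_rep_le {a : G} (ha : a ∈ Δ) {r : ℕ} (hr : r ≤ R) {T : Finset G} (hT : T ⊆ Δ) :
    ∑ b ∈ T, (rep B Δ r (a - b) : ℝ) ≤ Λ * τ * N ^ 2 := by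
  refine le_trans ?_ (S.row a ha)
  refine (sum_le_sum_of_subset_of_nonneg hT fun _ _ _ => Nat.cast_nonneg _).trans ?_
  refine sum_le_sum fun b _ => ?_
  have : rep B Δ r (a - b) ≤ rep B Δ R (a - b) :=
    card_le_card fun p hp => by
      rw [mem_filter] at hp ⊢
      exact ⟨hp.1, S.ball.mono hr hp.2⟩
  exact_mod_cast this

theorem card_neighbours_mul_le {a : G} (ha : a ∈ Δ) {r : ℕ} (hr : r ≤ R) {m : ℝ} {T : Finset G}
    (hT : T ⊆ Δ) (h : ∀ b ∈ T, m ≤ rep B Δ r (a - b)) : (#T : ℝ) * m ≤ Λ * τ * N ^ 2 := by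
  refine le_trans ?_ (S.sum_rep_le ha hr hT)
  rw [← nsmul_eq_mul]
  exact card_nsmul_le_sum _ _ _ h

theorem card_level_mul_le {r : ℕ} (hr : r ≤ R) (m : ℝ) :
    (#(level B Δ r m) : ℝ) * m ≤ Λ * τ * N ^ 3 := by
  have hpos := S.Λ_pos
  have hτ := S.τ_pos
  calc (#(level B Δ r m) : ℝ) * m ≤ ∑ p ∈ level B Δ r m, (rep B Δ r (p.1 - p.2) : ℝ) := by
        rw [← nsmul_eq_mul]
        exact card_nsmul_le_sum _ _ _ fun p hp => (mem_filter.1 hp).2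
    _ ≤ ∑ p ∈ Δ ×ˢ Δ, (rep B Δ r (p.1 - p.2) : ℝ) :=
        sum_le_sum_of_subset_of_nonneg (filter_subset _ _) fun _ _ _ => Nat.cast_nonneg _
    _ = ∑ a ∈ Δ, ∑ b ∈ Δ, (rep B Δ r (a - b) : ℝ) := sum_product _ _ _
    _ ≤ ∑ a ∈ Δ, Λ * τ * N ^ 2 := sum_le_sum fun a ha => S.sum_rep_le ha hr subset_rfl
    _ = #Δ * (Λ * τ * N ^ 2) := by simp
    _ ≤ N * (Λ * τ * N ^ 2) := by gcongr; exact S.card_le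
    _ = _ := by ring

/-- The pairs of pairs parallel to the two legs of an element of `C`. -/
theorem card_cherries_mul_le {C : Finset (G × G × G)} {e : ℕ} {m M : ℝ}
    (hm : 0 ≤ m) (hM : 0 ≤ M) (he : 2 * e ≤ R)
    (hΔ : ∀ c ∈ C, c.1 ∈ Δ ∧ c.2.1 ∈ Δ ∧ c.2.2 ∈ Δ)
    (h₁ : ∀ c ∈ C, m ≤ rep B Δ e (c.1 - c.2.1)) (h₂ : ∀ c ∈ C, m ≤ rep B Δ e (c.1 - c.2.2))
    (hst : ∀ c ∈ C, (starRep B Δ (2 * e) c : ℝ) ≤ M) :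
    ∃ W ⊆ (Δ ×ˢ Δ) ×ˢ (Δ ×ˢ Δ), (∀ w ∈ W, ∃ c ∈ C, crossDiff w - (c.2.1 - c.2.2) ∈ B (2 * e)) ∧
      (#C : ℝ) * m ^ 2 ≤ #W * M := by
  -- A cherry is incident to the pairs of pairs parallel to its two legs, at least `m ^ 2` of them.
  -- Cherries incident to one `w` are translates of each other and are determined by their apex, so
  -- `starRep` bounds their number.
  obtain ⟨r, hr⟩ : ∃ r : G × G × G → (G × G) × (G × G) → Prop, ∀ c w, r c w ↔
      w.1.1 - w.1.2 - (c.1 - c.2.1) ∈ B e ∧ w.2.1 - w.2.2 - (c.1 - c.2.2) ∈ B e :=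
    ⟨_, fun _ _ => Iff.rfl⟩
  refine ⟨{w ∈ (Δ ×ˢ Δ) ×ˢ (Δ ×ˢ Δ) | ∃ c ∈ C, r c w}, filter_subset _ _, ?_, ?_⟩
  · intro w hw
    obtain ⟨_, c, hc, hcw⟩ := mem_filter.1 hw
    obtain ⟨h1, h2⟩ := (hr c w).1 hcw
    exact ⟨c, hc, S.ball.of_sub h2 h1 (by simp only [crossDiff]; abel) (by omega)⟩
  · refine card_mul_le_card_mul_of_rel C _ r hM (fun c hc => ?_) fun w hw c₀ hc₀ h₀ => ?_
    · have : ({p ∈ Δ ×ˢ Δ | p.1 - p.2 - (c.1 - c.2.1) ∈ B e}) ×ˢ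
          ({p ∈ Δ ×ˢ Δ | p.1 - p.2 - (c.1 - c.2.2) ∈ B e}) ⊆
          {w ∈ ({w ∈ (Δ ×ˢ Δ) ×ˢ (Δ ×ˢ Δ) | ∃ c ∈ C, r c w} : Finset _) | r c w} := by
        intro w hw
        obtain ⟨hw1, hw2⟩ := mem_product.1 hw
        obtain ⟨hw1, hw1'⟩ := mem_filter.1 hw1
        obtain ⟨hw2, hw2'⟩ := mem_filter.1 hw2
        exact mem_filter.2 ⟨mem_filter.2 ⟨mem_product.2 ⟨hw1, hw2⟩, c, hc,
          (hr c w).2 ⟨hw1', hw2'⟩⟩, (hr c w).2 ⟨hw1', hw2'⟩⟩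
      have h3 := card_le_card this
      rw [card_product] at h3
      have h4 : (rep B Δ e (c.1 - c.2.1) : ℝ) * rep B Δ e (c.1 - c.2.2) ≤
          #{w ∈ ({w ∈ (Δ ×ˢ Δ) ×ˢ (Δ ×ˢ Δ) | ∃ c ∈ C, r c w} : Finset _) | r c w} := by
        exact_mod_cast h3
      refine le_trans ?_ h4
      rw [sq]
      exact mul_le_mul (h₁ c hc) (h₂ c hc) hm (Nat.cast_nonneg _)
    · refine le_trans ?_ (hst c₀ hc₀)
      rw [hr] at h₀
      have : #{c ∈ C | r c w} ≤ starRep B Δ (2 * e) c₀ := by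
        refine card_le_card_of_injOn (fun c => c.1) (fun c hc => ?_) fun c hc c' hc' heq => ?_
        · simp only [coe_filter, Set.mem_ofPred_eq] at hc
          rw [hr] at hc
          obtain ⟨hcC, h1, h2⟩ := hc
          obtain ⟨d1, d2, d3⟩ := hΔ c hcC
          refine mem_filter.2 ⟨d1, ⟨c.2.1, d2, ?_⟩, ⟨c.2.2, d3, ?_⟩⟩
          · exact S.ball.of_sub h₀.1 h1 (by abel) (by omega)
          · exact S.ball.of_sub h₀.2 h2 (by abel) (by omega)
        · simp only [coe_filter, Set.mem_ofPred_eq] at hc hc'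
          rw [hr] at hc hc'
          obtain ⟨hcC, h1, h2⟩ := hc
          obtain ⟨hcC', h1', h2'⟩ := hc'
          dsimp only at heq
          obtain ⟨_, d2, d3⟩ := hΔ c hcC
          obtain ⟨_, d2', d3'⟩ := hΔ c' hcC'
          refine Prod.ext heq (Prod.ext ?_ ?_)
          · refine S.eq_of_sub_mem d2 d2' (r := 2 * e) ?_ he
            exact S.ball.of_sub h1 h1' (by rw [heq]; abel) (by omega)
          · refine S.eq_of_sub_mem d3 d3' (r := 2 * e) ?_ he
            exact S.ball.of_sub h2 h2' (by rw [heq]; abel) (by omega)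
      exact_mod_cast this

/-- Let W be the pairs of pairs parallel to the legs of cherries. The cross difference of each w ∈ W
is near some b - b', hence near the differences of at least θ pairs of the level set. Two elements
of W matched to the same pair have close cross differences, and such couples are counted by the
eightfold energy. Matching is at radius u + 2e, so comparing two matches costs 2u + 4e. -/
theorem sq_card_cherries_mul_le {C : Finset (G × G × G)} {e u : ℕ} {m M θ : ℝ}
    (hm : 0 ≤ m) (hM : 0 < M) (hθ : 0 < θ) (hR : 2 * u + 4 * e ≤ R)
    (hΔ : ∀ c ∈ C, c.1 ∈ Δ ∧ c.2.1 ∈ Δ ∧ c.2.2 ∈ Δ)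
    (h₁ : ∀ c ∈ C, m ≤ rep B Δ e (c.1 - c.2.1)) (h₂ : ∀ c ∈ C, m ≤ rep B Δ e (c.1 - c.2.2))
    (hst : ∀ c ∈ C, (starRep B Δ (2 * e) c : ℝ) ≤ M)
    (h₃ : ∀ c ∈ C, θ ≤ rep B Δ u (c.2.1 - c.2.2)) :
    (#C : ℝ) ^ 2 * m ^ 4 * θ ≤
      M ^ 2 * (Λ * τ ^ 3 * N ^ 7) * #(level B Δ (2 * u + 4 * e) θ) := by
  obtain ⟨W, hW, hWC, hcard⟩ := S.card_cherries_mul_le hm hM.le (by omega) hΔ h₁ h₂ hst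
  have key := sq_card_mul_le_of_incidence W (level B Δ (2 * u + 4 * e) θ)
    (fun w p => p.1 - p.2 - crossDiff w ∈ B (u + 2 * e)) hθ (fun w hw => ?_)
    {x ∈ ((Δ ×ˢ Δ) ×ˢ (Δ ×ˢ Δ)) ×ˢ ((Δ ×ˢ Δ) ×ˢ (Δ ×ˢ Δ)) |
      crossDiff x.1 - crossDiff x.2 ∈ B R} (fun w hw w' hw' p _ h h' => ?_)
  · have h4 : (#W : ℝ) ^ 2 * θ ≤ #(level B Δ (2 * u + 4 * e) θ) * (Λ * τ ^ 3 * N ^ 7) :=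
      key.trans (by gcongr; exact S.energy_le)
    calc (#C : ℝ) ^ 2 * m ^ 4 * θ = (#C * m ^ 2) ^ 2 * θ := by ring
      _ ≤ (#W * M) ^ 2 * θ := by gcongr
      _ = M ^ 2 * ((#W : ℝ) ^ 2 * θ) := by ring
      _ ≤ M ^ 2 * (#(level B Δ (2 * u + 4 * e) θ) * (Λ * τ ^ 3 * N ^ 7)) := by gcongr
      _ = _ := by ring
  · obtain ⟨c, hc, hcw⟩ := hWC w hw
    refine (h₃ c hc).trans ?_
    norm_cast
    refine card_le_card fun p hp => ?_
    obtain ⟨hpΔ, hp⟩ := mem_filter.1 hp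
    refine mem_filter.2 ⟨mem_filter.2 ⟨hpΔ, (h₃ c hc).trans ?_⟩, ?_⟩
    · norm_cast
      exact rep_mono S.ball (s := u) (by simpa using S.ball.neg hp) (by omega)
    · exact S.ball.of_sub hp hcw (by abel) (by omega)
  · refine mem_filter.2 ⟨mem_product.2 ⟨hW hw, hW hw'⟩, ?_⟩
    exact S.ball.of_sub h' h (by abel) (by omega)

end Setup

end Setup

/-! ### From popular differences to differences of popular differences. -/

section Cherries

variable {G : Type v} [AddCommGroup G]
variable {B : ℕ → Set G} {Δ : Finset G} {R : ℕ} {N τ Λ : ℝ}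

/-- A set of triples `(a, b, b')` in `Δ` such that `a - b` and `a - b'` have at least `ρ N`
representations and the triple has about `σ N` translates in `Δ`. -/
structure IsCherrySet (B : ℕ → Set G) (Δ : Finset G) (N : ℝ) (e : ℕ) (ρ σ : ℝ)
    (C : Finset (G × G × G)) : Prop where
  mem : ∀ c ∈ C, c.1 ∈ Δ ∧ c.2.1 ∈ Δ ∧ c.2.2 ∈ Δ
  left : ∀ c ∈ C, ρ * N ≤ rep B Δ e (c.1 - c.2.1)
  right : ∀ c ∈ C, ρ * N ≤ rep B Δ e (c.1 - c.2.2)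
  le_star : ∀ c ∈ C, σ * N ≤ starRep B Δ (2 * e) c
  star_le : ∀ c ∈ C, (starRep B Δ (2 * e) c : ℝ) ≤ 2 * σ * N

theorem IsCherrySet.subset {e : ℕ} {ρ σ : ℝ} {C C' : Finset (G × G × G)}
    (h : IsCherrySet B Δ N e ρ σ C) (hC : C' ⊆ C) : IsCherrySet B Δ N e ρ σ C' :=
  ⟨fun c hc => h.mem c (hC hc), fun c hc => h.left c (hC hc), fun c hc => h.right c (hC hc),
    fun c hc => h.le_star c (hC hc), fun c hc => h.star_le c (hC hc)⟩

namespace Setup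

variable (S : Setup B Δ R N τ Λ)
include S

theorem log_inv_le (j : ℕ) : Real.log (τ ^ 2 / Λ ^ j)⁻¹ ≤ (j + 2) * Λ := by
  have hτ := S.τ_pos
  have hΛ := S.Λ_pos
  have h1 := S.log_le
  have h2 : Real.log Λ ≤ Λ := (Real.log_le_sub_one_of_pos hΛ).trans (by linarith)
  rw [Real.log_inv] at h1 ⊢
  rw [Real.log_div (by positivity) (by positivity), Real.log_pow, Real.log_pow]
  push_cast
  have : (j : ℝ) * Real.log Λ ≤ j * Λ := by gcongr
  linarith

theorem exists_dyadic {α : Type*} (T : Finset α) (F : α → ℝ) {j : ℕ} (hj : j ≤ 20)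
    (hlo : ∀ x ∈ T, τ ^ 2 / Λ ^ j * N ≤ F x) (hF : ∀ x ∈ T, F x ≤ N) :
    ∃ ρ : ℝ, 0 < ρ ∧
      (#T : ℝ) ≤ Λ ^ 2 * #{x ∈ T | ρ * N ≤ F x ∧ F x ≤ 2 * ρ * N} := by
  have hτ := S.τ_pos
  have hΛ := S.Λ_pos
  have hN := S.N_pos
  have hj' : (j : ℝ) ≤ 20 := by exact_mod_cast hj
  obtain ⟨ρ, h1, -, h2⟩ := exists_dyadic_class T (fun x => F x / N) (fun _ => 1)
    (by simp) (lo := τ ^ 2 / Λ ^ j) (L := (j + 2) * Λ) (by positivity)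
    (fun x hx => by rw [le_div_iff₀ hN]; exact hlo x hx)
    (fun x hx => by rw [div_le_one hN]; exact hF x hx) (S.log_inv_le j) (by positivity)
  refine ⟨ρ, h1, ?_⟩
  have e : {x ∈ T | ρ ≤ F x / N ∧ F x / N ≤ 2 * ρ} =
      {x ∈ T | ρ * N ≤ F x ∧ F x ≤ 2 * ρ * N} := by
    refine filter_congr fun x _ => ?_
    rw [le_div_iff₀ hN, div_le_iff₀ hN]
  rw [e] at h2
  simp only [sum_const, nsmul_eq_mul, mul_one] at h2
  refine h2.trans ?_
  gcongr
  have := S.le_Λ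
  nlinarith

theorem starRep_le (r : ℕ) (x : G × G × G) : (starRep B Δ r x : ℝ) ≤ N :=
  le_trans (by exact_mod_cast card_le_card (filter_subset _ _)) S.card_le

/-- Cauchy–Schwarz over the apex produces many cherries. Those with very few translates are
negligible because there are at most N⁴ pairs of pairs, and a dyadic pigeonhole fixes σ for the
rest. -/
theorem exists_cherries {e : ℕ} {ρ : ℝ} (hρ : 0 < ρ) (hR : 2 * e ≤ R)
    (h : τ * N ^ 2 ≤ Λ * ρ * #(level B Δ e (ρ * N))) :
    ∃ σ : ℝ, 0 < σ ∧ ∃ C, IsCherrySet B Δ N e ρ σ C ∧ τ ^ 2 * N ^ 3 ≤ Λ ^ 5 * ρ ^ 2 * #C := by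
  have hτ := S.τ_pos
  have hΛ := S.Λ_pos
  have hΛ' := S.le_Λ
  have hN := S.N_pos
  set E := level B Δ e (ρ * N) with hE
  set C₀ : Finset (G × G × G) := {c ∈ Δ ×ˢ Δ ×ˢ Δ | (c.1, c.2.1) ∈ E ∧ (c.1, c.2.2) ∈ E} with hC₀
  have hmem : ∀ c ∈ C₀, c.1 ∈ Δ ∧ c.2.1 ∈ Δ ∧ c.2.2 ∈ Δ := fun c hc => by
    obtain ⟨h1, -⟩ := mem_filter.1 hc
    rw [mem_product, mem_product] at h1
    exact h1
  have hl : ∀ c ∈ C₀, ρ * N ≤ rep B Δ e (c.1 - c.2.1) := fun c hc =>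
    (mem_filter.1 (mem_filter.1 hc).2.1).2
  have hr : ∀ c ∈ C₀, ρ * N ≤ rep B Δ e (c.1 - c.2.2) := fun c hc =>
    (mem_filter.1 (mem_filter.1 hc).2.2).2
  have hcount : (#E : ℝ) ^ 2 ≤ N * #C₀ := by
    have h1 := sq_card_le_card_mul_card_fiber_pairs E Δ Prod.fst
      (fun p hp => (mem_product.1 (mem_filter.1 hp).1).1)
    refine h1.trans ?_
    have h2 : #{x ∈ E ×ˢ E | x.1.1 = x.2.1} ≤ #C₀ := by
      refine card_le_card_of_injOn (fun x => (x.1.1, x.1.2, x.2.2)) (fun x hx => ?_)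
        fun x hx y hy hxy => ?_
      · obtain ⟨hx1, hx2⟩ := mem_filter.1 hx
        obtain ⟨hx3, hx4⟩ := mem_product.1 hx1
        have h5 := mem_product.1 (mem_filter.1 hx3).1
        have h6 := mem_product.1 (mem_filter.1 hx4).1
        refine mem_filter.2 ⟨?_, hx3, ?_⟩
        · exact mem_product.2 ⟨h5.1, mem_product.2 ⟨h5.2, h6.2⟩⟩
        · dsimp only
          rw [hx2]; exact hx4
      · have hx2 := (mem_filter.1 hx).2
        have hy2 := (mem_filter.1 hy).2
        simp only [Prod.mk.injEq] at hxy
        refine Prod.ext (Prod.ext hxy.1 hxy.2.1) (Prod.ext ?_ hxy.2.2)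
        rw [← hx2, ← hy2, hxy.1]
    have h3 : (#{x ∈ E ×ˢ E | x.1.1 = x.2.1} : ℝ) ≤ #C₀ := by exact_mod_cast h2
    have := S.card_le
    gcongr
  -- With this threshold the discarded cherries are at most a proportion 1/Λ of `C₀`.
  set s₀ : ℝ := τ ^ 2 / Λ ^ 3 with hs₀
  have hs₀pos : 0 < s₀ := by positivity
  set Cs : Finset (G × G × G) := {c ∈ C₀ | ¬ s₀ * N ≤ starRep B Δ (2 * e) c} with hCs
  set C₁ : Finset (G × G × G) := {c ∈ C₀ | s₀ * N ≤ starRep B Δ (2 * e) c} with hC₁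
  have hsplit : (#C₁ : ℝ) + #Cs = #C₀ := by
    exact_mod_cast card_filter_add_card_filter_not (s := C₀) _
  have hCs_le : (#Cs : ℝ) * (ρ * N) ^ 2 ≤ N ^ 4 * (s₀ * N) := by
    obtain ⟨W, hW, -, hle⟩ := S.card_cherries_mul_le (C := Cs) (e := e) (m := ρ * N)
      (M := s₀ * N) (by positivity) (by positivity) hR
      (fun c hc => hmem c (filter_subset _ _ hc)) (fun c hc => hl c (filter_subset _ _ hc))
      (fun c hc => hr c (filter_subset _ _ hc)) (fun c hc => (not_le.1 (mem_filter.1 hc).2).le)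
    refine hle.trans ?_
    have h1 : (#W : ℝ) ≤ (#Δ : ℝ) ^ 4 := by
      have := card_le_card hW
      simp only [card_product] at this
      calc (#W : ℝ) ≤ ((#Δ * #Δ * (#Δ * #Δ) : ℕ) : ℝ) := by exact_mod_cast this
        _ = _ := by push_cast; ring
    have h2 : (#Δ : ℝ) ^ 4 ≤ N ^ 4 := by have := S.card_le; gcongr
    have := h1.trans h2
    gcongr
  have hC₀_ge : τ ^ 2 * N ^ 3 ≤ Λ ^ 2 * ρ ^ 2 * #C₀ := by
    have h1 : (τ * N ^ 2) ^ 2 ≤ (Λ * ρ * #E) ^ 2 := by gcongr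
    have h2 : Λ ^ 2 * ρ ^ 2 * (#E : ℝ) ^ 2 ≤ Λ ^ 2 * ρ ^ 2 * (N * #C₀) := by gcongr
    have h3 : N * (τ ^ 2 * N ^ 3) ≤ N * (Λ ^ 2 * ρ ^ 2 * #C₀) := by nlinarith
    exact le_of_mul_le_mul_left h3 hN
  have hhalf : (#C₀ : ℝ) ≤ 2 * #C₁ := by
    have h1 : (#Cs : ℝ) * ρ ^ 2 ≤ N ^ 3 * s₀ := by
      have : N ^ 2 * ((#Cs : ℝ) * ρ ^ 2) ≤ N ^ 2 * (N ^ 3 * s₀) := by nlinarith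
      exact le_of_mul_le_mul_left this (by positivity)
    have h2 : Λ ^ 3 * (N ^ 3 * s₀) = τ ^ 2 * N ^ 3 := by
      rw [hs₀]; field_simp
    have h3 : Λ ^ 3 * ρ ^ 2 * (#Cs : ℝ) ≤ Λ ^ 2 * ρ ^ 2 * #C₀ := by nlinarith [pow_pos hΛ 3]
    have h4 : Λ * (#Cs : ℝ) ≤ #C₀ := by
      have : (Λ ^ 2 * ρ ^ 2) * (Λ * (#Cs : ℝ)) ≤ (Λ ^ 2 * ρ ^ 2) * #C₀ := by linarith
      exact le_of_mul_le_mul_left this (by positivity)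
    have h5 : (0 : ℝ) ≤ #Cs := Nat.cast_nonneg _
    nlinarith
  obtain ⟨σ, hσ, hd⟩ := S.exists_dyadic C₁ (fun c => (starRep B Δ (2 * e) c : ℝ)) (j := 3)
    (by norm_num) (fun c hc => (mem_filter.1 hc).2) (fun c _ => S.starRep_le _ c)
  set C : Finset (G × G × G) := {x ∈ C₁ | σ * N ≤ (starRep B Δ (2 * e) x : ℝ) ∧
    (starRep B Δ (2 * e) x : ℝ) ≤ 2 * σ * N}
  have hC : C ⊆ C₀ := (filter_subset _ _).trans (filter_subset _ _)
  refine ⟨σ, hσ, C, ⟨fun c hc => hmem c (hC hc), fun c hc => hl c (hC hc),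
    fun c hc => hr c (hC hc), fun c hc => (mem_filter.1 hc).2.1,
    fun c hc => (mem_filter.1 hc).2.2⟩, ?_⟩
  calc τ ^ 2 * N ^ 3 ≤ Λ ^ 2 * ρ ^ 2 * #C₀ := hC₀_ge
    _ ≤ Λ ^ 2 * ρ ^ 2 * (2 * (Λ ^ 2 * #C)) := by gcongr; exact hhalf.trans (by gcongr)
    _ = 2 * (Λ ^ 4 * ρ ^ 2 * #C) := by ring
    _ ≤ Λ * (Λ ^ 4 * ρ ^ 2 * #C) := by gcongr; linarith
    _ = _ := by ring

/-- The difference b - b' has at least as many representations as the cherry has translates, so θ =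
σN is allowed. The count of cherries cancels every power of ρ. Translates use radius 2e, hence b -
b' uses u = 4e, and 2u + 4e = 12e. -/
theorem level_of_cherries {e : ℕ} {ρ σ : ℝ} (hρ : 0 < ρ) (hσ : 0 < σ) (hR : 12 * e ≤ R)
    {C : Finset (G × G × G)} (hC : IsCherrySet B Δ N e ρ σ C)
    (h : τ ^ 2 * N ^ 3 ≤ Λ ^ 5 * ρ ^ 2 * #C) :
    τ * N ^ 2 ≤ Λ ^ 12 * σ * #(level B Δ (12 * e) (σ * N)) := by
  have hτ := S.τ_pos
  have hΛ := S.Λ_pos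
  have hΛ' := S.le_Λ
  have hN := S.N_pos
  have key := S.sq_card_cherries_mul_le (C := C) (e := e) (u := 4 * e) (m := ρ * N)
    (M := 2 * σ * N) (θ := σ * N) (by positivity) (by positivity) (by positivity) (by omega)
    hC.mem hC.left hC.right hC.star_le fun c hc => (hC.le_star c hc).trans (by
      have := S.starRep_le_rep (r := 2 * e) (by omega) c
      rw [show 2 * (2 * e) = 4 * e by ring] at this
      exact_mod_cast this)
  rw [show 2 * (4 * e) + 4 * e = 12 * e by ring] at key
  set L : ℝ := (#(level B Δ (12 * e) (σ * N)) : ℝ)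
  have h1 : (τ ^ 2 * N ^ 3) ^ 2 ≤ (Λ ^ 5 * ρ ^ 2 * #C) ^ 2 := by gcongr
  have h2 : (τ ^ 2 * N ^ 3) ^ 2 * (σ * N ^ 5) ≤
      Λ ^ 10 * ((2 * σ * N) ^ 2 * (Λ * τ ^ 3 * N ^ 7) * L) := by
    calc _ ≤ (Λ ^ 5 * ρ ^ 2 * #C) ^ 2 * (σ * N ^ 5) := by gcongr
      _ = Λ ^ 10 * ((#C : ℝ) ^ 2 * (ρ * N) ^ 4 * (σ * N)) := by ring
      _ ≤ _ := by gcongr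
  have h3 : (τ ^ 3 * N ^ 9 * σ) * (τ * N ^ 2) ≤ (τ ^ 3 * N ^ 9 * σ) * (4 * Λ ^ 11 * σ * L) := by
    nlinarith
  have h4 := le_of_mul_le_mul_left h3 (by positivity)
  have hL : 0 ≤ L := Nat.cast_nonneg _
  calc _ ≤ _ := h4
    _ ≤ Λ * Λ ^ 11 * σ * L := by gcongr; linarith
    _ = _ := by ring

end Setup

end Cherries

/-! ### Selecting a superlevel set. -/

section LayerCake

variable {α β : Type*}

/-- Since min(f, f') is the sum over k of 1[k < f] 1[k < f'], one averages over the K levels. Half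
of Ψ pays for the term proportional to the superlevel set, the other half for the constant term. The
first will make X nearly symmetric and the second will make X large. -/
theorem exists_superlevel (S : Finset α) (X₀ : Finset β) (g₁ g₂ : α → β) (f : β → ℕ) {K : ℕ}
    {Ψ c : ℝ} (hg₁ : ∀ s ∈ S, g₁ s ∈ X₀) (hf : ∀ x ∈ X₀, f x ≤ K)
    (hΨ : 0 < Ψ) (h : Ψ ≤ ∑ s ∈ S, (min (f (g₁ s)) (f (g₂ s)) : ℝ))
    (hc : c * ∑ x ∈ X₀, (f x : ℝ) ≤ Ψ / 2) :
    0 < K ∧ ∃ k, c * #{x ∈ X₀ | k < f x} + Ψ / (2 * K) ≤ #{s ∈ S | k < f (g₁ s) ∧ k < f (g₂ s)} := by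
  have h₁ : ∀ m : ℕ, m ≤ K → ∑ k ∈ range K, (if k < m then 1 else 0 : ℝ) = m := by
    intro m hm
    rw [← sum_filter, sum_const, nsmul_eq_mul, mul_one]
    have : {k ∈ range K | k < m} = range m := by
      ext k; simp only [mem_filter, mem_range]; omega
    rw [this, card_range]
  have h₂ : ∑ k ∈ range K, (#{x ∈ X₀ | k < f x} : ℝ) = ∑ x ∈ X₀, (f x : ℝ) := by
    simp only [card_filter, Nat.cast_sum, Nat.cast_ite, Nat.cast_one, Nat.cast_zero]
    rw [sum_comm]
    exact sum_congr rfl fun x hx => h₁ _ (hf x hx)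
  have h₃ : ∑ k ∈ range K, (#{s ∈ S | k < f (g₁ s) ∧ k < f (g₂ s)} : ℝ) =
      ∑ s ∈ S, (min (f (g₁ s)) (f (g₂ s)) : ℝ) := by
    simp only [card_filter, Nat.cast_sum, Nat.cast_ite, Nat.cast_one, Nat.cast_zero]
    rw [sum_comm]
    refine sum_congr rfl fun s hs => ?_
    rw [← Nat.cast_min, ← h₁ _ (le_trans (min_le_left _ _) (hf _ (hg₁ s hs)))]
    simp only [lt_min_iff]
  have hK : 0 < K := by
    rcases Nat.eq_zero_or_pos K with rfl | hK
    · rw [← h₃] at h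
      simp at h
      linarith
    · exact hK
  have hK' : (0 : ℝ) < K := by exact_mod_cast hK
  obtain ⟨k, -, hk⟩ := exists_le_of_sum_le (s := range K) (nonempty_range_iff.2 hK.ne')
    (f := fun k => c * (#{x ∈ X₀ | k < f x} : ℝ) + Ψ / (2 * K))
    (g := fun k => (#{s ∈ S | k < f (g₁ s) ∧ k < f (g₂ s)} : ℝ)) (by
      rw [sum_add_distrib, ← mul_sum, h₂, h₃, sum_const, card_range, nsmul_eq_mul]
      have : (K : ℝ) * (Ψ / (2 * K)) = Ψ / 2 := by field_simp
      linarith)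
  exact ⟨hK, k, hk⟩

end LayerCake

/-! ### Cherries at a fixed apex. -/

section Local

variable {G : Type v} [AddCommGroup G]
variable {B : ℕ → Set G} {Δ : Finset G} {R : ℕ} {N τ Λ : ℝ}

/-- An element of `Δ` completing `c` to a pair with `c - d` close to `z`, if there is one. -/
noncomputable def partner (B : ℕ → Set G) (Δ : Finset G) (r : ℕ) (z c : G) : G :=
  if h : HasPartner B Δ r z c then h.choose else 0

theorem HasPartner.partner_mem {r : ℕ} {z c : G} (h : HasPartner B Δ r z c) :
    partner B Δ r z c ∈ Δ := by
  rw [partner, dif_pos h]; exact h.choose_spec.1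

theorem HasPartner.partner_near {r : ℕ} {z c : G} (h : HasPartner B Δ r z c) :
    c - partner B Δ r z c - z ∈ B r := by
  rw [partner, dif_pos h]; exact h.choose_spec.2

theorem rep_neg_le (hB : IsBallFamily B) (r : ℕ) (z : G) : rep B Δ r z ≤ rep B Δ r (-z) := by
  refine card_le_card_of_injOn Prod.swap (fun p hp => ?_) Prod.swap_injective.injOn
  obtain ⟨h1, h2⟩ := mem_filter.1 hp
  refine mem_filter.2 ⟨mem_product.2 (mem_product.1 h1).symm, ?_⟩
  have := hB.neg h2
  simp only [Prod.fst_swap, Prod.snd_swap]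
  convert this using 1
  abel

/-- Pairs `p` in `Δ` such that `a - p.1` and `a - p.2` have many representations, `(a, p)` has
about `σ N` translates in `Δ`, and `p.1 - p.2` has not many more representations. -/
structure IsLocal (B : ℕ → Set G) (Δ : Finset G) (N Λ : ℝ) (e : ℕ) (ρ σ : ℝ) (a : G)
    (P : Finset (G × G)) : Prop where
  mem : ∀ p ∈ P, p.1 ∈ Δ ∧ p.2 ∈ Δ
  right : ∀ p ∈ P, ρ * N ≤ rep B Δ e (a - p.2)
  le_star : ∀ p ∈ P, σ * N ≤ starRep B Δ (2 * e) (a, p)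
  star_le : ∀ p ∈ P, (starRep B Δ (2 * e) (a, p) : ℝ) ≤ 2 * σ * N
  rep_le : ∀ p ∈ P, (rep B Δ (12 * e) (p.1 - p.2) : ℝ) ≤ Λ ^ 7 * (σ * N)

/-- The number of pairs in `P` parallel to `p`. -/
noncomputable def parallelCount (B : ℕ → Set G) (e : ℕ) (P : Finset (G × G)) (p : G × G) : ℕ :=
  #{q ∈ P | q.1 - q.2 - (p.1 - p.2) ∈ B (8 * e)}

/-- The translates of the triples `(a, p)` for `p ∈ P`, given by the first coordinate. -/
noncomputable def translates (B : ℕ → Set G) (Δ : Finset G) (e : ℕ) (a : G)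
    (P : Finset (G × G)) : Finset (G × G × G) :=
  {t ∈ Δ ×ˢ P | HasPartner B Δ (2 * e) (a - t.2.1) t.1 ∧ HasPartner B Δ (2 * e) (a - t.2.2) t.1}

theorem translates_fiber {e : ℕ} {a : G} {P : Finset (G × G)} {p : G × G} (hp : p ∈ P) :
    #{t ∈ translates B Δ e a P | t.2 = p} = starRep B Δ (2 * e) (a, p) := by
  refine card_bij (fun t _ => t.1) (fun t ht => ?_) (fun t ht s hs hts => ?_) fun c hc => ?_
  · obtain ⟨h1, rfl⟩ := mem_filter.1 ht
    obtain ⟨h1, h2⟩ := mem_filter.1 h1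
    exact mem_filter.2 ⟨(mem_product.1 h1).1, h2⟩
  · exact Prod.ext hts ((mem_filter.1 ht).2.trans (mem_filter.1 hs).2.symm)
  · obtain ⟨h1, h2⟩ := mem_filter.1 hc
    exact ⟨(c, p), mem_filter.2 ⟨mem_filter.2 ⟨mem_product.2 ⟨h1, hp⟩, h2⟩, rfl⟩, rfl⟩

namespace Setup

variable (S : Setup B Δ R N τ Λ)
include S

-- Few cherries have b - b' much more popular than σN: for these, θ = Λ⁷σN in the energy estimate,
-- and the first-moment bound on the level set at that height wins back enough powers of Λ. Here u =
-- 12e, so the radius is 2u + 4e = 28e. The apex is then chosen by pigeonhole.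
set_option maxHeartbeats 1000000 in
theorem exists_local {e : ℕ} {ρ σ : ℝ} (hρ : 0 < ρ) (hσ : 0 < σ) (hR : 28 * e ≤ R)
    {C : Finset (G × G × G)} (hC : IsCherrySet B Δ N e ρ σ C)
    (h : τ ^ 2 * N ^ 3 ≤ Λ ^ 5 * ρ ^ 2 * #C) :
    ∃ a ∈ Δ, ∃ P, IsLocal B Δ N Λ e ρ σ a P ∧ τ ^ 2 * N ^ 2 ≤ Λ ^ 6 * ρ ^ 2 * #P := by
  have hτ := S.τ_pos
  have hΛ := S.Λ_pos
  have hΛ' := S.le_Λ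
  have hN := S.N_pos
  set Cb : Finset (G × G × G) :=
    {c ∈ C | ¬ (rep B Δ (12 * e) (c.2.1 - c.2.2) : ℝ) ≤ Λ ^ 7 * (σ * N)} with hCb
  set C₁ : Finset (G × G × G) :=
    {c ∈ C | (rep B Δ (12 * e) (c.2.1 - c.2.2) : ℝ) ≤ Λ ^ 7 * (σ * N)} with hC₁
  have hsplit : (#C₁ : ℝ) + #Cb = #C := by
    exact_mod_cast card_filter_add_card_filter_not (s := C) _
  have hCb' := hC.subset (C' := Cb) (filter_subset _ _)
  have key := S.sq_card_cherries_mul_le (C := Cb) (e := e) (u := 12 * e) (m := ρ * N)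
    (M := 2 * σ * N) (θ := Λ ^ 7 * (σ * N)) (by positivity) (by positivity) (by positivity)
    (by omega) hCb'.mem hCb'.left hCb'.right hCb'.star_le
    fun c hc => (not_le.1 (mem_filter.1 hc).2).le
  rw [show 2 * (12 * e) + 4 * e = 28 * e by ring] at key
  have key₂ := S.card_level_mul_le hR (Λ ^ 7 * (σ * N))
  set L : ℝ := (#(level B Δ (28 * e) (Λ ^ 7 * (σ * N))) : ℝ)
  have h1 : (#Cb : ℝ) ^ 2 * ρ ^ 4 * Λ ^ 12 ≤ (2 * τ ^ 2 * N ^ 3) ^ 2 := by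
    have h2 : (#Cb : ℝ) ^ 2 * (ρ * N) ^ 4 * (Λ ^ 7 * (σ * N)) * (Λ ^ 7 * (σ * N)) ≤
        (2 * σ * N) ^ 2 * (Λ * τ ^ 3 * N ^ 7) * (Λ * τ * N ^ 3) := by
      calc _ ≤ (2 * σ * N) ^ 2 * (Λ * τ ^ 3 * N ^ 7) * L * (Λ ^ 7 * (σ * N)) := by gcongr
        _ = (2 * σ * N) ^ 2 * (Λ * τ ^ 3 * N ^ 7) * (L * (Λ ^ 7 * (σ * N))) := by ring
        _ ≤ _ := by gcongr
    have h3 : (N ^ 6 * σ ^ 2 * Λ ^ 2) * ((#Cb : ℝ) ^ 2 * ρ ^ 4 * Λ ^ 12) ≤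
        (N ^ 6 * σ ^ 2 * Λ ^ 2) * (2 * τ ^ 2 * N ^ 3) ^ 2 := by
      linarith
    exact le_of_mul_le_mul_left h3 (by positivity)
  have h2 : (#Cb : ℝ) * ρ ^ 2 * Λ ^ 6 ≤ 2 * τ ^ 2 * N ^ 3 := by
    refine le_of_sq_le_sq ?_ (by positivity)
    linarith
  have h3 : 2 * (#Cb : ℝ) ≤ #C := by
    have h4 : (Λ ^ 5 * ρ ^ 2) * (Λ * (#Cb : ℝ)) ≤ (Λ ^ 5 * ρ ^ 2) * (2 * #C) := by linarith
    have h5 := le_of_mul_le_mul_left h4 (by positivity)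
    have h6 : (0 : ℝ) ≤ #Cb := Nat.cast_nonneg _
    nlinarith
  have hC₁pos : (#C : ℝ) ≤ 2 * #C₁ := by linarith
  obtain ⟨a, ha, hcard⟩ : ∃ a ∈ Δ, (#C₁ : ℝ) ≤ N * #{c ∈ C₁ | c.1 = a} := by
    by_contra! hcon
    have hmaps : ∀ c ∈ C₁, c.1 ∈ Δ := fun c hc => (hC.mem c (filter_subset _ _ hc)).1
    have h5 : (#C₁ : ℝ) = ∑ a ∈ Δ, (#{c ∈ C₁ | c.1 = a} : ℝ) := by
      exact_mod_cast card_eq_sum_card_fiberwise hmaps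
    have hne : Δ.Nonempty := by
      rcases C₁.eq_empty_or_nonempty with h6 | ⟨c, hc⟩
      · rw [h6] at hC₁pos
        simp only [card_empty, Nat.cast_zero, mul_zero] at hC₁pos
        have : 0 < τ ^ 2 * N ^ 3 := by positivity
        have h7 : Λ ^ 5 * ρ ^ 2 * (#C : ℝ) ≤ 0 :=
          mul_nonpos_of_nonneg_of_nonpos (by positivity) hC₁pos
        linarith
      · exact ⟨_, hmaps c hc⟩
    have h6 : N * (#C₁ : ℝ) < #Δ * #C₁ := by
      calc N * (#C₁ : ℝ) = ∑ a ∈ Δ, N * (#{c ∈ C₁ | c.1 = a} : ℝ) := by rw [h5, mul_sum]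
        _ < ∑ a ∈ Δ, (#C₁ : ℝ) := sum_lt_sum_of_nonempty hne hcon
        _ = _ := by simp
    have h7 : (#Δ : ℝ) * #C₁ ≤ N * #C₁ := by have := S.card_le; gcongr
    linarith
  set P : Finset (G × G) := {p ∈ Δ ×ˢ Δ | (a, p) ∈ C₁} with hP
  have hPC : ∀ p ∈ P, (a, p) ∈ C₁ := fun p hp => (mem_filter.1 hp).2
  have hPC' : ∀ p ∈ P, (a, p) ∈ C := fun p hp => filter_subset _ _ (hPC p hp)
  refine ⟨a, ha, P, ⟨fun p hp => mem_product.1 (mem_filter.1 hp).1,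
    fun p hp => hC.right (a, p) (hPC' p hp), fun p hp => hC.le_star (a, p) (hPC' p hp),
    fun p hp => hC.star_le (a, p) (hPC' p hp), fun p hp => ?_⟩, ?_⟩
  · have h5 := hPC p hp
    rw [hC₁, mem_filter] at h5
    exact h5.2
  have hle : #{c ∈ C₁ | c.1 = a} ≤ #P := by
    refine card_le_card_of_injOn Prod.snd (fun c hc => ?_) fun c hc c' hc' hcc => ?_
    · obtain ⟨h5, rfl⟩ := mem_filter.1 hc
      obtain ⟨-, h6⟩ := hC.mem c (filter_subset _ _ h5)
      exact mem_filter.2 ⟨mem_product.2 h6, h5⟩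
    · exact Prod.ext ((mem_filter.1 hc).2.trans (mem_filter.1 hc').2.symm) hcc
  have hle' : (#{c ∈ C₁ | c.1 = a} : ℝ) ≤ #P := by exact_mod_cast hle
  have h5 : N * (τ ^ 2 * N ^ 2) ≤ N * (Λ ^ 6 * ρ ^ 2 * #P) := by
    calc N * (τ ^ 2 * N ^ 2) = τ ^ 2 * N ^ 3 := by ring
      _ ≤ Λ ^ 5 * ρ ^ 2 * #C := h
      _ ≤ Λ ^ 5 * ρ ^ 2 * (2 * (N * #P)) := by
          gcongr
          refine hC₁pos.trans (mul_le_mul_of_nonneg_left (hcard.trans ?_) (by norm_num))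
          gcongr
      _ = N * (2 * Λ ^ 5 * ρ ^ 2 * #P) := by ring
      _ ≤ N * (Λ * Λ ^ 5 * ρ ^ 2 * #P) := by gcongr; linarith
      _ = _ := by ring
  exact le_of_mul_le_mul_left h5 hN

section Base

variable {e : ℕ} {ρ σ : ℝ} {a : G} {P : Finset (G × G)} (L : IsLocal B Δ N Λ e ρ σ a P)
include L

omit S L in
theorem mem_translates {t : G × G × G} {Q : Finset (G × G)} (ht : t ∈ translates B Δ e a Q) :
    t.1 ∈ Δ ∧ t.2 ∈ Q ∧ HasPartner B Δ (2 * e) (a - t.2.1) t.1 ∧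
      HasPartner B Δ (2 * e) (a - t.2.2) t.1 := by
  obtain ⟨h1, h2, h3⟩ := mem_filter.1 ht
  exact ⟨(mem_product.1 h1).1, (mem_product.1 h1).2, h2, h3⟩

omit L in
theorem partner_injective (hR : 4 * e ≤ R) {b c c' : G} (hc : c ∈ Δ) (hc' : c' ∈ Δ)
    (h : HasPartner B Δ (2 * e) (a - b) c) (h' : HasPartner B Δ (2 * e) (a - b) c')
    (heq : partner B Δ (2 * e) (a - b) c = partner B Δ (2 * e) (a - b) c') : c = c' := by
  refine S.eq_of_sub_mem hc hc' (r := 4 * e) ?_ hR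
  refine S.ball.of_sub h.partner_near h'.partner_near ?_ (by omega)
  rw [heq]; abel

omit L in
theorem partner_sub_partner {b b' c : G}
    (h : HasPartner B Δ (2 * e) (a - b) c) (h' : HasPartner B Δ (2 * e) (a - b') c) :
    b - b' - (partner B Δ (2 * e) (a - b) c - partner B Δ (2 * e) (a - b') c) ∈ B (4 * e) :=
  S.ball.of_sub h.partner_near h'.partner_near (by abel) (by omega)

-- The two partners fix b - b' up to a ball, so triples with the same partners lie over parallel
-- pairs. Once (b, b') is given, separation recovers c from its partner.
omit L in
theorem translates_partner_fiber_le (hR : 4 * e ≤ R) {Q : Finset (G × G)} (hQ : Q ⊆ P)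
    {M : ℝ} (hM : 0 ≤ M) (hQM : ∀ p ∈ Q, (parallelCount B e P p : ℝ) ≤ M) (x x' : G) :
    (#{t ∈ translates B Δ e a Q | partner B Δ (2 * e) (a - t.2.1) t.1 = x ∧
      partner B Δ (2 * e) (a - t.2.2) t.1 = x'} : ℝ) ≤ M := by
  set F := {t ∈ translates B Δ e a Q | partner B Δ (2 * e) (a - t.2.1) t.1 = x ∧
      partner B Δ (2 * e) (a - t.2.2) t.1 = x'} with hF
  rcases F.eq_empty_or_nonempty with h | ⟨t₀, ht₀⟩
  · rw [h]; simpa using hM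
  obtain ⟨ht₀, hx₀, hx₀'⟩ := mem_filter.1 ht₀
  obtain ⟨-, hq₀, h₀, h₀'⟩ := mem_translates ht₀
  refine le_trans ?_ (hQM _ hq₀)
  have : #F ≤ parallelCount B e P t₀.2 := by
    refine card_le_card_of_injOn Prod.snd (fun t ht => ?_) fun t ht s hs hts => ?_
    · obtain ⟨ht, hx, hx'⟩ := mem_filter.1 ht
      obtain ⟨-, hq, h, h'⟩ := mem_translates ht
      refine mem_filter.2 ⟨hQ hq, ?_⟩
      have h1 := S.partner_sub_partner h h'
      have h2 := S.partner_sub_partner h₀ h₀'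
      rw [hx, hx'] at h1
      rw [hx₀, hx₀'] at h2
      exact S.ball.of_sub h1 h2 (by abel) (by omega)
    · obtain ⟨ht, hx, hx'⟩ := mem_filter.1 ht
      obtain ⟨hs, hy, hy'⟩ := mem_filter.1 hs
      obtain ⟨htΔ, -, h, h'⟩ := mem_translates ht
      obtain ⟨hsΔ, -, k, k'⟩ := mem_translates hs
      refine Prod.ext (S.partner_injective (b := t.2.1) hR htΔ hsΔ h (hts ▸ k) ?_) hts
      rw [hx, hts, hy]
  exact_mod_cast this

omit S in
theorem le_card_translates {Q : Finset (G × G)} (hQ : Q ⊆ P) :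
    (#Q : ℝ) * (σ * N) ≤ #(translates B Δ e a Q) := by
  have := card_mul_le_card_mul_of_rel Q (translates B Δ e a Q) (fun p t => t.2 = p)
    (m := σ * N) (M := 1) zero_le_one (fun p hp => by
      rw [translates_fiber hp]; exact L.le_star p (hQ hp))
    (fun t ht p hp h => by
      have : #{p' ∈ Q | t.2 = p'} ≤ 1 := card_le_one.2 fun x hx y hy =>
        (mem_filter.1 hx).2.symm.trans (mem_filter.1 hy).2
      exact_mod_cast this)
  simpa using this

/-- A pair in `P` has at least σN translates, each giving a pair of partners in Δ × Δ, and the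
fibres of this map are bounded by the number of parallel pairs. Thus few pairs have few parallels,
and the others are pigeonholed dyadically. -/
theorem exists_regular_parallelCount (hR : 16 * e ≤ R) (hρ : 0 < ρ) (hσ : 0 < σ)
    (hρσ : ρ ≤ Λ * σ) (hcard : τ ^ 2 * N ^ 2 ≤ Λ ^ 6 * ρ ^ 2 * #P) :
    ∃ n : ℝ, 0 < n ∧ ∃ Q ⊆ P, (∀ p ∈ Q, n ≤ parallelCount B e P p ∧
      (parallelCount B e P p : ℝ) ≤ 2 * n) ∧ (#P : ℝ) ≤ 2 * Λ ^ 2 * #Q := by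
  have hτ := S.τ_pos
  have hΛ := S.Λ_pos
  have hΛ' := S.le_Λ
  have hN := S.N_pos
  have hPpos : (0 : ℝ) < #P := by
    by_contra! h0
    have h1 : Λ ^ 6 * ρ ^ 2 * (#P : ℝ) ≤ 0 :=
      mul_nonpos_of_nonneg_of_nonpos (by positivity) h0
    have : 0 < τ ^ 2 * N ^ 2 := by positivity
    linarith
  have hρ1 : ρ ≤ 1 := by
    obtain ⟨p, hp⟩ := card_pos.1 (by exact_mod_cast hPpos : 0 < #P)
    have := (L.right p hp).trans (S.rep_le (by omega) _)
    nlinarith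
  set n₀ : ℝ := τ ^ 2 / Λ ^ 8 * N with hn₀
  set Ps : Finset (G × G) := {p ∈ P | ¬ n₀ ≤ parallelCount B e P p} with hPs
  set P₁ : Finset (G × G) := {p ∈ P | n₀ ≤ parallelCount B e P p} with hP₁
  have hsplit : (#P₁ : ℝ) + #Ps = #P := by
    exact_mod_cast card_filter_add_card_filter_not (s := P) _
  have hsmall : (#Ps : ℝ) * (σ * N) ≤ N ^ 2 * n₀ := by
    refine (le_card_translates L (Q := Ps) (filter_subset _ _)).trans ?_
    have := card_mul_le_card_mul_of_rel (translates B Δ e a Ps) (Δ ×ˢ Δ)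
      (fun t x => partner B Δ (2 * e) (a - t.2.1) t.1 = x.1 ∧
        partner B Δ (2 * e) (a - t.2.2) t.1 = x.2) (m := 1) (M := n₀) (by positivity)
      (fun t ht => by
        obtain ⟨-, -, h, h'⟩ := mem_translates ht
        have : 0 < #{x ∈ Δ ×ˢ Δ | partner B Δ (2 * e) (a - t.2.1) t.1 = x.1 ∧
            partner B Δ (2 * e) (a - t.2.2) t.1 = x.2} :=
          card_pos.2 ⟨(_, _), mem_filter.2
            ⟨mem_product.2 ⟨h.partner_mem, h'.partner_mem⟩, rfl, rfl⟩⟩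
        exact_mod_cast this)
      (fun x _ _ _ _ => S.translates_partner_fiber_le (by omega) (Q := Ps) (filter_subset _ _)
        (by positivity) (fun p hp => (not_le.1 (mem_filter.1 hp).2).le) x.1 x.2)
    rw [mul_one, card_product] at this
    refine this.trans ?_
    have h1 := S.card_le
    push_cast
    rw [sq]
    gcongr
  have hhalf : (#P : ℝ) ≤ 2 * #P₁ := by
    have h1 : Λ ^ 8 * (N ^ 2 * n₀) = τ ^ 2 * N ^ 2 * N := by rw [hn₀]; field_simp
    have h2 : Λ ^ 8 * (#Ps : ℝ) * σ * N ≤ Λ ^ 6 * ρ ^ 2 * #P * N := by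
      nlinarith [pow_pos hΛ 8]
    have h3 : Λ ^ 8 * (#Ps : ℝ) * σ ≤ Λ ^ 6 * ρ ^ 2 * #P := le_of_mul_le_mul_right h2 hN
    have h4 : ρ ^ 2 ≤ Λ * σ := by nlinarith
    have h5 : (Λ ^ 7 * σ) * (Λ * #Ps) ≤ (Λ ^ 7 * σ) * #P := by
      calc _ = Λ ^ 8 * (#Ps : ℝ) * σ := by ring
        _ ≤ Λ ^ 6 * ρ ^ 2 * #P := h3
        _ ≤ Λ ^ 6 * (Λ * σ) * #P := by gcongr
        _ = _ := by ring
    have h6 := le_of_mul_le_mul_left h5 (by positivity)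
    have h7 : (0 : ℝ) ≤ #Ps := Nat.cast_nonneg _
    nlinarith
  obtain ⟨s, hs, hd⟩ := S.exists_dyadic P₁ (fun p => (parallelCount B e P p : ℝ)) (j := 8)
    (by norm_num) (fun p hp => (mem_filter.1 hp).2) (fun p hp => by
      have : parallelCount B e P p ≤ #Δ := by
        refine card_le_card_of_injOn Prod.fst (fun q hq => ?_) fun q hq q' hq' hqq => ?_
        · exact (L.mem q (mem_filter.1 hq).1).1
        · obtain ⟨h1, h2⟩ := mem_filter.1 hq
          obtain ⟨h1', h2'⟩ := mem_filter.1 hq'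
          refine Prod.ext hqq ?_
          refine S.eq_of_sub_mem (L.mem q h1).2 (L.mem q' h1').2 (r := 16 * e) ?_ hR
          exact S.ball.of_sub h2' h2 (by rw [hqq]; abel) (by omega)
      exact le_trans (by exact_mod_cast this) S.card_le)
  set Q : Finset (G × G) := {p ∈ P₁ | s * N ≤ (parallelCount B e P p : ℝ) ∧
    (parallelCount B e P p : ℝ) ≤ 2 * s * N}
  refine ⟨s * N, by positivity, Q, (filter_subset _ _).trans (filter_subset _ _),
    fun p hp => ⟨(mem_filter.1 hp).2.1, (mem_filter.1 hp).2.2.trans_eq (by ring)⟩, ?_⟩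
  linarith

end Base

end Setup

end Local

/-! ### Regularising the set of translates. -/

section Regular

variable {G : Type v} [AddCommGroup G]
variable {B : ℕ → Set G} {Δ : Finset G} {R : ℕ} {N τ Λ : ℝ}

/-- A set of translates of triples `(a, p)` with `p ∈ P`, regular under its projections, in which
each `p` has at most `2 n` parallel pairs in `P`. -/
structure IsRegular (B : ℕ → Set G) (Δ : Finset G) (e : ℕ) (a : G) (P : Finset (G × G))
    (Ω : Finset (G × G × G)) (θ₁ θ₂ n : ℝ) : Prop where
  subset : Ω ⊆ translates B Δ e a P
  parallel_le : ∀ t ∈ Ω, (parallelCount B e P t.2 : ℝ) ≤ 2 * n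
  left : ∀ t ∈ Ω, θ₁ ≤ #{s ∈ Ω | (s.1, s.2.1) = (t.1, t.2.1)}
  right : ∀ t ∈ Ω, θ₁ ≤ #{s ∈ Ω | (s.1, s.2.2) = (t.1, t.2.2)}
  pair : ∀ t ∈ Ω, θ₂ ≤ #{s ∈ Ω | s.2 = t.2}

namespace Setup

variable (S : Setup B Δ R N τ Λ)
include S

/-- For fixed b, each c starts a representation of a - b, so the row bound at a applies. -/
theorem card_partner_pairs_le {e : ℕ} (hR : 2 * e ≤ R) {a : G} (ha : a ∈ Δ)
    {T : Finset (G × G)} (hT : ∀ z ∈ T, z.1 ∈ Δ ∧ z.2 ∈ Δ ∧ HasPartner B Δ (2 * e) (a - z.2) z.1) :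
    (#T : ℝ) ≤ Λ * τ * N ^ 2 := by
  refine le_trans ?_ (S.sum_rep_le ha hR subset_rfl)
  have h1 : (#T : ℝ) = ∑ b ∈ Δ, (#{z ∈ T | z.2 = b} : ℝ) := by
    exact_mod_cast card_eq_sum_card_fiberwise (f := Prod.snd) fun z hz => (hT z hz).2.1
  rw [h1]
  refine sum_le_sum fun b _ => ?_
  have h2 : #{z ∈ T | z.2 = b} ≤ #{c ∈ Δ | HasPartner B Δ (2 * e) (a - b) c} := by
    refine card_le_card_of_injOn Prod.fst (fun z hz => ?_) fun z hz z' hz' hzz => ?_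
    · obtain ⟨hzT, hzb⟩ := mem_filter.1 hz
      obtain ⟨h3, -, h4⟩ := hT z hzT
      exact mem_filter.2 ⟨h3, hzb ▸ h4⟩
    · exact Prod.ext hzz ((mem_filter.1 hz).2.trans (mem_filter.1 hz').2.symm)
  exact_mod_cast h2.trans (card_hasPartner_le _ _)

section Base

variable {e : ℕ} {ρ σ : ℝ} {a : G} {P : Finset (G × G)} (L : IsLocal B Δ N Λ e ρ σ a P)
include L

theorem exists_regular (hR : 16 * e ≤ R) (hρ : 0 < ρ) (hσ : 0 < σ) (ha : a ∈ Δ)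
    (hρσ : ρ ≤ Λ * σ) (hcard : τ ^ 2 * N ^ 2 ≤ Λ ^ 6 * ρ ^ 2 * #P) :
    ∃ n : ℝ, 0 < n ∧ ∃ Ω, IsRegular B Δ e a P Ω (τ * N / (Λ ^ 12 * ρ)) (σ * N / 4) n ∧
      ∃ q ∈ P, n ≤ Λ ^ 3 * #{p ∈ Ω.image Prod.snd | q.1 - q.2 - (p.1 - p.2) ∈ B (8 * e)} := by
  have hτ := S.τ_pos
  have hΛ := S.Λ_pos
  have hΛ' := S.le_Λ
  have hN := S.N_pos
  obtain ⟨n, hn, Q, hQP, hQn, hPQ⟩ := S.exists_regular_parallelCount L hR hρ hσ hρσ hcard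
  set Ω₀ := translates B Δ e a Q with hΩ₀
  have hΩ₀card := le_card_translates L hQP
  rw [← hΩ₀] at hΩ₀card
  have hQpos : τ ^ 2 * N ^ 2 ≤ 2 * Λ ^ 8 * ρ ^ 2 * #Q := by
    calc _ ≤ _ := hcard
      _ ≤ Λ ^ 6 * ρ ^ 2 * (2 * Λ ^ 2 * #Q) := by gcongr
      _ = _ := by ring
  have hQ0 : (0 : ℝ) < #Q := by
    by_contra! h0
    have h1 : 2 * Λ ^ 8 * ρ ^ 2 * (#Q : ℝ) ≤ 0 :=
      mul_nonpos_of_nonneg_of_nonpos (by positivity) h0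
    have : 0 < τ ^ 2 * N ^ 2 := by positivity
    linarith
  -- Up to powers of Λ this is the average fibre: at least about (τN/ρ)² · ρN translates lie over at
  -- most τN² pairs (c, b).
  set θ₁ := τ * N / (Λ ^ 12 * ρ) with hθ₁
  have hθ₁pos : 0 < θ₁ := by positivity
  have hQΔ : ∀ p ∈ Q, p.1 ∈ Δ ∧ p.2 ∈ Δ := fun p hp => L.mem p (hQP hp)
  have hi₀ : (#(Ω₀.image fun t => (t.1, t.2.1)) : ℝ) ≤ Λ * τ * N ^ 2 :=
    S.card_partner_pairs_le (e := e) (by omega) ha fun z hz => by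
      obtain ⟨t, ht, rfl⟩ := mem_image.1 hz
      obtain ⟨h1, h2, h3, -⟩ := mem_translates ht
      exact ⟨h1, (hQΔ _ h2).1, h3⟩
  have hi₁ : (#(Ω₀.image fun t => (t.1, t.2.2)) : ℝ) ≤ Λ * τ * N ^ 2 :=
    S.card_partner_pairs_le (e := e) (by omega) ha fun z hz => by
      obtain ⟨t, ht, rfl⟩ := mem_image.1 hz
      obtain ⟨h1, h2, -, h3⟩ := mem_translates ht
      exact ⟨h1, (hQΔ _ h2).2, h3⟩
  have hi₂ : (#(Ω₀.image Prod.snd) : ℝ) ≤ #Q := by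
    have : Ω₀.image Prod.snd ⊆ Q := fun p hp => by
      obtain ⟨t, ht, rfl⟩ := mem_image.1 hp
      exact (mem_translates ht).2.1
    exact_mod_cast card_le_card this
  have hθ₁le : 16 * (θ₁ * (Λ * τ * N ^ 2)) ≤ #Q * (σ * N) := by
    have h1 : Λ ^ 11 * (θ₁ * (Λ * τ * N ^ 2)) * ρ = τ ^ 2 * N ^ 2 * N := by
      rw [hθ₁]; field_simp
    have h2 : Λ ^ 11 * (θ₁ * (Λ * τ * N ^ 2)) * ρ ≤ Λ ^ 9 * 2 * σ * #Q * N * ρ := by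
      rw [h1]
      calc τ ^ 2 * N ^ 2 * N ≤ 2 * Λ ^ 8 * ρ ^ 2 * #Q * N := by gcongr
        _ = 2 * Λ ^ 8 * ρ * (#Q : ℝ) * N * ρ := by ring
        _ ≤ 2 * Λ ^ 8 * (Λ * σ) * (#Q : ℝ) * N * ρ := by gcongr
        _ = _ := by ring
    have h3 := le_of_mul_le_mul_right h2 hρ
    have h4 : Λ ^ 9 * (Λ ^ 2 * (θ₁ * (Λ * τ * N ^ 2))) ≤ Λ ^ 9 * (2 * (#Q * (σ * N))) := by
      linarith
    have h5 := le_of_mul_le_mul_left h4 (by positivity)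
    have h6 : 32 * (θ₁ * (Λ * τ * N ^ 2)) ≤ Λ ^ 2 * (θ₁ * (Λ * τ * N ^ 2)) := by
      gcongr; nlinarith
    linarith
  obtain ⟨Ω, hΩ, hΩcard, hfib⟩ := exists_subset_fibers_large Ω₀
    ![fun t => (t.1, t.2.1), fun t => (t.1, t.2.2), fun t => t.2] ![θ₁, θ₁, σ * N / 4]
    (by
      simp only [Fin.sum_univ_three, Matrix.cons_val_zero, Matrix.cons_val_one, Matrix.cons_val]
      have h1 := mul_le_mul_of_nonneg_left hi₀ hθ₁pos.le
      have h2 := mul_le_mul_of_nonneg_left hi₁ hθ₁pos.le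
      have h3 := mul_le_mul_of_nonneg_left hi₂ (by positivity : 0 ≤ σ * N / 4)
      have h4 : (#(Ω₀.image fun t => t.2) : ℝ) = #(Ω₀.image Prod.snd) := rfl
      rw [h4]
      linarith)
    (fun i => by fin_cases i <;> simp <;> positivity)
  have hreg : IsRegular B Δ e a P Ω θ₁ (σ * N / 4) n :=
    ⟨fun t ht => by
      obtain ⟨h1, h2⟩ := mem_filter.1 (hΩ ht)
      refine mem_filter.2 ⟨mem_product.2 ⟨(mem_product.1 h1).1, hQP (mem_product.1 h1).2⟩, h2⟩,
      fun t ht => (hQn _ (mem_translates (hΩ ht)).2.1).2,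
      fun t ht => hfib 0 t ht, fun t ht => hfib 1 t ht, fun t ht => hfib 2 t ht⟩
  refine ⟨n, hn, Ω, hreg, ?_⟩
  set P' := Ω.image Prod.snd with hP'
  have hP'Q : P' ⊆ Q := fun p hp => by
    obtain ⟨t, ht, rfl⟩ := mem_image.1 hp
    exact (mem_translates (hΩ ht)).2.1
  have hΩP' : (#Ω : ℝ) * 1 ≤ #P' * (2 * σ * N) := by
    refine card_mul_le_card_mul_of_rel Ω P' (fun t p => t.2 = p) (by positivity)
      (fun t ht => ?_) fun p hp _ _ _ => ?_
    · have : 0 < #{p ∈ P' | t.2 = p} :=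
        card_pos.2 ⟨t.2, mem_filter.2 ⟨mem_image_of_mem _ ht, rfl⟩⟩
      exact_mod_cast this
    · refine le_trans ?_ (L.star_le p (hQP (hP'Q hp)))
      rw [← translates_fiber (hQP (hP'Q hp))]
      exact_mod_cast card_le_card (filter_subset_filter _ hreg.subset)
  have hP'card : (#Q : ℝ) ≤ 4 * #P' := by
    have h1 : (σ * N) * (#Q : ℝ) ≤ (σ * N) * (4 * #P') := by linarith
    exact le_of_mul_le_mul_left h1 (by positivity)
  -- Count parallel couples in `P' × P`. Every p ∈ P' has at least n parallels in `P`, while #P ≤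
  -- 8Λ²#P', so some q ∈ P has at least n/Λ³ parallels in `P'`.
  by_contra! hcon
  have h1 := card_mul_le_card_mul_of_rel P' P
    (fun p q => q.1 - q.2 - (p.1 - p.2) ∈ B (8 * e)) (m := n) (M := n / Λ ^ 3) (by positivity)
    (fun p hp => (hQn p (hP'Q hp)).1) (fun q hq _ _ _ => by
      rw [le_div_iff₀ (by positivity), mul_comm]; exact (hcon q hq).le)
  have h2 : (#P : ℝ) * (n / Λ ^ 3) ≤ (8 * Λ ^ 2 * #P') * (n / Λ ^ 3) := by
    gcongr
    refine hPQ.trans ?_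
    calc 2 * Λ ^ 2 * (#Q : ℝ) ≤ 2 * Λ ^ 2 * (4 * #P') := by gcongr
      _ = _ := by ring
  have h3 : (8 * Λ ^ 2 * (#P' : ℝ)) * (n / Λ ^ 3) = 8 / Λ * (#P' * n) := by field_simp
  have h4 : 8 / Λ < 1 := by rw [div_lt_one hΛ]; linarith
  have h5 : 0 < (#P' : ℝ) * n := by
    have : (0 : ℝ) < #P' := by linarith
    positivity
  nlinarith

/-- Each point is represented at most `O(n)` times. -/
theorem card_representations_le (hR : 8 * e ≤ R) (hσ : 0 ≤ σ) {Ω : Finset (G × G × G)} {θ₁ θ₂ n : ℝ}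
    (hn : 0 < n) (hΩ : IsRegular B Δ e a P Ω θ₁ θ₂ n) {x : G} (hx : x ∈ Δ) :
    (#{z ∈ Ω.image fun t => (t.1, t.2.2) | partner B Δ (2 * e) (a - z.2) z.1 = x} : ℝ) * θ₁ *
      (σ * N) ≤ 2 * n * (Λ * τ * N ^ 2) := by
  set T : Finset (G × G) :=
    {z ∈ Ω.image fun t => (t.1, t.2.2) | partner B Δ (2 * e) (a - z.2) z.1 = x} with hT
  -- Each (c, b') representing x extends to at least θ₁ triples in `Ωx`. The other partner y of such
  -- a triple lies in `D`, because x - y inherits the σN representations of b - b' up to sign, and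
  -- at most 2n triples share the same y.
  set Ωx : Finset (G × G × G) := {t ∈ Ω | partner B Δ (2 * e) (a - t.2.2) t.1 = x} with hΩx
  set D : Finset G := {y ∈ Δ | σ * N ≤ rep B Δ (8 * e) (x - y)} with hD
  have h1 : (#T : ℝ) * θ₁ ≤ #Ωx * 1 := by
    refine card_mul_le_card_mul_of_rel T Ωx (fun z t => (t.1, t.2.2) = z) zero_le_one
      (fun z hz => ?_) fun t ht _ _ _ => ?_
    · obtain ⟨hz, hzx⟩ := mem_filter.1 hz
      obtain ⟨t, ht, rfl⟩ := mem_image.1 hz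
      refine (hΩ.right t ht).trans ?_
      norm_cast
      refine card_le_card fun s hs => ?_
      obtain ⟨hs, hst⟩ := mem_filter.1 hs
      refine mem_filter.2 ⟨mem_filter.2 ⟨hs, ?_⟩, hst⟩
      obtain ⟨h2, h3⟩ := Prod.mk.inj hst
      rw [h2, h3]; exact hzx
    · have : #{z ∈ T | (t.1, t.2.2) = z} ≤ 1 := card_le_one.2 fun u hu v hv =>
        (mem_filter.1 hu).2.symm.trans (mem_filter.1 hv).2
      exact_mod_cast this
  have h2 : (#Ωx : ℝ) * 1 ≤ #D * (2 * n) := by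
    refine card_mul_le_card_mul_of_rel Ωx D
      (fun t y => partner B Δ (2 * e) (a - t.2.1) t.1 = y) (by positivity)
      (fun t ht => ?_) fun y _ _ _ _ => ?_
    · obtain ⟨ht, htx⟩ := mem_filter.1 ht
      obtain ⟨-, htP, h, h'⟩ := mem_translates (hΩ.subset ht)
      have : 0 < #{y ∈ D | partner B Δ (2 * e) (a - t.2.1) t.1 = y} := by
        refine card_pos.2 ⟨_, mem_filter.2 ⟨mem_filter.2 ⟨h.partner_mem, ?_⟩, rfl⟩⟩
        refine (L.le_star _ htP).trans ?_
        have h3 := S.starRep_le_rep (r := 2 * e) (by omega) (a, t.2)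
        have h4 := S.partner_sub_partner h h'
        have h5 := rep_mono (Δ := Δ) S.ball (r := 2 * (2 * e)) (u := 8 * e) h4 (by omega)
        have h6 := rep_neg_le (Δ := Δ) S.ball (8 * e) (partner B Δ (2 * e) (a - t.2.1) t.1 -
          partner B Δ (2 * e) (a - t.2.2) t.1)
        rw [neg_sub, htx] at h6
        rw [htx] at h5
        exact_mod_cast (h3.trans h5).trans h6
      exact_mod_cast this
    · have h3 := S.translates_partner_fiber_le (e := e) (a := a) (P := P) (by omega)
        (Q := Ω.image Prod.snd)
        (fun p hp => by
          obtain ⟨t, ht, rfl⟩ := mem_image.1 hp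
          exact (mem_translates (hΩ.subset ht)).2.1)
        (M := 2 * n) (by positivity)
        (fun p hp => by
          obtain ⟨t, ht, rfl⟩ := mem_image.1 hp
          exact hΩ.parallel_le t ht) y x
      refine le_trans ?_ h3
      norm_cast
      refine card_le_card fun t ht => ?_
      obtain ⟨ht, hty⟩ := mem_filter.1 ht
      obtain ⟨ht, htx⟩ := mem_filter.1 ht
      obtain ⟨htΔ, -, h, h'⟩ := mem_translates (hΩ.subset ht)
      exact mem_filter.2 ⟨mem_filter.2 ⟨mem_product.2 ⟨htΔ, mem_image_of_mem _ ht⟩, h, h'⟩,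
        hty, htx⟩
  have h3 : (#D : ℝ) * (σ * N) ≤ Λ * τ * N ^ 2 :=
    S.card_neighbours_mul_le hx hR (filter_subset _ _) fun y hy => (mem_filter.1 hy).2
  have hσN : 0 ≤ σ * N := mul_nonneg hσ S.N_pos.le
  have h4 : (#T : ℝ) * θ₁ ≤ #D * (2 * n) := by linarith
  calc (#T : ℝ) * θ₁ * (σ * N) ≤ (#D * (2 * n)) * (σ * N) := by gcongr
    _ = 2 * n * (#D * (σ * N)) := by ring
    _ ≤ _ := by gcongr

end Base

end Setup

end Regular

/-! ### Common differences of the class of parallel pairs and of the represented points. -/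

section Energy

variable {G : Type v} [AddCommGroup G]
variable {B : ℕ → Set G} {Δ : Finset G} {R : ℕ} {N τ Λ : ℝ}

theorem sq_mul_le_of_sq_le {q v x y z w α β T : ℝ} (hq : 0 ≤ q) (hqv : q ≤ v)
    (hv : v ^ 2 ≤ x * y * z) (hw : 0 ≤ w) (hx : 0 ≤ x) (hy : 0 ≤ y) (hz : 0 ≤ z)
    (hα : x ≤ α) (hβ : y * w ≤ β) (hT : z ≤ T) : q ^ 2 * w ≤ α * β * T := by
  have hα' : 0 ≤ α := hx.trans hα
  have hβ' : 0 ≤ α * β := mul_nonneg hα' ((mul_nonneg hy hw).trans hβ)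
  calc q ^ 2 * w ≤ v ^ 2 * w := by gcongr
    _ ≤ x * y * z * w := by gcongr
    _ = x * (y * w) * z := by ring
    _ ≤ α * β * T := by gcongr

namespace Setup

variable (S : Setup B Δ R N τ Λ)
include S

theorem rep_subset_le {X : Finset G} (hX : X ⊆ Δ) {r : ℕ} (hr : 2 * r ≤ R) (z : G) :
    rep B X r z ≤ #X := by
  refine card_le_card_of_injOn Prod.fst (fun p hp => ?_) fun p hp q hq hpq => ?_
  · exact (mem_product.1 (mem_filter.1 hp).1).1
  · obtain ⟨hp, hpz⟩ := mem_filter.1 hp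
    obtain ⟨hq, hqz⟩ := mem_filter.1 hq
    refine Prod.ext hpq (S.eq_of_sub_mem (hX (mem_product.1 hp).2) (hX (mem_product.1 hq).2)
      (r := 2 * r) ?_ hr)
    exact S.ball.of_sub hqz hpz (by rw [hpq]; abel) (by omega)

/-- Take h₁ of at least average contribution. Elements h with fewer than κ|X|/2 representations
account for at most half of it, and every other h contributes at most |X|. -/
theorem exists_symmetric {X H : Finset G} (hX : X ⊆ Δ) (hX0 : X.Nonempty) (hH : H.Nonempty)
    {κ : ℝ} (hκ : 0 ≤ κ) {r : ℕ} (hr : 2 * r ≤ R)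
    (h : κ * #X * (#H : ℝ) ^ 2 ≤ ∑ h₁ ∈ H, ∑ h₂ ∈ H, (rep B X r (h₂ - h₁) : ℝ)) :
    ∃ h₁ ∈ H, ∃ H₁ ⊆ H, κ * #H ≤ 2 * #H₁ ∧
      ∀ h ∈ H₁, κ * #X ≤ 2 * (rep B X r (h - h₁) : ℝ) := by
  have hXpos : (0 : ℝ) < #X := by exact_mod_cast card_pos.2 hX0
  obtain ⟨h₁, hh₁, hle⟩ := exists_le_of_sum_le hH (f := fun _ => κ * #X * (#H : ℝ))
    (g := fun h₁ => ∑ h₂ ∈ H, (rep B X r (h₂ - h₁) : ℝ)) (by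
      rw [sum_const, nsmul_eq_mul]
      linarith)
  refine ⟨h₁, hh₁, {h ∈ H | κ * #X ≤ 2 * (rep B X r (h - h₁) : ℝ)}, filter_subset _ _, ?_,
    fun h hh => (mem_filter.1 hh).2⟩
  set H₁ : Finset G := {h ∈ H | κ * #X ≤ 2 * (rep B X r (h - h₁) : ℝ)} with hH₁
  have h2 : ∀ h ∈ H, (rep B X r (h - h₁) : ℝ) ≤
      (if κ * #X ≤ 2 * (rep B X r (h - h₁) : ℝ) then (#X : ℝ) else 0) + κ * #X / 2 := by
    intro h _
    split_ifs with hc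
    · have h3 : (rep B X r (h - h₁) : ℝ) ≤ #X := by exact_mod_cast S.rep_subset_le hX hr _
      have : 0 ≤ κ * #X / 2 := by positivity
      linarith
    · linarith
  have h3 := hle.trans (sum_le_sum h2)
  rw [sum_add_distrib, ← sum_filter, sum_const, sum_const, nsmul_eq_mul, nsmul_eq_mul] at h3
  have h4 : (#X : ℝ) * (κ * #H) ≤ #X * (2 * #H₁) := by linarith
  exact le_of_mul_le_mul_left h4 hXpos

section Base

variable {e : ℕ} {ρ σ : ℝ} {a : G} {P : Finset (G × G)} (L : IsLocal B Δ N Λ e ρ σ a P)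
include L

-- Take triples (c, b, b') and (c, b, b'') of Ω with (b, b') ∈ Q, and send them to (y, b'') with y ≈
-- c + b - a. As y and y' ≈ c + b' - a differ by about q.1 - q.2, locality leaves at most Λ⁷σN
-- choices for y; popularity of a - b'' bounds the choices for b''. If (c, b) and (ĉ, b̂) collide,
-- then c + b ≈ ĉ + b̂, so the points x ≈ c + b'' - a and x̂ ≈ ĉ + b'' - a satisfy x - x̂ ≈ b̂ - b.
-- Cauchy–Schwarz bounds the number of collisions from below.
set_option maxHeartbeats 400000 in
theorem sq_le_sum_min_representations (hR : 24 * e ≤ R) (hρ : 0 < ρ) (ha : a ∈ Δ)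
    {Ω : Finset (G × G × G)} {θ₁ θ₂ n : ℝ} (hθ₁ : 0 ≤ θ₁) (hθ₂ : 0 ≤ θ₂)
    (hΩ : IsRegular B Δ e a P Ω θ₁ θ₂ n) {q : G × G} (hq : q ∈ P) {Q : Finset (G × G)}
    (hQ : Q = {p ∈ Ω.image Prod.snd | q.1 - q.2 - (p.1 - p.2) ∈ B (8 * e)}) {f : G → ℕ}
    (hf : ∀ x, f x =
      #{z ∈ Ω.image fun t => (t.1, t.2.2) | partner B Δ (2 * e) (a - z.2) z.1 = x}) :
    #(Q.image Prod.fst) = #Q ∧ Q.image Prod.fst ⊆ Δ ∧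
    (#Q * θ₂ * θ₁) ^ 2 * (ρ * N) ≤ (Λ ^ 7 * (σ * N)) * (Λ * τ * N ^ 2) *
      ∑ w ∈ {w ∈ (Q.image Prod.fst ×ˢ Q.image Prod.fst) ×ˢ (Δ ×ˢ Δ) |
        w.2.1 - w.2.2 - (w.1.2 - w.1.1) ∈ B (8 * e)}, (min (f w.2.1) (f w.2.2) : ℝ) := by
  have hτ := S.τ_pos
  have hΛ := S.Λ_pos
  have hN := S.N_pos
  have hQP : Q ⊆ P := fun p hp => by
    rw [hQ] at hp
    obtain ⟨t, ht, rfl⟩ := mem_image.1 (mem_filter.1 hp).1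
    exact (mem_translates (hΩ.subset ht)).2.1
  have hQq : ∀ p ∈ Q, q.1 - q.2 - (p.1 - p.2) ∈ B (8 * e) := fun p hp => by
    rw [hQ] at hp
    exact (mem_filter.1 hp).2
  have hinj : ∀ p ∈ Q, ∀ p' ∈ Q, p.1 = p'.1 → p = p' := fun p hp p' hp' hpp => by
    refine Prod.ext hpp (S.eq_of_sub_mem (L.mem p (hQP hp)).2 (L.mem p' (hQP hp')).2
      (r := 16 * e) ?_ (by omega))
    exact S.ball.of_sub (hQq p hp) (hQq p' hp') (by rw [hpp]; abel) (by omega)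
  refine ⟨card_image_of_injOn fun p hp p' hp' h => hinj p hp p' hp' h, fun h hh => ?_, ?_⟩
  · obtain ⟨p, hp, rfl⟩ := mem_image.1 hh
    exact (L.mem p (hQP hp)).1
  set H := Q.image Prod.fst with hH
  set W : Finset ((G × G) × (G × G)) := {w ∈ (H ×ˢ H) ×ˢ (Δ ×ˢ Δ) |
    w.2.1 - w.2.2 - (w.1.2 - w.1.1) ∈ B (8 * e)} with hW
  set Ωq : Finset (G × G × G) := {t ∈ Ω | t.2 ∈ Q} with hΩq
  set V : Finset ((G × G × G) × (G × G × G)) :=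
    {u ∈ Ωq ×ˢ Ω | (u.2.1, u.2.2.1) = (u.1.1, u.1.2.1)} with hV
  have hVmem : ∀ u ∈ V, u.1 ∈ Ω ∧ u.1.2 ∈ Q ∧ u.2 ∈ Ω ∧ u.2.1 = u.1.1 ∧ u.2.2.1 = u.1.2.1 :=
    fun u hu => by
      obtain ⟨h1, h2⟩ := mem_filter.1 hu
      obtain ⟨h3, h4⟩ := mem_product.1 h1
      obtain ⟨h5, h6⟩ := mem_filter.1 h3
      exact ⟨h5, h6, h4, (Prod.mk.inj h2).1, (Prod.mk.inj h2).2⟩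
  have hc1 : (#Q : ℝ) * θ₂ ≤ #Ωq * 1 := by
    refine card_mul_le_card_mul_of_rel Q Ωq (fun p t => t.2 = p) zero_le_one
      (fun p hp => ?_) fun t _ _ _ _ => ?_
    · have hp' := hp
      rw [hQ] at hp'
      obtain ⟨t, ht, rfl⟩ := mem_image.1 (mem_filter.1 hp').1
      refine (hΩ.pair t ht).trans ?_
      norm_cast
      refine card_le_card fun s hs => ?_
      obtain ⟨hs, hst⟩ := mem_filter.1 hs
      exact mem_filter.2 ⟨mem_filter.2 ⟨hs, hst ▸ hp⟩, hst⟩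
    · have : #{p ∈ Q | t.2 = p} ≤ 1 := card_le_one.2 fun u hu v hv =>
        (mem_filter.1 hu).2.symm.trans (mem_filter.1 hv).2
      exact_mod_cast this
  have hc2 : (#Ωq : ℝ) * θ₁ ≤ #V * 1 := by
    refine card_mul_le_card_mul_of_rel Ωq V (fun t u => u.1 = t) zero_le_one
      (fun t ht => ?_) fun u _ _ _ _ => ?_
    · refine (hΩ.left t (filter_subset _ _ ht)).trans ?_
      norm_cast
      refine card_le_card_of_injOn (fun s => (t, s)) (fun s hs => ?_)
        fun s _ s' _ hss => (Prod.mk.inj hss).2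
      obtain ⟨hs, hst⟩ := mem_filter.1 hs
      exact mem_filter.2 ⟨mem_filter.2 ⟨mem_product.2 ⟨ht, hs⟩, hst⟩, rfl⟩
    · have : #{p ∈ Ωq | u.1 = p} ≤ 1 := card_le_one.2 fun x hx y hy =>
        (mem_filter.1 hx).2.symm.trans (mem_filter.1 hy).2
      exact_mod_cast this
  set g : (G × G × G) × (G × G × G) → G × G := fun u =>
    (partner B Δ (2 * e) (a - u.1.2.1) u.1.1, u.2.2.2) with hg
  set A : Finset G := {y ∈ Δ | HasPartner B Δ (12 * e) (q.1 - q.2) y} with hA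
  set D : Finset G := {b ∈ Δ | ρ * N ≤ rep B Δ e (a - b)} with hD
  have hAcard : (#A : ℝ) ≤ Λ ^ 7 * (σ * N) := by
    have h1 : #A ≤ rep B Δ (12 * e) (q.1 - q.2) := card_hasPartner_le _ _
    exact le_trans (Nat.cast_le.2 h1) (L.rep_le q hq)
  have hDcard : (#D : ℝ) * (ρ * N) ≤ Λ * τ * N ^ 2 :=
    S.card_neighbours_mul_le ha (by omega) (filter_subset _ _) fun y hy => (mem_filter.1 hy).2
  have hgV : ∀ u ∈ V, g u ∈ A ×ˢ D := fun u hu => by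
    obtain ⟨h1, h2, h3, h4, h5⟩ := hVmem u hu
    obtain ⟨-, -, k1, k2⟩ := mem_translates (hΩ.subset h1)
    obtain ⟨-, k3, -, -⟩ := mem_translates (hΩ.subset h3)
    refine mem_product.2 ⟨mem_filter.2 ⟨k1.partner_mem, _, k2.partner_mem, ?_⟩,
      mem_filter.2 ⟨(L.mem _ k3).2, L.right u.2.2 k3⟩⟩
    have h6 := S.ball.neg (S.ball.add (S.partner_sub_partner k1 k2) (hQq _ h2))
    refine S.ball.mono (r := 4 * e + 8 * e) (by omega) ?_
    convert h6 using 1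
    simp only [hg]
    abel
  have hsq := sq_card_le_card_mul_card_fiber_pairs V (A ×ˢ D) g hgV
  set Ψ := {x ∈ V ×ˢ V | g x.1 = g x.2} with hΨ
  have hdet₁ : ∀ u ∈ V, ∀ u' ∈ V, u.1.2.1 = u'.1.2.1 → u.2.1 = u'.2.1 → u.2.2.2 = u'.2.2.2 →
      u = u' := fun u hu u' hu' h1 h2 h3 => by
    obtain ⟨-, k2, -, k4, k5⟩ := hVmem u hu
    obtain ⟨-, k2', -, k4', k5'⟩ := hVmem u' hu'
    refine Prod.ext (Prod.ext ?_ (hinj _ k2 _ k2' h1)) (Prod.ext h2 (Prod.ext ?_ h3))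
    · rw [← k4, ← k4', h2]
    · rw [k5, k5', h1]
  have hdet₂ : ∀ u ∈ V, ∀ u' ∈ V, u.1.2.1 = u'.1.2.1 → g u = g u' → u = u' :=
    fun u hu u' hu' h1 h2 => by
    obtain ⟨k1, k2, -, k4, k5⟩ := hVmem u hu
    obtain ⟨k1', k2', -, k4', k5'⟩ := hVmem u' hu'
    obtain ⟨m1, -, m2, -⟩ := mem_translates (hΩ.subset k1)
    obtain ⟨m1', -, m2', -⟩ := mem_translates (hΩ.subset k1')
    obtain ⟨h3, h4⟩ := Prod.mk.inj h2
    refine hdet₁ u hu u' hu' h1 ?_ h4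
    rw [k4, k4']
    exact S.partner_injective (b := u.1.2.1) (by omega) m1 m1' m2 (h1 ▸ m2') (by rw [h3, h1])
  have hpt : ∀ u ∈ V, (u.2.1, u.2.2.2) ∈ Ω.image (fun t => (t.1, t.2.2)) := fun u hu =>
    mem_image_of_mem (fun t : G × G × G => (t.1, t.2.2)) (hVmem u hu).2.2.1
  set k : ((G × G × G) × (G × G × G)) × ((G × G × G) × (G × G × G)) → (G × G) × (G × G) :=
    fun x => ((x.1.1.2.1, x.2.1.2.1), (partner B Δ (2 * e) (a - x.1.2.2.2) x.1.2.1,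
      partner B Δ (2 * e) (a - x.2.2.2.2) x.2.2.1)) with hk
  have hΨmem : ∀ x ∈ Ψ, x.1 ∈ V ∧ x.2 ∈ V ∧ g x.1 = g x.2 := fun x hx => by
    obtain ⟨h1, h2⟩ := mem_filter.1 hx
    exact ⟨(mem_product.1 h1).1, (mem_product.1 h1).2, h2⟩
  have hkW : ∀ x ∈ Ψ, k x ∈ W := fun x hx => by
    obtain ⟨hx1, hx2, hgx⟩ := hΨmem x hx
    obtain ⟨k1, k2, k3, k4, k5⟩ := hVmem _ hx1
    obtain ⟨k1', k2', k3', k4', k5'⟩ := hVmem _ hx2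
    obtain ⟨-, -, m1, -⟩ := mem_translates (hΩ.subset k1)
    obtain ⟨-, -, m1', -⟩ := mem_translates (hΩ.subset k1')
    obtain ⟨-, -, -, m2⟩ := mem_translates (hΩ.subset k3)
    obtain ⟨-, -, -, m2'⟩ := mem_translates (hΩ.subset k3')
    obtain ⟨h3, h4⟩ := Prod.mk.inj hgx
    refine mem_filter.2 ⟨mem_product.2 ⟨mem_product.2 ⟨mem_image.2 ⟨_, k2, rfl⟩,
      mem_image.2 ⟨_, k2', rfl⟩⟩, mem_product.2 ⟨m2.partner_mem, m2'.partner_mem⟩⟩, ?_⟩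
    have n1 := S.ball.add m1.partner_near (S.ball.neg m1'.partner_near)
    have n2 := S.ball.add m2'.partner_near (S.ball.neg m2.partner_near)
    rw [h3] at n1
    refine S.ball.mono (r := 2 * e + 2 * e + (2 * e + 2 * e)) (by omega) ?_
    convert S.ball.add n1 n2 using 1
    simp only [hk]
    rw [← h4, k4, k4']
    abel
  -- With b and b̂ known, a collision is determined by (c, b''), which represents x, and equally by
  -- (ĉ, b''), which represents x̂: either one fixes the common value of `g`, and `hdet₂` then
  -- recovers the other half. Hence the minimum.
  have hfib : ∀ w ∈ W, #{x ∈ Ψ | k x = w} ≤ min (f w.2.1) (f w.2.2) := fun w _ => by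
    refine le_min ?_ ?_
    · rw [hf]
      refine card_le_card_of_injOn (fun x => (x.1.2.1, x.1.2.2.2)) (fun x hx => ?_)
        fun x hx y hy hxy => ?_
      · obtain ⟨hxΨ, hxw⟩ := mem_filter.1 hx
        exact mem_filter.2 ⟨hpt _ (hΨmem x hxΨ).1, by rw [← hxw]⟩
      · obtain ⟨hx, hxw⟩ := mem_filter.1 hx
        obtain ⟨hy, hyw⟩ := mem_filter.1 hy
        obtain ⟨hx1, hx2, hgx⟩ := hΨmem x hx
        obtain ⟨hy1, hy2, hgy⟩ := hΨmem y hy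
        have hkk := hxw.trans hyw.symm
        simp only [hk, Prod.mk.injEq] at hkk hxy
        have h1 : x.1 = y.1 := hdet₁ _ hx1 _ hy1 hkk.1.1 hxy.1 hxy.2
        exact Prod.ext h1 (hdet₂ _ hx2 _ hy2 hkk.1.2 (by rw [← hgx, ← hgy, h1]))
    · rw [hf]
      refine card_le_card_of_injOn (fun x => (x.2.2.1, x.2.2.2.2)) (fun x hx => ?_)
        fun x hx y hy hxy => ?_
      · obtain ⟨hxΨ, hxw⟩ := mem_filter.1 hx
        exact mem_filter.2 ⟨hpt _ (hΨmem x hxΨ).2.1, by rw [← hxw]⟩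
      · obtain ⟨hx, hxw⟩ := mem_filter.1 hx
        obtain ⟨hy, hyw⟩ := mem_filter.1 hy
        obtain ⟨hx1, hx2, hgx⟩ := hΨmem x hx
        obtain ⟨hy1, hy2, hgy⟩ := hΨmem y hy
        have hkk := hxw.trans hyw.symm
        simp only [hk, Prod.mk.injEq] at hkk hxy
        have h1 : x.2 = y.2 := hdet₁ _ hx2 _ hy2 hkk.1.2 hxy.1 hxy.2
        exact Prod.ext (hdet₂ _ hx1 _ hy1 hkk.1.1 (by rw [hgx, hgy, h1])) h1
  have hΨcard : (#Ψ : ℝ) ≤ ∑ w ∈ W, (min (f w.2.1) (f w.2.2) : ℝ) := by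
    have h1 : #Ψ ≤ ∑ w ∈ W, min (f w.2.1) (f w.2.2) := by
      rw [card_eq_sum_card_fiberwise hkW]
      exact sum_le_sum hfib
    have h2 := (Nat.cast_le (α := ℝ)).2 h1
    rw [Nat.cast_sum] at h2
    exact h2.trans_eq (sum_congr rfl fun w _ => Nat.cast_min _ _)
  have hVcard : (#Q : ℝ) * θ₂ * θ₁ ≤ #V := by
    have h1 := mul_le_mul_of_nonneg_right hc1 hθ₁
    rw [mul_one] at h1 hc2
    exact h1.trans hc2
  rw [card_product, Nat.cast_mul] at hsq
  exact sq_mul_le_of_sq_le (mul_nonneg (mul_nonneg (Nat.cast_nonneg _) hθ₂) hθ₁) hVcard hsq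
    (mul_nonneg hρ.le hN.le) (Nat.cast_nonneg _) (Nat.cast_nonneg _) (Nat.cast_nonneg _)
    hAcard hDcard hΨcard

end Base

end Setup

end Energy

/-! ### Extracting X and H, and the iteration. -/

section Structure

variable {G : Type v} [AddCommGroup G]
variable {B : ℕ → Set G} {Δ : Finset G} {R : ℕ} {N τ Λ : ℝ}

theorem card_filter_parallel_le (Δ H : Finset G) (r : ℕ) (f : G → ℕ) (k : ℕ) :
    (#{w ∈ {w ∈ (H ×ˢ H) ×ˢ (Δ ×ˢ Δ) | w.2.1 - w.2.2 - (w.1.2 - w.1.1) ∈ B r} |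
      k < f w.2.1 ∧ k < f w.2.2} : ℝ) ≤
      ∑ h₁ ∈ H, ∑ h₂ ∈ H, (rep B {x ∈ Δ | k < f x} r (h₂ - h₁) : ℝ) := by
  set T := {w ∈ {w ∈ (H ×ˢ H) ×ˢ (Δ ×ˢ Δ) | w.2.1 - w.2.2 - (w.1.2 - w.1.1) ∈ B r} |
      k < f w.2.1 ∧ k < f w.2.2} with hT
  have hmem : ∀ w ∈ T, w.1 ∈ H ×ˢ H ∧ w.2 ∈ Δ ×ˢ Δ ∧ w.2.1 - w.2.2 - (w.1.2 - w.1.1) ∈ B r ∧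
      k < f w.2.1 ∧ k < f w.2.2 := fun w hw => by
    obtain ⟨h1, h2⟩ := mem_filter.1 hw
    obtain ⟨h3, h4⟩ := mem_filter.1 h1
    exact ⟨(mem_product.1 h3).1, (mem_product.1 h3).2, h4, h2⟩
  have h1 : (#T : ℝ) = ∑ p ∈ H ×ˢ H, (#{w ∈ T | w.1 = p} : ℝ) := by
    exact_mod_cast card_eq_sum_card_fiberwise (f := Prod.fst) fun w hw => (hmem w hw).1
  rw [h1, sum_product]
  refine sum_le_sum fun h₁ _ => sum_le_sum fun h₂ _ => ?_
  have h2 : #{w ∈ T | w.1 = (h₁, h₂)} ≤ rep B {x ∈ Δ | k < f x} r (h₂ - h₁) := by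
    refine card_le_card_of_injOn Prod.snd (fun w hw => ?_) fun w hw w' hw' hww => ?_
    · obtain ⟨hwT, hw1⟩ := mem_filter.1 hw
      obtain ⟨-, h3, h4, h5, h6⟩ := hmem w hwT
      obtain ⟨h7, h8⟩ := mem_product.1 h3
      refine mem_filter.2 ⟨mem_product.2 ⟨mem_filter.2 ⟨h7, h5⟩, mem_filter.2 ⟨h8, h6⟩⟩, ?_⟩
      rwa [hw1] at h4
    · exact Prod.ext ((mem_filter.1 hw).2.trans (mem_filter.1 hw').2.symm) hww
  exact_mod_cast h2

namespace Setup

variable (S : Setup B Δ R N τ Λ)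
include S

/-- After inserting the fibre sizes, the dependence on ρ and σ reduces to the ratio σ/ρ, which is at
least 1/Λ. -/
theorem energy_lower_bound {ρ σ q T : ℝ} (hρ : 0 < ρ) (hσ : 0 < σ) (hρσ : ρ ≤ Λ * σ)
    (h : (q * (σ * N / 4) * (τ * N / (Λ ^ 12 * ρ))) ^ 2 * (ρ * N) ≤
      (Λ ^ 7 * (σ * N)) * (Λ * τ * N ^ 2) * T) : q ^ 2 * (τ * N ^ 2) / Λ ^ 34 ≤ T := by
  have hτ := S.τ_pos
  have hΛ := S.Λ_pos
  have hΛ' := S.le_Λ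
  have hN := S.N_pos
  have e1 : (q * (σ * N / 4) * (τ * N / (Λ ^ 12 * ρ))) ^ 2 * (ρ * N) =
      (σ * τ * N ^ 3 / (16 * Λ ^ 24)) * (q ^ 2 * (τ * N ^ 2) * (σ / ρ)) := by
    field_simp; ring
  have h1 : Λ⁻¹ ≤ σ / ρ := by
    rw [le_div_iff₀ hρ, inv_mul_le_iff₀ hΛ]; exact hρσ
  have h2 : (σ * τ * N ^ 3 / (16 * Λ ^ 24)) * (q ^ 2 * (τ * N ^ 2) * Λ⁻¹) ≤
      (σ * τ * N ^ 3 / (16 * Λ ^ 24)) * (16 * Λ ^ 32 * T) := by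
    calc _ ≤ (σ * τ * N ^ 3 / (16 * Λ ^ 24)) * (q ^ 2 * (τ * N ^ 2) * (σ / ρ)) := by gcongr
      _ ≤ _ := e1 ▸ h
      _ = _ := by field_simp
  have h3 := le_of_mul_le_mul_left h2 (by positivity)
  rw [div_le_iff₀ (by positivity)]
  have h4 : q ^ 2 * (τ * N ^ 2) ≤ 16 * Λ ^ 33 * T := by
    calc q ^ 2 * (τ * N ^ 2) = q ^ 2 * (τ * N ^ 2) * Λ⁻¹ * Λ := by field_simp
      _ ≤ 16 * Λ ^ 32 * T * Λ := by gcongr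
      _ = _ := by ring
  have hT : 0 ≤ T := by
    have : 0 ≤ 16 * Λ ^ 33 * T := le_trans (by positivity) h4
    exact nonneg_of_mul_nonneg_right this (by positivity)
  calc _ ≤ _ := h4
    _ ≤ Λ * Λ ^ 33 * T := by gcongr; linarith
    _ = _ := by ring

theorem representations_bound {ρ σ n f : ℝ} (hρ : 0 < ρ) (hσ : 0 < σ) (hn : 0 < n)
    (hρσ : ρ ≤ Λ * σ)
    (h : f * (τ * N / (Λ ^ 12 * ρ)) * (σ * N) ≤ 2 * n * (Λ * τ * N ^ 2)) :
    f ≤ 2 * n * Λ ^ 14 := by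
  have hτ := S.τ_pos
  have hΛ := S.Λ_pos
  have hN := S.N_pos
  have h1 : (τ * N ^ 2 * σ / (Λ ^ 12 * ρ)) * f ≤
      (τ * N ^ 2 * σ / (Λ ^ 12 * ρ)) * (2 * n * Λ ^ 13 * (ρ / σ)) := by
    calc _ = f * (τ * N / (Λ ^ 12 * ρ)) * (σ * N) := by ring
      _ ≤ _ := h
      _ = _ := by field_simp
  have h2 := le_of_mul_le_mul_left h1 (by positivity)
  have h3 : ρ / σ ≤ Λ := by rwa [div_le_iff₀ hσ]
  calc f ≤ _ := h2
    _ ≤ 2 * n * Λ ^ 13 * Λ := by gcongr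
    _ = _ := by ring

/-- For the chosen superlevel set X, the term c|X| says that the energy of X against H is within
powers of Λ of its maximum |H|²|X|. The constant term, compared with that same maximum, gives |X||H|
≥ τN² up to losses, because the number K of levels is at most about n, hence about |H|. -/
theorem exists_pair_of_sum_min_le {H : Finset G} (hH0 : H.Nonempty) {r : ℕ}
    (hr : 2 * r ≤ R) {n : ℝ} (hn : 0 < n) (hnH : n ≤ Λ ^ 3 * #H) {f : G → ℕ}
    (hf : ∀ x ∈ Δ, (f x : ℝ) ≤ 2 * n * Λ ^ 14) (hfsum : ∑ x ∈ Δ, (f x : ℝ) ≤ Λ * τ * N ^ 2)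
    (hmin : (#H : ℝ) ^ 2 * (τ * N ^ 2) / Λ ^ 34 ≤
      ∑ w ∈ {w ∈ (H ×ˢ H) ×ˢ (Δ ×ˢ Δ) | w.2.1 - w.2.2 - (w.1.2 - w.1.1) ∈ B r},
        (min (f w.2.1) (f w.2.2) : ℝ)) :
    ∃ X ⊆ Δ, ∃ H₁ ⊆ H, ∃ z, τ * N ^ 2 ≤ Λ ^ 100 * (#X * #H₁) ∧
      ∀ y ∈ H₁, (#X : ℝ) ≤ Λ ^ 100 * (rep B X r (y + z) : ℝ) := by
  have hτ := S.τ_pos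
  have hΛ := S.Λ_pos
  have hΛ' := S.le_Λ
  have hΛ1 : 1 ≤ Λ := by linarith
  have hN := S.N_pos
  have hHpos : (0 : ℝ) < #H := by exact_mod_cast hH0.card_pos
  obtain ⟨K, hK⟩ : ∃ K : ℕ, K = ⌊2 * n * Λ ^ 14⌋₊ := ⟨_, rfl⟩
  have hKle : (K : ℝ) ≤ 2 * n * Λ ^ 14 := hK ▸ Nat.floor_le (by positivity)
  have hΨpos : 0 < (#H : ℝ) ^ 2 * (τ * N ^ 2) / Λ ^ 34 := by positivity
  have hc : (#H : ℝ) ^ 2 / Λ ^ 36 * ∑ x ∈ Δ, (f x : ℝ) ≤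
      (#H : ℝ) ^ 2 * (τ * N ^ 2) / Λ ^ 34 / 2 := by
    calc _ ≤ (#H : ℝ) ^ 2 / Λ ^ 36 * (Λ * τ * N ^ 2) := by gcongr
      _ = (#H : ℝ) ^ 2 * (τ * N ^ 2) / Λ ^ 34 / Λ := by field_simp
      _ ≤ _ := by gcongr; linarith
  obtain ⟨hK0, k, hk⟩ := exists_superlevel _ Δ (fun w => w.2.1) (fun w => w.2.2) f (K := K)
    (c := (#H : ℝ) ^ 2 / Λ ^ 36)
    (fun w hw => (mem_product.1 (mem_product.1 (mem_filter.1 hw).1).2).1)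
    (fun x hx => hK ▸ Nat.le_floor (hf x hx)) hΨpos hmin hc
  have hk' := hk.trans (card_filter_parallel_le Δ H r f k)
  obtain ⟨X, hX⟩ : ∃ X : Finset G, X = {x ∈ Δ | k < f x} := ⟨_, rfl⟩
  rw [← hX] at hk'
  have hXΔ : X ⊆ Δ := hX ▸ filter_subset _ _
  clear hk hmin hf hfsum hc hX
  have hup : ∑ h₁ ∈ H, ∑ h₂ ∈ H, (rep B X r (h₂ - h₁) : ℝ) ≤ (#H : ℝ) ^ 2 * #X := by
    calc _ ≤ ∑ h₁ ∈ H, ∑ h₂ ∈ H, (#X : ℝ) := by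
          refine sum_le_sum fun h₁ _ => sum_le_sum fun h₂ _ => ?_
          exact Nat.cast_le.2 (S.rep_subset_le hXΔ hr _)
      _ = _ := by simp only [sum_const, nsmul_eq_mul]; ring
  have hK0' : (0 : ℝ) < K := by exact_mod_cast hK0
  have hXlow : τ * N ^ 2 ≤ Λ ^ 52 * (#X * #H) := by
    have h1 : (#H : ℝ) ^ 2 * (τ * N ^ 2) / Λ ^ 34 / (2 * K) ≤ (#H : ℝ) ^ 2 * #X := by
      have : 0 ≤ (#H : ℝ) ^ 2 / Λ ^ 36 * #X := by positivity
      linarith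
    rw [div_le_iff₀ (by positivity), div_le_iff₀ (by positivity)] at h1
    have h2 : (#H : ℝ) ^ 2 * (τ * N ^ 2) ≤ (#H : ℝ) ^ 2 * (Λ ^ 52 * (#X * #H)) := by
      calc _ ≤ _ := h1
        _ ≤ (#H : ℝ) ^ 2 * #X * (2 * (2 * (Λ ^ 3 * #H) * Λ ^ 14)) * Λ ^ 34 := by
            gcongr; exact hKle.trans (by gcongr)
        _ = (#H : ℝ) ^ 2 * (4 * Λ ^ 51 * (#X * #H)) := by ring
        _ ≤ (#H : ℝ) ^ 2 * (Λ * Λ ^ 51 * (#X * #H)) := by gcongr; linarith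
        _ = _ := by ring
    exact le_of_mul_le_mul_left h2 (by positivity)
  have hX0 : X.Nonempty := by
    rw [nonempty_iff_ne_empty]
    rintro h0
    rw [h0] at hXlow
    simp only [card_empty, Nat.cast_zero, zero_mul, mul_zero] at hXlow
    have : 0 < τ * N ^ 2 := by positivity
    linarith
  have hsymm : 1 / Λ ^ 36 * #X * (#H : ℝ) ^ 2 ≤
      ∑ h₁ ∈ H, ∑ h₂ ∈ H, (rep B X r (h₂ - h₁) : ℝ) := by
    refine le_trans ?_ hk'
    have : 0 ≤ (#H : ℝ) ^ 2 * (τ * N ^ 2) / Λ ^ 34 / (2 * K) := by positivity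
    have e1 : 1 / Λ ^ 36 * (#X : ℝ) * (#H : ℝ) ^ 2 = (#H : ℝ) ^ 2 / Λ ^ 36 * #X := by ring
    linarith
  obtain ⟨h₁, -, H₁, hH₁, hcard, hsym⟩ := S.exists_symmetric hXΔ hX0 hH0
    (κ := 1 / Λ ^ 36) (by positivity) hr hsymm
  refine ⟨X, hXΔ, H₁, hH₁, -h₁, ?_, fun y hy => ?_⟩
  · have h1 : (#H : ℝ) ≤ Λ ^ 37 * #H₁ := by
      rw [one_div, inv_mul_le_iff₀ (by positivity)] at hcard
      calc (#H : ℝ) ≤ _ := hcard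
        _ ≤ Λ ^ 36 * (Λ * #H₁) := by gcongr; linarith
        _ = _ := by ring
    calc τ * N ^ 2 ≤ _ := hXlow
      _ ≤ Λ ^ 52 * (#X * (Λ ^ 37 * #H₁)) := by gcongr
      _ = Λ ^ 89 * (#X * #H₁) := by ring
      _ ≤ _ := by gcongr; all_goals norm_num
  · have h1 := hsym y hy
    rw [one_div, inv_mul_le_iff₀ (by positivity), sub_eq_add_neg] at h1
    calc (#X : ℝ) ≤ _ := h1
      _ ≤ Λ ^ 36 * (Λ * (rep B X r (y + -h₁) : ℝ)) := by gcongr; linarith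
      _ = Λ ^ 37 * (rep B X r (y + -h₁) : ℝ) := by ring
      _ ≤ _ := by gcongr; all_goals norm_num

theorem exists_pair_of_cherries {e : ℕ} {ρ σ : ℝ} (hρ : 0 < ρ) (hσ : 0 < σ)
    (hρσ : ρ ≤ Λ * σ) (hR : 28 * e ≤ R)
    {C : Finset (G × G × G)} (hC : IsCherrySet B Δ N e ρ σ C)
    (h : τ ^ 2 * N ^ 3 ≤ Λ ^ 5 * ρ ^ 2 * #C) :
    ∃ X ⊆ Δ, ∃ H ⊆ Δ, ∃ z, τ * N ^ 2 ≤ Λ ^ 100 * (#X * #H) ∧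
      ∀ y ∈ H, (#X : ℝ) ≤ Λ ^ 100 * (rep B X (8 * e) (y + z) : ℝ) := by
  have hτ := S.τ_pos
  have hΛ := S.Λ_pos
  have hΛ' := S.le_Λ
  have hΛ1 : 1 ≤ Λ := by linarith
  have hN := S.N_pos
  obtain ⟨a, ha, P, L, hP⟩ := S.exists_local hρ hσ hR hC h
  obtain ⟨n, hn, Ω, hΩ, q, hq, hqn⟩ := S.exists_regular L (by omega) hρ hσ ha hρσ hP
  obtain ⟨Q, hQ⟩ : ∃ Q, Q = {p ∈ Ω.image Prod.snd | q.1 - q.2 - (p.1 - p.2) ∈ B (8 * e)} :=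
    ⟨_, rfl⟩
  rw [← hQ] at hqn
  obtain ⟨f, hf⟩ : ∃ f : G → ℕ, ∀ x, f x =
      #{z ∈ Ω.image fun t => (t.1, t.2.2) | partner B Δ (2 * e) (a - z.2) z.1 = x} :=
    ⟨_, fun _ => rfl⟩
  obtain ⟨hHQ, hHΔ, hmin⟩ := S.sq_le_sum_min_representations L (by omega) hρ ha
    (by positivity) (by positivity) hΩ hq hQ hf
  obtain ⟨H, hH⟩ : ∃ H, H = Q.image Prod.fst := ⟨_, rfl⟩
  rw [← hH] at hHQ hHΔ hmin
  rw [← hHQ] at hqn hmin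
  have hH0 : H.Nonempty := by
    rw [nonempty_iff_ne_empty]
    rintro h0
    rw [h0, card_empty, Nat.cast_zero, mul_zero] at hqn
    linarith
  have hmin' := S.energy_lower_bound hρ hσ hρσ hmin
  have hfle : ∀ x ∈ Δ, (f x : ℝ) ≤ 2 * n * Λ ^ 14 := fun x hx => by
    refine S.representations_bound hρ hσ hn hρσ ?_
    rw [hf]
    exact S.card_representations_le L (by omega) hσ.le hn hΩ hx
  have hfsum : ∑ x ∈ Δ, (f x : ℝ) ≤ Λ * τ * N ^ 2 := by
    have hI : ∀ z ∈ Ω.image (fun t => (t.1, t.2.2)), z.1 ∈ Δ ∧ z.2 ∈ Δ ∧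
        HasPartner B Δ (2 * e) (a - z.2) z.1 := fun z hz => by
      obtain ⟨t, ht, rfl⟩ := mem_image.1 hz
      obtain ⟨h1, h2, -, h3⟩ := mem_translates (hΩ.subset ht)
      exact ⟨h1, (L.mem _ h2).2, h3⟩
    refine le_trans (le_of_eq ?_) (S.card_partner_pairs_le (e := e) (by omega) ha hI)
    have h1 := card_eq_sum_card_fiberwise (s := Ω.image (fun t => (t.1, t.2.2))) (t := Δ)
      (f := fun z => partner B Δ (2 * e) (a - z.2) z.1) fun z hz => (hI z hz).2.2.partner_mem
    rw [h1, Nat.cast_sum]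
    exact sum_congr rfl fun x _ => by rw [hf]
  obtain ⟨X, hX, H₁, hH₁, z, h1, h2⟩ := S.exists_pair_of_sum_min_le hH0 (by omega) hn hqn
    hfle hfsum hmin'
  exact ⟨X, hX, H₁, hH₁.trans hHΔ, z, h1, h2⟩

theorem mono {Λ' : ℝ} (h : Λ ≤ Λ') : Setup B Δ R N τ Λ' where
  ball := S.ball
  sep := S.sep
  card_le := S.card_le
  N_pos := S.N_pos
  τ_pos := S.τ_pos
  τ_le := S.τ_le
  le_Λ := S.le_Λ.trans h
  log_le := S.log_le.trans h
  row a ha := by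
    have := S.N_pos
    have := S.τ_pos
    exact (S.row a ha).trans (by gcongr)
  energy_le := by
    have := S.N_pos
    have := S.τ_pos
    exact S.energy_le.trans (by gcongr)

/-- Iterating the passage from popular differences to differences of popular differences. -/
theorem exists_pair {h : ℕ} (hh : 2 ≤ h) {ρ₀ : ℝ} (hρ₀ : 0 < ρ₀) (hρ₀' : ρ₀ ≤ 1)
    (h₀ : τ * N ^ 2 ≤ Λ * ρ₀ * #(level B Δ 1 (ρ₀ * N))) (hR : 28 * 12 ^ h ≤ R) {M : ℝ}
    (hM : Λ ^ 12 ^ h * τ ^ (-(1 / (h : ℝ))) ≤ M) :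
    ∃ X ⊆ Δ, ∃ H ⊆ Δ, ∃ z, τ * N ^ 2 ≤ M ^ 100 * (#X * #H) ∧
      ∀ y ∈ H, (#X : ℝ) ≤ M ^ 100 * (rep B X (8 * 12 ^ h) (y + z) : ℝ) := by
  have hτ := S.τ_pos
  have hΛ := S.Λ_pos
  have hΛ' := S.le_Λ
  have hΛ1 : 1 ≤ Λ := by linarith
  have hN := S.N_pos
  have hh' : (0 : ℝ) < h := by exact_mod_cast (by omega : 0 < h)
  have hτh : 1 ≤ τ ^ (-(1 / (h : ℝ))) :=
    Real.one_le_rpow_of_pos_of_le_one_of_nonpos hτ S.τ_le (by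
      rw [neg_nonpos]; positivity)
  have hpow : ∀ i ≤ h, Λ ^ 12 ^ i ≤ Λ ^ 12 ^ h := fun i hi =>
    pow_le_pow_right₀ hΛ1 (Nat.pow_le_pow_right (by norm_num) hi)
  have hΛM : Λ ^ 12 ^ h ≤ M := le_trans (le_mul_of_one_le_right (by positivity) hτh) hM
  have hM0 : 0 < M := lt_of_lt_of_le (by positivity) hΛM
  by_contra hcon
  -- If no pair exists, each step lowers the height by a factor M. Radius and exponent of Λ are
  -- multiplied by 12 each time, as in `level_of_cherries`.
  have key : ∀ i ≤ h, ∃ ρ : ℝ, 0 < ρ ∧ ρ * M ^ i ≤ 1 ∧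
      τ * N ^ 2 ≤ Λ ^ 12 ^ i * ρ * #(level B Δ (12 ^ i) (ρ * N)) := by
    intro i
    induction i with
    | zero =>
      intro _
      exact ⟨ρ₀, hρ₀, by simpa using hρ₀', by simpa using h₀⟩
    | succ i ih =>
      intro hi
      obtain ⟨ρ, hρ, hρM, hlev⟩ := ih (by omega)
      have hRi : 28 * 12 ^ i ≤ R :=
        le_trans (Nat.mul_le_mul_left _ (Nat.pow_le_pow_right (by norm_num) (by omega))) hR
      have S' := S.mono (Λ' := Λ ^ 12 ^ i) (le_self_pow₀ hΛ1 (by positivity))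
      obtain ⟨σ, hσ, C, hC, hCcard⟩ := S'.exists_cherries hρ (by omega) hlev
      rcases le_or_gt ρ (M * σ) with hle | hlt
      · refine absurd ?_ hcon
        have hiM : Λ ^ 12 ^ i ≤ M := (hpow i (by omega)).trans hΛM
        have S'' := S'.mono hiM
        obtain ⟨X, hX, H, hH, z, h1, h2⟩ := S''.exists_pair_of_cherries hρ hσ hle hRi hC
          (hCcard.trans (by gcongr))
        refine ⟨X, hX, H, hH, z, h1, fun y hy => (h2 y hy).trans ?_⟩
        have h3 : rep B X (8 * 12 ^ i) (y + z) ≤ rep B X (8 * 12 ^ h) (y + z) :=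
          card_le_card fun p hp => by
            rw [mem_filter] at hp ⊢
            refine ⟨hp.1, S.ball.mono ?_ hp.2⟩
            exact Nat.mul_le_mul_left _ (Nat.pow_le_pow_right (by norm_num) (by omega))
        gcongr
      · refine ⟨σ, hσ, ?_, ?_⟩
        · calc σ * M ^ (i + 1) = M * σ * M ^ i := by ring
            _ ≤ ρ * M ^ i := by gcongr
            _ ≤ 1 := hρM
        · have := S'.level_of_cherries hρ hσ (by omega) hC hCcard
          rw [← pow_mul, ← pow_succ, mul_comm 12 (12 ^ i), ← pow_succ] at this
          exact this
  obtain ⟨ρ, hρ, hρM, hlev⟩ := key h le_rfl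
  have h1 : (#(level B Δ (12 ^ h) (ρ * N)) : ℝ) ≤ N ^ 2 := by
    have h2 : #(level B Δ (12 ^ h) (ρ * N)) ≤ #Δ * #Δ := by
      rw [← card_product]; exact card_le_card (filter_subset _ _)
    calc (#(level B Δ (12 ^ h) (ρ * N)) : ℝ) ≤ #Δ * #Δ := by exact_mod_cast h2
      _ ≤ N * N := by have := S.card_le; gcongr
      _ = _ := by ring
  have h2 : τ ≤ Λ ^ 12 ^ h * ρ := by
    have : N ^ 2 * τ ≤ N ^ 2 * (Λ ^ 12 ^ h * ρ) := by
      calc N ^ 2 * τ = τ * N ^ 2 := by ring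
        _ ≤ _ := hlev
        _ ≤ Λ ^ 12 ^ h * ρ * N ^ 2 := by gcongr
        _ = _ := by ring
    exact le_of_mul_le_mul_left this (by positivity)
  have hΛh : 1 < Λ ^ 12 ^ h := one_lt_pow₀ (by linarith) (by positivity)
  -- Since h ≥ 2, M^h has a spare factor Λ^(12^h), which makes ρ ≤ M^(-h) incompatible with τ ≤
  -- Λ^(12^h) ρ.
  have h3 : (Λ ^ 12 ^ h) ^ 2 * τ⁻¹ ≤ M ^ h := by
    calc (Λ ^ 12 ^ h) ^ 2 * τ⁻¹ ≤ (Λ ^ 12 ^ h) ^ h * τ⁻¹ := by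
          gcongr; exact hΛh.le
      _ = (Λ ^ 12 ^ h * τ ^ (-(1 / (h : ℝ)))) ^ h := by
          rw [mul_pow, ← Real.rpow_mul_natCast hτ.le, neg_mul, one_div_mul_cancel hh'.ne',
            Real.rpow_neg_one]
      _ ≤ M ^ h := by gcongr
  have h4 : Λ ^ 12 ^ h ≤ 1 := by
    calc Λ ^ 12 ^ h = τ * (Λ ^ 12 ^ h * τ⁻¹) := by field_simp
      _ ≤ Λ ^ 12 ^ h * ρ * (Λ ^ 12 ^ h * τ⁻¹) := by gcongr
      _ = ρ * ((Λ ^ 12 ^ h) ^ 2 * τ⁻¹) := by ring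
      _ ≤ ρ * M ^ h := by gcongr
      _ ≤ 1 := hρM
  linarith

end Setup

end Structure

/-! ### Convolutions and energies as counts. -/

section Counting

variable {G : Type v} [AddCommGroup G] [Fintype G]

omit [AddCommGroup G] in
theorem sum_ind_mul (X : Finset G) (φ : G → ℝ) : ∑ x, ind X x * φ x = ∑ x ∈ X, φ x := by
  simp [ind, Set.indicator_apply]

theorem sum_conv_mul (f g φ : G → ℝ) :
    ∑ x, conv f g x * φ x = ∑ u, f u * ∑ v, g v * φ (u + v) := by
  simp only [conv, sum_mul, mul_sum]
  rw [sum_comm]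
  refine sum_congr rfl fun u _ => ?_
  rw [← Equiv.sum_comp (Equiv.addLeft u)]
  exact sum_congr rfl fun v _ => by simp [mul_assoc]

theorem sum_dconv_mul (f g φ : G → ℝ) :
    ∑ x, dconv f g x * φ x = ∑ u, f u * ∑ v, g v * φ (u - v) := by
  simp only [dconv, sum_mul, mul_sum]
  rw [sum_comm]
  refine sum_congr rfl fun u _ => ?_
  rw [← Equiv.sum_comp (Equiv.subLeft u)]
  exact sum_congr rfl fun v _ => by simp [mul_assoc]

theorem sum_iterConv_two_mul (Δ : Finset G) (φ : G → ℝ) :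
    ∑ x, iterConv (ind Δ) 2 x * φ x = ∑ p ∈ Δ ×ˢ Δ, φ (p.1 + p.2) := by
  have h : iterConv (ind Δ) 2 = conv (iterConv (ind Δ) 1) (ind Δ) := rfl
  rw [h, iterConv_one, sum_conv_mul, sum_ind_mul, sum_product]
  exact sum_congr rfl fun _ _ => sum_ind_mul _ _

theorem sum_iterConv_four_mul (Δ : Finset G) (φ : G → ℝ) :
    ∑ x, iterConv (ind Δ) 4 x * φ x =
      ∑ p ∈ (Δ ×ˢ Δ) ×ˢ (Δ ×ˢ Δ), φ (p.1.1 + p.1.2 + p.2.1 + p.2.2) := by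
  have h : iterConv (ind Δ) 4 = conv (conv (iterConv (ind Δ) 2) (ind Δ)) (ind Δ) := rfl
  rw [h, sum_conv_mul, sum_conv_mul, sum_iterConv_two_mul, sum_product (Δ ×ˢ Δ) (Δ ×ˢ Δ)]
  refine sum_congr rfl fun p _ => ?_
  rw [sum_ind_mul, sum_product]
  exact sum_congr rfl fun _ _ => sum_ind_mul _ _

omit [AddCommGroup G] [Fintype G] in
theorem sum_ind_apply [DecidableEq G] {ι : Type*} (Q : Finset ι) (s : ι → G) (Γ : Finset G) :
    ∑ q ∈ Q, ind Γ (s q) = #{q ∈ Q | s q ∈ Γ} := by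
  simp [ind, Set.indicator_apply]

/-- If `F` is the density of the values of `s` on `Q`, then `(F ∘ F) ∘ 1_Γ` counts differences. -/
theorem dconv_dconv_ind [DecidableEq G] {ι : Type*} {F : G → ℝ} {Q : Finset ι} {s : ι → G}
    (hF : ∀ φ : G → ℝ, ∑ x, F x * φ x = ∑ q ∈ Q, φ (s q)) (Γ : Finset G) (x : G) :
    dconv (dconv F F) (ind Γ) x = #{p ∈ Q ×ˢ Q | s p.1 - s p.2 - x ∈ Γ} := by
  have h : dconv (dconv F F) (ind Γ) x = ∑ y, dconv F F y * ind Γ (y - x) := rfl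
  rw [h, sum_dconv_mul, hF, ← sum_ind_apply (Q ×ˢ Q) (fun p => s p.1 - s p.2 - x), sum_product]
  exact sum_congr rfl fun _ _ => hF _

theorem dconv_dconv_ind_ind [DecidableEq G] (X Γ : Finset G) (x : G) :
    dconv (dconv (ind X) (ind X)) (ind Γ) x = #{p ∈ X ×ˢ X | p.1 - p.2 - x ∈ Γ} :=
  dconv_dconv_ind (s := id) (fun φ => sum_ind_mul X φ) Γ x

theorem inn_dconv (X : Finset G) (g : G → ℝ) :
    inn (dconv (ind X) (ind X)) g = ∑ p ∈ X ×ˢ X, g (p.1 - p.2) := by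
  rw [inn, sum_dconv_mul, sum_ind_mul, sum_product]
  exact sum_congr rfl fun _ _ => sum_ind_mul _ _

theorem energy_two_ind [DecidableEq G] (Δ Γ : Finset G) : energy 2 (ind Δ) (ind Γ) =
    #{w ∈ (Δ ×ˢ Δ) ×ˢ (Δ ×ˢ Δ) | w.1.1 + w.1.2 - (w.2.1 + w.2.2) ∈ Γ} := by
  rw [← sum_ind_apply ((Δ ×ˢ Δ) ×ˢ (Δ ×ˢ Δ))
    (fun w => w.1.1 + w.1.2 - (w.2.1 + w.2.2)), energy]
  have h : ∀ φ : (Fin 2 → G) → ℝ, ∑ a, (∏ i, ind Δ (a i)) * φ a =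
      ∑ p ∈ Δ ×ˢ Δ, φ ![p.1, p.2] := fun φ => by
    rw [← Equiv.sum_comp (finTwoArrowEquiv G).symm, Fintype.sum_prod_type, sum_product]
    refine Eq.trans ?_ (sum_ind_mul Δ _)
    refine sum_congr rfl fun a _ => ?_
    rw [← sum_ind_mul Δ, mul_sum]
    refine sum_congr rfl fun b _ => ?_
    simp [mul_assoc]
  rw [sum_product]
  simp only [mul_assoc, ← mul_sum]
  rw [h]
  refine sum_congr rfl fun p _ => ?_
  rw [h]
  simp

theorem apply_zero_le_norm (F : G → ℝ) : F 0 ≤ ‖F‖ :=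
  (le_abs_self _).trans (norm_le_pi_norm F 0)

omit [Fintype G] in
theorem sum_rep_eq (B : ℕ → Set G) (Δ Δ' T : Finset G) (r : ℕ) :
    ∑ a ∈ Δ', ∑ b ∈ T, rep B Δ r (a - b) =
      #{w ∈ (Δ' ×ˢ T) ×ˢ (Δ ×ˢ Δ) | w.2.1 - w.2.2 - (w.1.1 - w.1.2) ∈ B r} := by
  rw [card_filter, sum_product, sum_product]
  exact sum_congr rfl fun a _ => sum_congr rfl fun b _ => by rw [rep, card_filter]

end Counting

/-! ### Sumsets of a symmetric set as balls. -/

section Sumset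

variable {G : Type v} [AddCommGroup G] [DecidableEq G]

theorem neg_mem_sumset {Γ : Finset G} (hΓ : -Γ = Γ) {r : ℕ} {x : G} (hx : x ∈ sumset r Γ) :
    -x ∈ sumset r Γ := by
  induction r generalizing x with
  | zero => simp_all [sumset]
  | succ r ih =>
    obtain ⟨a, ha, b, hb, rfl⟩ := mem_add.1 hx
    exact mem_add.2 ⟨-a, ih ha, -b, by rw [← hΓ]; exact neg_mem_neg hb, by abel⟩

theorem add_mem_sumset {Γ : Finset G} {r s : ℕ} {x y : G} (hx : x ∈ sumset r Γ)
    (hy : y ∈ sumset s Γ) : x + y ∈ sumset (r + s) Γ := by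
  induction s generalizing y with
  | zero => simp_all [sumset]
  | succ s ih =>
    obtain ⟨a, ha, b, hb, rfl⟩ := mem_add.1 hy
    exact mem_add.2 ⟨x + a, ih ha, b, hb, by abel⟩

theorem zero_mem_sumset {Γ : Finset G} (h0 : 0 ∈ Γ) (r : ℕ) : 0 ∈ sumset r Γ := by
  induction r with
  | zero => simp [sumset]
  | succ r ih => exact mem_add.2 ⟨0, ih, 0, h0, by simp⟩

theorem sumset_mono {Γ Γ' : Finset G} (h : Γ ⊆ Γ') (r : ℕ) : sumset r Γ ⊆ sumset r Γ' := by
  induction r with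
  | zero => exact subset_rfl
  | succ r ih => exact add_subset_add ih h

theorem isBallFamily_sumset {Γ : Finset G} (hΓ : -Γ = Γ) (h0 : 0 ∈ Γ) :
    IsBallFamily fun r => (sumset r Γ : Set G) where
  mono {r s} hrs x hx := by
    have := add_mem_sumset hx (zero_mem_sumset h0 (s - r))
    rwa [add_zero, Nat.add_sub_cancel' hrs] at this
  neg hx := neg_mem_sumset hΓ hx
  add hx hy := add_mem_sumset hx hy

theorem IsOrthogonal.eq_of_sub_mem {Δ Γ : Finset G} (h : IsOrthogonal Δ Γ) (h0 : 0 ∈ Γ) {a b : G}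
    (ha : a ∈ Δ) (hb : b ∈ Δ) (hab : a - b ∈ Γ) : a = b := by
  by_contra hne
  refine Finset.disjoint_left.1 (h ha hb hne) (?_ : a ∈ _) ?_
  · exact mem_vadd_finset.2 ⟨0, h0, by simp⟩
  · exact mem_vadd_finset.2 ⟨a - b, hab, by simp⟩

variable [Fintype G] {h t : ℕ} (F : AdditiveFramework G h t)

theorem AdditiveFramework.subset_of_le {i j : ℕ} (hij : i ≤ j) (hj : j ≤ h + 1) :
    F.Γ j ⊆ F.Γ i := by
  induction j, hij using Nat.le_induction with
  | base => exact subset_rfl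
  | succ j _ ih => exact (F.succ_subset j (by omega)).trans (ih (by omega))

/-- The bottom set lies in level 2, whose t-fold sumset lies in level 1. This is where h ≥ 2 is
needed. -/
theorem AdditiveFramework.sumset_bottom_subset (hh : 2 ≤ h) : sumset t F.bottom ⊆ F.top :=
  (sumset_mono (F.subset_of_le (i := 2) (by omega) le_rfl) t).trans
    ((F.sumset_subset 1 le_rfl (by omega)).trans (F.succ_subset 0 (by omega)))

end Sumset

theorem one_le_rpow_neg_inv {τ k : ℝ} (hk : 0 < k) (hτ : 0 < τ) (hτ' : τ ≤ 1) :
    1 ≤ τ ^ (-(1 / k)) :=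
  Real.one_le_rpow_of_pos_of_le_one_of_nonpos hτ hτ' (by rw [neg_nonpos]; positivity)

/-! ### From non-smoothing to the working hypotheses. -/

section Framework

variable {G : Type v} [AddCommGroup G] [Fintype G] [DecidableEq G]

namespace AdditiveFramework

variable {h t : ℕ} (F : AdditiveFramework G h t)

/-- The sumsets of the bottom set, viewed as balls. -/
def ball (r : ℕ) : Set G := (sumset r F.bottom : Set G)

theorem isBallFamily_ball : IsBallFamily F.ball :=
  isBallFamily_sumset (F.neg_eq _ le_rfl) (F.zero_mem _ le_rfl)

theorem ball_subset_top (hh : 2 ≤ h) {r : ℕ} (hr : r ≤ t) {x : G} (hx : x ∈ F.ball r) :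
    x ∈ F.top :=
  F.sumset_bottom_subset hh (F.isBallFamily_ball.mono hr hx)

theorem mem_ball_one {x : G} (hx : x ∈ F.bottom) : x ∈ F.ball 1 :=
  mem_add.2 ⟨0, mem_singleton_self _, x, hx, zero_add x⟩

end AdditiveFramework

namespace IsNonSmoothing

variable {h t : ℕ} {F : AdditiveFramework G h t} {τ k : ℝ} {Δ : Finset G}
  (hΔ : IsNonSmoothing F τ k Δ)
include hΔ

theorem eq_of_sub_mem_top {a b : G} (ha : a ∈ Δ) (hb : b ∈ Δ) (hab : a - b ∈ F.top) : a = b :=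
  hΔ.orthogonal.eq_of_sub_mem (F.zero_mem 0 (by omega)) ha hb hab

/-- The convolution in the m = 2 norm, evaluated at 0, counts a₁ + a₂ - b₁ - b₂ in the top set.
Exchanging variables turns equal sums into equal differences. -/
theorem sum_rep_le (hh : 2 ≤ h) (hτ : 0 < τ) :
    (∑ a ∈ Δ, ∑ b ∈ Δ, (rep F.ball Δ t (a - b) : ℝ)) ≤ τ ^ (-(1 / k)) * τ * (#Δ : ℝ) ^ 3 := by
  have h1 := (apply_zero_le_norm _).trans hΔ.norm_two
  rw [dconv_dconv_ind (sum_iterConv_two_mul Δ)] at h1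
  have h2 : τ ^ (1 - 1 / k) = τ ^ (-(1 / k)) * τ := by
    rw [← Real.rpow_add_one hτ.ne']; ring_nf
  rw [h2] at h1
  refine le_trans ?_ h1
  have h3 := sum_rep_eq F.ball Δ Δ Δ t
  have h4 : (∑ a ∈ Δ, ∑ b ∈ Δ, (rep F.ball Δ t (a - b) : ℝ)) =
      ((∑ a ∈ Δ, ∑ b ∈ Δ, rep F.ball Δ t (a - b) : ℕ) : ℝ) := by push_cast; rfl
  rw [h4, h3]
  refine Nat.cast_le.2 (card_le_card_of_injOn
    (fun w => ((w.2.1, w.1.2), (w.2.2, w.1.1))) (fun w hw => ?_) fun w _ w' _ hww => ?_)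
  · obtain ⟨hw, hw'⟩ := mem_filter.1 hw
    simp only [mem_product] at hw
    refine mem_filter.2 ⟨by simp only [mem_product]; tauto, F.ball_subset_top hh le_rfl ?_⟩
    convert hw' using 1
    dsimp only
    abel
  · simp only [Prod.mk.injEq] at hww
    ext <;> tauto

/-- A difference of two cross differences has four positive and four negative terms, so a
permutation of variables reduces the count to the m = 4 norm at 0. -/
theorem card_crossDiff_le (hh : 2 ≤ h) (hτ : 0 < τ) {Δ' : Finset G} (hΔ' : Δ' ⊆ Δ) :
    (#{x ∈ ((Δ' ×ˢ Δ') ×ˢ (Δ' ×ˢ Δ')) ×ˢ ((Δ' ×ˢ Δ') ×ˢ (Δ' ×ˢ Δ')) |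
      crossDiff x.1 - crossDiff x.2 ∈ F.ball t} : ℝ) ≤ τ ^ (-(1 / k)) * τ ^ 3 * (#Δ : ℝ) ^ 7 := by
  have h1 := (apply_zero_le_norm _).trans hΔ.norm_four
  rw [dconv_dconv_ind (sum_iterConv_four_mul Δ)] at h1
  have h2 : τ ^ (3 - 1 / k) = τ ^ (-(1 / k)) * τ ^ 3 := by
    rw [← Real.rpow_add_natCast hτ.ne']; push_cast; ring_nf
  rw [h2] at h1
  refine le_trans (Nat.cast_le.2 (card_le_card_of_injOn
    (fun x => (((x.1.2.1, x.1.1.2), (x.2.2.2, x.2.1.1)), ((x.1.2.2, x.1.1.1), (x.2.2.1, x.2.1.2))))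
    (fun x hx => ?_) fun x _ x' _ hxx => ?_)) h1
  · obtain ⟨hx, hx'⟩ := mem_filter.1 hx
    simp only [mem_product] at hx
    obtain ⟨⟨⟨h1, h2⟩, h3, h4⟩, ⟨h5, h6⟩, h7, h8⟩ := hx
    refine mem_filter.2 ⟨?_, F.ball_subset_top hh le_rfl ?_⟩
    · simp only [mem_product]
      exact ⟨⟨⟨hΔ' h3, hΔ' h2⟩, hΔ' h8, hΔ' h5⟩, ⟨hΔ' h4, hΔ' h1⟩, hΔ' h7, hΔ' h6⟩
    convert hx' using 1
    simp only [crossDiff]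
    abel
  · simp only [Prod.mk.injEq] at hxx
    ext <;> tauto

theorem le_sum_rep {Δ' : Finset G} (hΔ' : Δ' ⊆ Δ) :
    τ / #Δ * (#Δ' : ℝ) ^ 4 ≤ ∑ a ∈ Δ', ∑ b ∈ Δ', (rep F.ball Δ' 1 (a - b) : ℝ) := by
  refine (hΔ.le_energy Δ' hΔ').trans ?_
  rw [energy_two_ind]
  have h3 := sum_rep_eq F.ball Δ' Δ' Δ' 1
  have h4 : (∑ a ∈ Δ', ∑ b ∈ Δ', (rep F.ball Δ' 1 (a - b) : ℝ)) =
      ((∑ a ∈ Δ', ∑ b ∈ Δ', rep F.ball Δ' 1 (a - b) : ℕ) : ℝ) := by push_cast; rfl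
  rw [h4, h3]
  refine Nat.cast_le.2 (card_le_card_of_injOn
    (fun w => ((w.2.2, w.1.2), (w.1.1, w.2.1))) (fun w hw => ?_) fun w _ w' _ hww => ?_)
  · obtain ⟨hw, hw'⟩ := mem_filter.1 hw
    simp only [mem_product] at hw
    refine mem_filter.2 ⟨by simp only [mem_product]; tauto, F.mem_ball_one ?_⟩
    convert hw' using 1
    dsimp only
    abel
  · simp only [Prod.mk.injEq] at hww
    ext <;> tauto

/-- Discarding the elements with atypically many popular differences. -/
theorem exists_setup (hh : 2 ≤ h) (hk : 0 < k) (hτ : 0 < τ) (hτ' : τ ≤ 1) (hne : Δ.Nonempty) :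
    ∃ Δ' ⊆ Δ, #Δ ≤ 2 * #Δ' ∧ Setup F.ball Δ' t #Δ τ (1000 * τ ^ (-(1 / k))) := by
  obtain ⟨η, hη⟩ : ∃ η, η = τ ^ (-(1 / k)) := ⟨_, rfl⟩
  have hη1 : 1 ≤ η := hη ▸ one_le_rpow_neg_inv hk hτ hτ'
  have hN : (0 : ℝ) < #Δ := by exact_mod_cast hne.card_pos
  have hsum := hΔ.sum_rep_le hh hτ
  have hlog := hΔ.log_le
  have h8 := fun Δ' (h : Δ' ⊆ Δ) => hΔ.card_crossDiff_le hh hτ h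
  rw [← hη] at hsum hlog ⊢
  simp only [← hη] at h8
  obtain ⟨f, hf⟩ : ∃ f : G → ℝ, ∀ a, f a = ∑ b ∈ Δ, (rep F.ball Δ t (a - b) : ℝ) :=
    ⟨_, fun _ => rfl⟩
  have hf0 : ∀ a, 0 ≤ f a := fun a => by rw [hf]; positivity
  have hrep : ∀ Δ' ⊆ Δ, ∀ z, rep F.ball Δ' t z ≤ rep F.ball Δ t z := fun Δ' h z =>
    card_le_card (filter_subset_filter _ (product_subset_product h h))
  -- The average row sum is at most ητN², so by Markov's inequality twice that threshold keeps at
  -- least half of Δ.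
  refine ⟨{a ∈ Δ | f a ≤ 2 * η * τ * (#Δ : ℝ) ^ 2}, filter_subset _ _, ?_, ?_⟩
  · have h1 := card_filter_add_card_filter_not (s := Δ) (fun a => f a ≤ 2 * η * τ * (#Δ : ℝ) ^ 2)
    have h2 : (#{a ∈ Δ | ¬ f a ≤ 2 * η * τ * (#Δ : ℝ) ^ 2} : ℝ) * (2 * η * τ * (#Δ : ℝ) ^ 2) ≤
        η * τ * (#Δ : ℝ) ^ 3 := by
      rw [← nsmul_eq_mul]
      refine (card_nsmul_le_sum _ f _ fun a ha => (not_le.1 (mem_filter.1 ha).2).le).trans ?_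
      refine (sum_le_sum_of_subset_of_nonneg (filter_subset _ _) fun a _ _ => hf0 a).trans ?_
      simpa only [hf] using hsum
    have h3 : (η * τ * (#Δ : ℝ) ^ 2) * (2 * #{a ∈ Δ | ¬ f a ≤ 2 * η * τ * (#Δ : ℝ) ^ 2}) ≤
        (η * τ * (#Δ : ℝ) ^ 2) * #Δ := by linarith
    have h4 := le_of_mul_le_mul_left h3 (by positivity)
    have h5 : 2 * #{a ∈ Δ | ¬ f a ≤ 2 * η * τ * (#Δ : ℝ) ^ 2} ≤ #Δ := by exact_mod_cast h4
    omega
  · set Δ' : Finset G := {a ∈ Δ | f a ≤ 2 * η * τ * (#Δ : ℝ) ^ 2} with hΔ'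
    have hsub : Δ' ⊆ Δ := filter_subset _ _
    refine ⟨F.isBallFamily_ball, fun a ha b hb hab => ?_, ?_, hN, hτ, hτ', by linarith,
      by linarith, fun a ha => ?_, (h8 Δ' hsub).trans ?_⟩
    · exact hΔ.eq_of_sub_mem_top (hsub ha) (hsub hb) (F.ball_subset_top hh le_rfl hab)
    · exact Nat.cast_le.2 (card_le_card hsub)
    · calc ∑ b ∈ Δ', (rep F.ball Δ' t (a - b) : ℝ) ≤ ∑ b ∈ Δ', (rep F.ball Δ t (a - b) : ℝ) :=
            sum_le_sum fun b _ => Nat.cast_le.2 (hrep Δ' hsub _)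
        _ ≤ f a := by
            rw [hf]
            exact sum_le_sum_of_subset_of_nonneg hsub fun _ _ _ => Nat.cast_nonneg _
        _ ≤ 2 * η * τ * (#Δ : ℝ) ^ 2 := (mem_filter.1 ha).2
        _ ≤ 1000 * η * τ * (#Δ : ℝ) ^ 2 := by gcongr; norm_num
    · gcongr; linarith

/-- The energy of Δ' is at least τN³/16, and pairs with fewer than τN/32 representations contribute
at most half of that. The others span O(log(32/τ)) dyadic scales, and `log_le` bounds this logarithm
by 4 + τ^(-1/k). -/
theorem exists_level (ht : 2 ≤ t) (hk : 0 < k) (hτ : 0 < τ) (hτ' : τ ≤ 1) {Δ' : Finset G}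
    (hΔ' : Δ' ⊆ Δ) (hcard : #Δ ≤ 2 * #Δ')
    (S : Setup F.ball Δ' t #Δ τ (1000 * τ ^ (-(1 / k)))) :
    ∃ ρ : ℝ, 0 < ρ ∧ ρ ≤ 1 ∧
      τ * (#Δ : ℝ) ^ 2 ≤ 1000 * τ ^ (-(1 / k)) * ρ * #(level F.ball Δ' 1 (ρ * #Δ)) := by
  obtain ⟨η, hη⟩ : ∃ η, η = τ ^ (-(1 / k)) := ⟨_, rfl⟩
  have hη1 : 1 ≤ η := hη ▸ one_le_rpow_neg_inv hk hτ hτ'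
  have hN := S.N_pos
  have hlog := hΔ.log_le
  have hlow := hΔ.le_sum_rep hΔ'
  have hle := fun z => S.rep_le (r := 1) (by omega) z
  have hcard' : (#Δ : ℝ) ≤ 2 * #Δ' := by exact_mod_cast hcard
  have hcard'' : (#Δ' : ℝ) ≤ #Δ := Nat.cast_le.2 (card_le_card hΔ')
  clear S
  rw [← hη] at hlog ⊢
  obtain ⟨N, hNN⟩ : ∃ N : ℝ, N = #Δ := ⟨_, rfl⟩
  rw [← hNN] at hN hlow hcard' hcard'' ⊢
  simp only [← hNN] at hle ⊢
  obtain ⟨g, hg⟩ : ∃ g : G × G → ℝ, ∀ p, g p = rep F.ball Δ' 1 (p.1 - p.2) := ⟨_, fun _ => rfl⟩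
  have hg0 : ∀ p, 0 ≤ g p := fun p => by rw [hg]; positivity
  have hlow' : τ * N ^ 3 / 16 ≤ ∑ p ∈ Δ' ×ˢ Δ', g p := by
    rw [sum_product]
    simp only [hg]
    refine le_trans ?_ hlow
    calc τ * N ^ 3 / 16 = τ / N * (N / 2) ^ 4 := by field_simp; norm_num
      _ ≤ _ := by gcongr; linarith
  set T : Finset (G × G) := {p ∈ Δ' ×ˢ Δ' | τ * N / 32 ≤ g p} with hT
  have hsmall : ∑ p ∈ Δ' ×ˢ Δ', g p ≤ ∑ p ∈ T, g p + τ * N ^ 3 / 32 := by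
    have h1 : ∀ p ∈ Δ' ×ˢ Δ', g p ≤ (if τ * N / 32 ≤ g p then g p else 0) + τ * N / 32 := by
      intro p _
      have : 0 ≤ τ * N / 32 := by positivity
      split_ifs with hc <;> linarith
    refine (sum_le_sum h1).trans ?_
    rw [sum_add_distrib, ← sum_filter, sum_const, nsmul_eq_mul, card_product, Nat.cast_mul]
    gcongr
    calc (#Δ' : ℝ) * #Δ' * (τ * N / 32) ≤ N * N * (τ * N / 32) := by gcongr
      _ = _ := by ring
  have hlog' : Real.log (τ / 32)⁻¹ ≤ 4 + η := by
    rw [inv_div, Real.log_div (by norm_num) hτ.ne']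
    rw [Real.log_inv] at hlog
    have : Real.log 32 ≤ 4 := by
      have h1 : Real.log 32 = 5 * Real.log 2 := by
        rw [show (32 : ℝ) = 2 ^ 5 by norm_num, Real.log_pow]; norm_num
      have := Real.log_two_lt_d9
      linarith
    linarith
  obtain ⟨ρ, hρ, hρ1, hρle⟩ := exists_dyadic_class T (fun p => g p / N) g (fun p _ => hg0 p)
    (lo := τ / 32) (L := 4 + η) (by positivity)
    (fun p hp => by
      rw [le_div_iff₀ hN]
      have := (mem_filter.1 hp).2
      linarith)
    (fun p _ => by rw [div_le_one hN, hg]; exact hle _) hlog' (by linarith)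
  refine ⟨ρ, hρ, hρ1, ?_⟩
  have hcl : ∑ p ∈ T with ρ ≤ g p / N ∧ g p / N ≤ 2 * ρ, g p ≤
      #(level F.ball Δ' 1 (ρ * N)) * (2 * ρ * N) := by
    rw [← nsmul_eq_mul]
    refine (sum_le_card_nsmul _ g (2 * ρ * N) fun p hp => ?_).trans ?_
    · have := (mem_filter.1 hp).2.2
      rwa [div_le_iff₀ hN] at this
    · refine nsmul_le_nsmul_left (by positivity) (card_le_card fun p hp => ?_)
      obtain ⟨h1, h2, -⟩ := mem_filter.1 hp
      rw [le_div_iff₀ hN, hg] at h2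
      exact mem_filter.2 ⟨(mem_filter.1 h1).1, h2⟩
  have h5 : N * (τ * N ^ 2) ≤ N * (1000 * η * ρ * #(level F.ball Δ' 1 (ρ * N))) := by
    have h6 : τ * N ^ 3 / 32 ≤ (2 * (4 + η) + 2) * (#(level F.ball Δ' 1 (ρ * N)) * (2 * ρ * N)) :=
      calc τ * N ^ 3 / 32 ≤ _ := by linarith
        _ ≤ _ := hρle
        _ ≤ _ := by gcongr
    calc N * (τ * N ^ 2) = 32 * (τ * N ^ 3 / 32) := by ring
      _ ≤ 32 * ((2 * (4 + η) + 2) * (#(level F.ball Δ' 1 (ρ * N)) * (2 * ρ * N))) := by gcongr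
      _ = (640 + 128 * η) * (N * ρ * #(level F.ball Δ' 1 (ρ * N))) := by ring
      _ ≤ (1000 * η) * (N * ρ * #(level F.ball Δ' 1 (ρ * N))) := by gcongr; linarith
      _ = _ := by ring
  exact le_of_mul_le_mul_left h5 hN

end IsNonSmoothing

end Framework

/-! ### From a symmetry set to the required pair. -/

section Conclusion

variable {G : Type v} [AddCommGroup G] [Fintype G] [DecidableEq G]

theorem inn_dconv_dconv_ind (X H Γ : Finset G) :
    inn (dconv (ind X) (ind X)) (dconv (dconv (ind H) (ind H)) (ind Γ)) =
      #{w ∈ (X ×ˢ X) ×ˢ (H ×ˢ H) | w.2.1 - w.2.2 - (w.1.1 - w.1.2) ∈ Γ} := by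
  rw [inn_dconv, card_filter, sum_product (X ×ˢ X) (H ×ˢ H), Nat.cast_sum]
  refine sum_congr rfl fun p _ => ?_
  rw [dconv_dconv_ind_ind, card_filter]

namespace IsNonSmoothing

variable {h t : ℕ} {F : AdditiveFramework G h t} {τ k : ℝ} {Δ : Finset G}
  (hΔ : IsNonSmoothing F τ k Δ)
include hΔ

/-- Each pair represents its own difference, so the sum of representation counts is at least |Δ|².
This absorbs the rounding error when H is trimmed. -/
theorem one_le_mul_card (hh : 2 ≤ h) (hτ : 0 < τ) (hne : Δ.Nonempty) :
    1 ≤ τ ^ (-(1 / k)) * τ * #Δ := by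
  have hN : (0 : ℝ) < #Δ := by exact_mod_cast hne.card_pos
  have h0 : (0 : G) ∈ F.ball t := zero_mem_sumset (F.zero_mem _ le_rfl) t
  have h1 : ∑ a ∈ Δ, ∑ b ∈ Δ, (1 : ℝ) ≤ ∑ a ∈ Δ, ∑ b ∈ Δ, (rep F.ball Δ t (a - b) : ℝ) := by
    refine sum_le_sum fun a ha => sum_le_sum fun b hb => ?_
    have : 0 < rep F.ball Δ t (a - b) := card_pos.2 ⟨(a, b), mem_filter.2
      ⟨mem_product.2 ⟨ha, hb⟩, by simpa using h0⟩⟩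
    exact_mod_cast this
  have h2 := h1.trans (hΔ.sum_rep_le hh hτ)
  simp only [sum_const, nsmul_eq_mul, mul_one] at h2
  have h3 : (#Δ : ℝ) ^ 2 * 1 ≤ (#Δ : ℝ) ^ 2 * (τ ^ (-(1 / k)) * τ * #Δ) := by linarith
  exact le_of_mul_le_mul_left h3 (by positivity)

/-- A set `H` lying in a symmetry set of `X` has large relative energy with `X`. -/
theorem sq_le_inn_of_symmetric (hh : 2 ≤ h) {X H : Finset G} (hX : X ⊆ Δ) {z : G} {r : ℕ}
    (hr : 2 * r ≤ t) {M : ℝ} (hM : 0 < M)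
    (hsym : ∀ y ∈ H, (#X : ℝ) ≤ M * (rep F.ball X r (y + z) : ℝ)) :
    (#H : ℝ) ^ 2 * #X ≤ M ^ 2 *
      inn (dconv (ind X) (ind X)) (dconv (dconv (ind H) (ind H)) (ind F.top)) := by
  rw [inn_dconv_dconv_ind]
  rcases X.eq_empty_or_nonempty with rfl | hX0
  · simp
  have hXpos : (0 : ℝ) < #X := by exact_mod_cast hX0.card_pos
  have hball := F.isBallFamily_ball
  set T : Finset (G × (G × G)) := {w ∈ H ×ˢ (X ×ˢ X) | w.2.1 - w.2.2 - (w.1 + z) ∈ F.ball r}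
    with hT
  have hTmem : ∀ w ∈ T, w.1 ∈ H ∧ w.2.1 ∈ X ∧ w.2.2 ∈ X ∧
      w.2.1 - w.2.2 - (w.1 + z) ∈ F.ball r := fun w hw => by
    obtain ⟨h1, h2⟩ := mem_filter.1 hw
    simp only [mem_product] at h1
    exact ⟨h1.1, h1.2.1, h1.2.2, h2⟩
  have hTcard : (#H : ℝ) * #X ≤ M * #T := by
    have h1 : #T = ∑ y ∈ H, rep F.ball X r (y + z) := by
      rw [hT, card_filter, sum_product]
      exact sum_congr rfl fun y _ => by rw [rep, card_filter]
    rw [h1, Nat.cast_sum, mul_sum, ← nsmul_eq_mul]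
    exact card_nsmul_le_sum _ _ _ hsym
  -- If x₁ - x' ≈ y₁ + z and x₂ - x' ≈ y₂ + z, then x₁ - x₂ ≈ y₁ - y₂. Cauchy–Schwarz over x' counts
  -- these couples, and separation recovers x' from the outcome.
  have hsq := sq_card_le_card_mul_card_fiber_pairs T X (fun w => w.2.2)
    fun w hw => (hTmem w hw).2.2.1
  have hinj : #{x ∈ T ×ˢ T | x.1.2.2 = x.2.2.2} ≤
      #{w ∈ (X ×ˢ X) ×ˢ (H ×ˢ H) | w.2.1 - w.2.2 - (w.1.1 - w.1.2) ∈ F.top} := by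
    refine card_le_card_of_injOn (fun x => ((x.1.2.1, x.2.2.1), (x.1.1, x.2.1)))
      (fun x hx => ?_) fun x hx x' hx' hxx => ?_
    · obtain ⟨h1, h2⟩ := mem_filter.1 hx
      obtain ⟨h3, h4⟩ := mem_product.1 h1
      obtain ⟨k1, k2, k3, k4⟩ := hTmem _ h3
      obtain ⟨l1, l2, l3, l4⟩ := hTmem _ h4
      refine mem_filter.2 ⟨by simp only [mem_product]; tauto,
        F.ball_subset_top hh (r := r + r) (by omega) ?_⟩
      refine hball.of_sub l4 k4 ?_ le_rfl
      rw [h2]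
      abel
    · obtain ⟨h1, h2⟩ := mem_filter.1 hx
      obtain ⟨h3, h4⟩ := mem_product.1 h1
      obtain ⟨h1', h2'⟩ := mem_filter.1 hx'
      obtain ⟨h3', h4'⟩ := mem_product.1 h1'
      obtain ⟨-, -, k3, k4⟩ := hTmem _ h3
      obtain ⟨-, -, k3', k4'⟩ := hTmem _ h3'
      simp only [Prod.mk.injEq] at hxx
      have h5 : x.1.2.2 = x'.1.2.2 := by
        refine hΔ.eq_of_sub_mem_top (hX k3) (hX k3')
          (F.ball_subset_top hh (r := r + r) (by omega) ?_)
        refine hball.of_sub k4' k4 ?_ le_rfl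
        rw [hxx.1.1, hxx.2.1]
        abel
      have h6 : x.2.2.2 = x'.2.2.2 := by rw [← h2, ← h2', h5]
      ext <;> tauto
  obtain ⟨E, hE⟩ : ∃ E : ℕ,
      E = #{w ∈ (X ×ˢ X) ×ˢ (H ×ˢ H) | w.2.1 - w.2.2 - (w.1.1 - w.1.2) ∈ F.top} := ⟨_, rfl⟩
  rw [← hE] at hinj ⊢
  have h1 : (#X : ℝ) * ((#H : ℝ) ^ 2 * #X) ≤ #X * (M ^ 2 * E) := by
    calc (#X : ℝ) * ((#H : ℝ) ^ 2 * #X) = ((#H : ℝ) * #X) ^ 2 := by ring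
      _ ≤ (M * #T) ^ 2 := by gcongr
      _ = M ^ 2 * (#T : ℝ) ^ 2 := by ring
      _ ≤ M ^ 2 * (#X * E) := by
          gcongr
          refine hsq.trans ?_
          gcongr
      _ = _ := by ring
  exact le_of_mul_le_mul_left h1 hXpos

omit hΔ in
theorem le_dconv_of_le_rep (hh : 2 ≤ h) {X : Finset G} {y : G} {r : ℕ} (hr : r ≤ t) :
    (rep F.ball X r y : ℝ) ≤ dconv (dconv (ind X) (ind X)) (ind F.top) y := by
  rw [dconv_dconv_ind_ind]
  refine Nat.cast_le.2 (card_le_card fun p hp => ?_)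
  obtain ⟨h1, h2⟩ := mem_filter.1 hp
  exact mem_filter.2 ⟨h1, F.ball_subset_top hh hr h2⟩

/-- Passing from a set `H` in a symmetry set of `X` to one with `|H||X|` of the right size. -/
theorem exists_pair_of_symmetric (hh : 2 ≤ h) (hk : 0 < k) (hτ : 0 < τ) (hτ' : τ ≤ 1)
    (hne : Δ.Nonempty) {X H : Finset G} (hX : X ⊆ Δ) (hH : H ⊆ Δ) {z : G} {r : ℕ}
    (hr : 2 * r ≤ t) {M K : ℝ} (hM : 1 + τ ^ (-(1 / k)) ≤ M) (hMK : M ^ 2 ≤ K)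
    (hXH : τ * (#Δ : ℝ) ^ 2 ≤ M * (#X * #H))
    (hsym : ∀ y ∈ H, (#X : ℝ) ≤ M * (rep F.ball X r (y + z) : ℝ)) :
    ∃ X ⊆ Δ, ∃ H ⊆ Δ, ∃ δ : ℝ, δ ≤ 1 ∧ K⁻¹ * τ ≤ δ ∧
      K⁻¹ * (δ * #Δ) ≤ #H ∧ (#H : ℝ) ≤ K * (δ * #Δ) ∧
      K⁻¹ * (τ * δ⁻¹ * #Δ) ≤ #X ∧ (#X : ℝ) ≤ K * (τ * δ⁻¹ * #Δ) ∧
      K⁻¹ * ((#H : ℝ) ^ 2 * #X) ≤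
        inn (dconv (ind X) (ind X)) (dconv (dconv (ind H) (ind H)) (ind F.top)) ∧
      ∃ z : G, ∀ x ∈ H,
        K⁻¹ * (#X : ℝ) ≤ dconv (dconv (ind X) (ind X)) (ind F.top) (x + z) := by
  have hN1 := hΔ.one_le_mul_card hh hτ hne
  have hη1 := one_le_rpow_neg_inv hk hτ hτ'
  obtain ⟨η, hη⟩ : ∃ η, η = τ ^ (-(1 / k)) := ⟨_, rfl⟩
  rw [← hη] at hM hN1 hη1
  have hN : (0 : ℝ) < #Δ := by exact_mod_cast hne.card_pos
  have hM1 : 1 ≤ M := by linarith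
  have hMK' : M ≤ K := (le_self_pow₀ hM1 two_ne_zero).trans hMK
  have hK1 : 1 ≤ K := hM1.trans hMK'
  have hXN : (#X : ℝ) ≤ #Δ := Nat.cast_le.2 (card_le_card hX)
  have hXH0 : (0 : ℝ) < #X * #H :=
    pos_of_mul_pos_right (lt_of_lt_of_le (by positivity) hXH) (by linarith)
  have hXpos : (0 : ℝ) < #X := pos_of_mul_pos_left hXH0 (Nat.cast_nonneg _)
  -- H is cut down to about τ|Δ|²/|X| elements. The ceiling adds at most |X| ≤ |Δ| ≤ ητ|Δ|² to
  -- |X||H'|, whence the requirement M ≥ 1 + η.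
  obtain ⟨H', hH', hcard⟩ := exists_subset_card_eq
    (min_le_left #H ⌈τ * (#Δ : ℝ) ^ 2 / #X⌉₊)
  have hup : (#X : ℝ) * #H' ≤ M * (τ * (#Δ : ℝ) ^ 2) := by
    have h1 : (#H' : ℝ) ≤ τ * (#Δ : ℝ) ^ 2 / #X + 1 := by
      refine le_trans (Nat.cast_le.2 (hcard.le.trans (min_le_right _ _))) ?_
      exact (Nat.ceil_lt_add_one (by positivity)).le
    calc (#X : ℝ) * #H' ≤ #X * (τ * (#Δ : ℝ) ^ 2 / #X + 1) := by gcongr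
      _ = τ * (#Δ : ℝ) ^ 2 + #X * 1 := by field_simp
      _ ≤ τ * (#Δ : ℝ) ^ 2 + #Δ * (η * τ * #Δ) := by gcongr
      _ = (1 + η) * (τ * (#Δ : ℝ) ^ 2) := by ring
      _ ≤ _ := by gcongr
  have hlow : τ * (#Δ : ℝ) ^ 2 ≤ M * (#X * #H') := by
    rcases min_choice #H ⌈τ * (#Δ : ℝ) ^ 2 / #X⌉₊ with h1 | h1
    · rwa [hcard, h1]
    · rw [hcard, h1]
      have h2 := Nat.le_ceil (τ * (#Δ : ℝ) ^ 2 / #X)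
      rw [div_le_iff₀ hXpos] at h2
      calc _ ≤ _ := h2
        _ = 1 * (#X * (⌈τ * (#Δ : ℝ) ^ 2 / #X⌉₊ : ℝ)) := by ring
        _ ≤ _ := by gcongr
  have hH'pos : (0 : ℝ) < #H' := by
    have h1 : (0 : ℝ) < #X * #H' :=
      pos_of_mul_pos_right (lt_of_lt_of_le (by positivity) hlow) (by linarith)
    exact pos_of_mul_pos_right h1 hXpos.le
  have hH'N : (#H' : ℝ) ≤ #Δ := Nat.cast_le.2 (card_le_card (hH'.trans hH))
  clear hcard hXH hXH0
  have hK0 : 0 < K := by linarith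
  have hδ : (#H' : ℝ) / #Δ * #Δ = #H' := by field_simp
  have hδ' : τ * ((#H' : ℝ) / #Δ)⁻¹ * #Δ = τ * (#Δ : ℝ) ^ 2 / #H' := by field_simp
  have hinn := hΔ.sq_le_inn_of_symmetric hh hX hr (by linarith) fun y hy => hsym y (hH' hy)
  refine ⟨X, hX, H', hH'.trans hH, #H' / #Δ, ?_, ?_, ?_, ?_, ?_, ?_, ?_, z, fun x hx => ?_⟩
  · rwa [div_le_one hN]
  · rw [inv_mul_le_iff₀ hK0, ← mul_div_assoc, le_div_iff₀ hN]
    have h1 : #Δ * (τ * #Δ) ≤ #Δ * (K * #H') := by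
      calc #Δ * (τ * #Δ) = τ * (#Δ : ℝ) ^ 2 := by ring
        _ ≤ _ := hlow
        _ ≤ K * (#Δ * #H') := by gcongr
        _ = _ := by ring
    exact le_of_mul_le_mul_left h1 hN
  · rw [hδ, inv_mul_le_iff₀ hK0]
    exact le_mul_of_one_le_left hH'pos.le hK1
  · rw [hδ]
    exact le_mul_of_one_le_left hH'pos.le hK1
  · rw [hδ', inv_mul_le_iff₀ hK0, div_le_iff₀ hH'pos, mul_assoc]
    exact hlow.trans (by gcongr)
  · rw [hδ', ← mul_div_assoc, le_div_iff₀ hH'pos]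
    exact hup.trans (by gcongr)
  · rw [inv_mul_le_iff₀ hK0]
    refine hinn.trans (mul_le_mul_of_nonneg_right hMK ?_)
    rw [inn_dconv_dconv_ind]
    positivity
  · rw [inv_mul_le_iff₀ hK0]
    calc (#X : ℝ) ≤ _ := hsym x (hH' hx)
      _ ≤ K * (rep F.ball X r (x + z) : ℝ) := by gcongr
      _ ≤ _ := by
          gcongr
          exact le_dconv_of_le_rep hh (by omega)

/-- A pair with losses polynomial in `τ⁻¹`. -/
theorem exists_pair_trivial (hh : 2 ≤ h) (ht : 2 ≤ t) (hk : 0 < k) (hτ : 0 < τ) (hτ' : τ ≤ 1)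
    (hne : Δ.Nonempty) :
    ∃ X ⊆ Δ, ∃ H ⊆ Δ, ∃ z, τ * (#Δ : ℝ) ^ 2 ≤ 16 / τ * (#X * #H) ∧
      ∀ y ∈ H, (#X : ℝ) ≤ 16 / τ * (rep F.ball X 1 (y + z) : ℝ) := by
  obtain ⟨X, hX, hcard, S⟩ := hΔ.exists_setup hh hk hτ hτ' hne
  have hN : (0 : ℝ) < #Δ := by exact_mod_cast hne.card_pos
  have hcard' : (#Δ : ℝ) ≤ 2 * #X := by exact_mod_cast hcard
  have hXpos : (0 : ℝ) < #X := by linarith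
  -- The energy lower bound on a subset containing half of Δ already says that it is symmetric
  -- against itself on average, with κ = τ/2.
  have hsum : τ / 2 * #X * (#X : ℝ) ^ 2 ≤
      ∑ h₁ ∈ X, ∑ h₂ ∈ X, (rep F.ball X 1 (h₂ - h₁) : ℝ) := by
    rw [sum_comm]
    refine le_trans ?_ (hΔ.le_sum_rep hX)
    rw [div_mul_eq_mul_div τ (#Δ : ℝ), le_div_iff₀ hN]
    calc τ / 2 * #X * (#X : ℝ) ^ 2 * #Δ ≤ τ / 2 * #X * (#X : ℝ) ^ 2 * (2 * #X) := by gcongr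
      _ = _ := by ring
  obtain ⟨h₁, -, H, hH, h1, h2⟩ := S.exists_symmetric subset_rfl
    (card_pos.1 (by exact_mod_cast hXpos)) (card_pos.1 (by exact_mod_cast hXpos))
    (by positivity) (by omega) hsum
  refine ⟨X, hX, H, hH.trans hX, -h₁, ?_, fun y hy => ?_⟩
  · have h3 : τ * (#Δ : ℝ) ^ 2 ≤ 16 * (#X * #H) := by
      calc τ * (#Δ : ℝ) ^ 2 ≤ τ * (2 * #X) ^ 2 := by gcongr
        _ = 8 * (#X * (τ / 2 * #X)) := by ring
        _ ≤ 8 * (#X * (2 * #H)) := by gcongr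
        _ = _ := by ring
    refine h3.trans ?_
    gcongr
    rw [le_div_iff₀ hτ]
    linarith
  · have h3 := h2 y hy
    rw [sub_eq_add_neg] at h3
    rw [div_mul_eq_mul_div, le_div_iff₀ hτ]
    have : (0 : ℝ) ≤ rep F.ball X 1 (y + -h₁) := Nat.cast_nonneg _
    linarith

end IsNonSmoothing

end Conclusion

/-! ### Sizes of the parameters and of the permitted loss. -/

section Parameters

/-- `Real.log x` is log |x| for negative x, so the quotient can be positive there; on [-1/2, 0) it
is at most 1. On [0, 1] it is nonpositive, with value 0 at both ends. -/
theorem one_lt_of_two_hundred_le {x : ℝ} (hx : -(1 / 2) ≤ x) (h : 200 ≤ x / Real.log x) :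
    1 < x := by
  by_contra! hx1
  rcases le_or_gt 0 x with h0 | h0
  · have := div_nonpos_of_nonneg_of_nonpos h0 (Real.log_nonpos h0 hx1)
    linarith
  · have h1 : Real.log x ≤ -(1 / 2) := by
      rw [← Real.log_neg_eq_log]
      have := Real.log_le_sub_one_of_pos (neg_pos.2 h0)
      linarith
    rw [le_div_iff_of_neg (by linarith)] at h
    linarith

theorem neg_half_le_log_log {k : ℝ} (hk : 2 ≤ k) : -(1 / 2) ≤ Real.log (Real.log k) := by
  have h1 : 0.69 < Real.log k :=
    lt_of_lt_of_le (lt_trans (by norm_num) Real.log_two_gt_d9) (Real.log_le_log (by norm_num) hk)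
  have h2 := Real.one_sub_inv_le_log_of_pos (by linarith : 0 < Real.log k)
  have h3 : (Real.log k)⁻¹ ≤ (0.69 : ℝ)⁻¹ := inv_anti₀ (by norm_num) h1.le
  norm_num at h3 ⊢
  linarith

/-- The size constraints on the height when `log log k` is not small. -/
theorem height_bounds {k x : ℝ} {h t : ℕ} (hk : 1 < k) (hx : x = Real.log (Real.log k))
    (hx4 : 4 < x) (hh : (h : ℝ) ≤ 100⁻¹ * (x / Real.log x)) (ht : 100 * Real.log k ≤ t) :
    28 * 12 ^ h ≤ t ∧ (10 * 12 ^ h : ℝ) ≤ k ∧ (h : ℝ) * 12 ^ h ≤ k := by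
  have hlogk : 0 < Real.log k := Real.log_pos hk
  have hL : Real.exp x = Real.log k := by rw [hx, Real.exp_log hlogk]
  have hLk : Real.exp x ≤ k := by
    rw [hL]
    exact (Real.log_le_sub_one_of_pos (by linarith)).trans (by linarith)
  have hlogx : 1 ≤ Real.log x := by
    rw [Real.le_log_iff_exp_le (by linarith)]
    linarith [Real.exp_one_lt_d9]
  have hhx : (h : ℝ) ≤ x / 100 := by
    refine hh.trans ?_
    have : x / Real.log x ≤ x := div_le_self (by linarith) hlogx
    linarith
  -- As 12 ≤ e³ and h ≤ x/100, the iterated factor 12^h is a small power of exp x = log k.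
  have hpow : (12 : ℝ) ^ h ≤ Real.exp (x / 4) := by
    have h12 : (12 : ℝ) ≤ Real.exp 3 := by
      have h1 := Real.exp_one_gt_d9
      have h2 : Real.exp 3 = Real.exp 1 ^ 3 := by rw [← Real.exp_nat_mul]; norm_num
      rw [h2]
      calc (12 : ℝ) ≤ 2.7 ^ 3 := by norm_num
        _ ≤ _ := by gcongr; linarith
    calc (12 : ℝ) ^ h ≤ Real.exp 3 ^ h := by gcongr
      _ = Real.exp (h * 3) := (Real.exp_nat_mul 3 h).symm
      _ ≤ _ := Real.exp_le_exp.2 (by linarith)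
  have hsq : Real.exp (x / 4) * Real.exp (x / 4) ≤ Real.exp x := by
    rw [← Real.exp_add]
    exact Real.exp_le_exp.2 (by linarith)
  have h10 : 10 * Real.exp (x / 4) ≤ Real.exp x := by
    have h1 : 10 ≤ Real.exp (x * (3 / 4)) := by
      have h1 := Real.exp_one_gt_d9
      have h2 : Real.exp 3 = Real.exp 1 ^ 3 := by rw [← Real.exp_nat_mul]; norm_num
      calc (10 : ℝ) ≤ 2.7 ^ 3 := by norm_num
        _ ≤ Real.exp 1 ^ 3 := by gcongr; linarith
        _ = Real.exp 3 := h2.symm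
        _ ≤ _ := Real.exp_le_exp.2 (by linarith)
    calc 10 * Real.exp (x / 4) ≤ Real.exp (x * (3 / 4)) * Real.exp (x / 4) := by gcongr
      _ = _ := by rw [← Real.exp_add]; ring_nf
  have hexp : 0 < Real.exp (x / 4) := Real.exp_pos _
  refine ⟨?_, ?_, ?_⟩
  · have h1 : (28 * 12 ^ h : ℝ) ≤ t := by
      refine le_trans ?_ ht
      rw [← hL]
      linarith
    exact_mod_cast h1
  · linarith
  · refine le_trans ?_ (hsq.trans hLk)
    gcongr
    have := Real.add_one_le_exp (x / 4)
    linarith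

/-- The quantity of which the permitted loss is a power. -/
noncomputable def baseLoss (h t : ℕ) (k τ : ℝ) : ℝ :=
  (t : ℝ) ^ h * (2 : ℝ) ^ k * τ ^ (-(1 / Real.log (Real.log k)) - 1 / (h : ℝ))

theorem loss_eq (A h t : ℕ) (k τ : ℝ) : loss A h t k τ = A * baseLoss h t k τ ^ A := rfl

section

variable {h t : ℕ} {k τ : ℝ} (ht : 1 ≤ t) (hk : 0 ≤ k)
  (hx : 0 < Real.log (Real.log k)) (hτ : 0 < τ) (hτ' : τ ≤ 1)
include ht hk hx hτ hτ'

omit hk hx in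
theorem mul_rpow_le_baseLoss {a : ℝ} (ha : a ≤ 1 / Real.log (Real.log k) + 1 / (h : ℝ)) :
    2 ^ k * τ ^ (-a) ≤ baseLoss h t k τ := by
  have h1 : (1 : ℝ) ≤ (t : ℝ) ^ h := one_le_pow₀ (by exact_mod_cast ht)
  have h2 : τ ^ (-a) ≤ τ ^ (-(1 / Real.log (Real.log k)) - 1 / (h : ℝ)) :=
    Real.rpow_le_rpow_of_exponent_ge hτ hτ' (by linarith)
  have h3 : (0 : ℝ) < 2 ^ k := by positivity
  calc (2 : ℝ) ^ k * τ ^ (-a) = 1 * 2 ^ k * τ ^ (-a) := by ring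
    _ ≤ _ := by
      unfold baseLoss
      gcongr

omit hx in
theorem rpow_le_baseLoss {a : ℝ} (ha : a ≤ 1 / Real.log (Real.log k) + 1 / (h : ℝ)) :
    τ ^ (-a) ≤ baseLoss h t k τ := by
  refine le_trans ?_ (mul_rpow_le_baseLoss ht hτ hτ' ha)
  exact le_mul_of_one_le_left (by positivity) (Real.one_le_rpow (by norm_num) hk)

theorem one_le_baseLoss : 1 ≤ baseLoss h t k τ := by
  have := rpow_le_baseLoss (h := h) (a := 0) ht hk hτ hτ' (by positivity)
  simpa using this

theorem pow_le_loss {m A : ℕ} (hA : 0 < A) (hm : m ≤ A) :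
    A * baseLoss h t k τ ^ m ≤ loss A h t k τ := by
  rw [loss_eq]
  gcongr
  exact one_le_baseLoss ht hk hx hτ hτ'

theorem one_le_loss {A : ℕ} (hA : 0 < A) : 1 ≤ loss A h t k τ := by
  refine le_trans ?_ (pow_le_loss ht hk hx hτ hτ' (m := 0) hA (by omega))
  rw [pow_zero, mul_one]
  exact Nat.one_le_cast.2 hA

end

/-- For log log k ≤ 4 the base of the loss is at least τ^(-1/4), whose eighth power is τ^(-2). -/
theorem sq_div_le_loss {h t : ℕ} {k τ : ℝ} (ht : 1 ≤ t) (hk : 0 ≤ k)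
    (hx : 0 < Real.log (Real.log k)) (hx4 : Real.log (Real.log k) ≤ 4) (hτ : 0 < τ)
    (hτ' : τ ≤ 1) : (16 / τ) ^ 2 ≤ loss 400 h t k τ := by
  have h1 : τ ^ (-(1 / 4 : ℝ)) ≤ baseLoss h t k τ :=
    rpow_le_baseLoss ht hk hτ hτ' (by
      have h2 := one_div_le_one_div_of_le hx hx4
      have h3 : 0 ≤ 1 / (h : ℝ) := by positivity
      linarith)
  have h4 : (16 / τ) ^ 2 = 256 * (τ ^ (-(1 / 4 : ℝ))) ^ 8 := by
    have h5 : (τ ^ (-(1 / 4 : ℝ))) ^ 8 = (τ ^ 2)⁻¹ := by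
      rw [← Real.rpow_mul_natCast hτ.le, ← Real.rpow_natCast τ 2, ← Real.rpow_neg hτ.le]
      norm_num
    rw [h5]
    field_simp
    norm_num
  have h6 := pow_le_loss (h := h) ht hk hx hτ hτ' (m := 8) (A := 400) (by norm_num) (by norm_num)
  have h7 : 0 ≤ τ ^ (-(1 / 4 : ℝ)) := by positivity
  calc (16 / τ) ^ 2 = 256 * (τ ^ (-(1 / 4 : ℝ))) ^ 8 := h4
    _ ≤ (400 : ℕ) * baseLoss h t k τ ^ 8 := by
      gcongr
      norm_num
    _ ≤ _ := h6

/-- The factor 2^k pays for 1000^(12^h), and τ^(-1/h) pays for τ^(-12^h/k). The iterated loss is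
thus at most the square of the base, which is then raised to the powers 100 and 2; this gives the
exponent 400. -/
theorem iterated_loss_le {h t : ℕ} {k τ : ℝ} (hh : 0 < h) (ht : 1 ≤ t) (hk : 0 < k)
    (hx : 0 < Real.log (Real.log k)) (hτ : 0 < τ) (hτ' : τ ≤ 1) (h10 : (10 * 12 ^ h : ℝ) ≤ k)
    (hhk : (h : ℝ) * 12 ^ h ≤ k) :
    ((((1000 * τ ^ (-(1 / k))) ^ 12 ^ h * τ ^ (-(1 / (h : ℝ)))) ^ 100) ^ 2) ≤
      loss 400 h t k τ := by
  have hh' : (0 : ℝ) < h := by exact_mod_cast hh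
  have hlog : 0 < 1 / Real.log (Real.log k) := by positivity
  have hpos := one_le_baseLoss (h := h) ht hk.le hx hτ hτ'
  have h1 : (1000 : ℝ) ^ 12 ^ h ≤ 2 ^ k := by
    calc (1000 : ℝ) ^ 12 ^ h ≤ (2 ^ 10) ^ 12 ^ h := by gcongr; norm_num
      _ = (2 : ℝ) ^ ((10 * 12 ^ h : ℕ) : ℝ) := by rw [← pow_mul, Real.rpow_natCast]
      _ ≤ 2 ^ k := Real.rpow_le_rpow_of_exponent_le (by norm_num) (by push_cast; exact h10)
  have h2 : (τ ^ (-(1 / k))) ^ 12 ^ h ≤ τ ^ (-(1 / (h : ℝ))) := by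
    rw [← Real.rpow_mul_natCast hτ.le]
    refine Real.rpow_le_rpow_of_exponent_ge hτ hτ' ?_
    push_cast
    rw [neg_mul, neg_le_neg_iff, one_div_mul_eq_div, div_le_div_iff₀ hk hh']
    linarith
  have h3 : (1000 * τ ^ (-(1 / k))) ^ 12 ^ h * τ ^ (-(1 / (h : ℝ))) ≤ baseLoss h t k τ ^ 2 := by
    rw [mul_pow, sq]
    calc (1000 : ℝ) ^ 12 ^ h * (τ ^ (-(1 / k))) ^ 12 ^ h * τ ^ (-(1 / (h : ℝ)))
        ≤ 2 ^ k * τ ^ (-(1 / (h : ℝ))) * τ ^ (-(1 / (h : ℝ))) := by gcongr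
      _ ≤ baseLoss h t k τ * baseLoss h t k τ := by
        gcongr
        · exact mul_rpow_le_baseLoss ht hτ hτ' (by linarith)
        · exact rpow_le_baseLoss ht hk.le hτ hτ' (by linarith)
  have h4 := pow_le_loss (h := h) ht hk.le hx hτ hτ' (m := 400) (A := 400) (by norm_num) le_rfl
  calc _ ≤ ((baseLoss h t k τ ^ 2) ^ 100) ^ 2 := by gcongr
    _ = baseLoss h t k τ ^ 400 := by rw [← pow_mul, ← pow_mul]
    _ ≤ (400 : ℕ) * baseLoss h t k τ ^ 400 :=
        le_mul_of_one_le_left (by positivity) (by norm_num)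
    _ ≤ _ := h4

end Parameters

end AdditiveStructure

/-! ### Choice of constants and the two ranges of log log k. -/

theorem mainTheorem7 :
    ∃ C : ℝ, 0 < C ∧ ∃ A : ℕ, 0 < A ∧
      ∀ (G : Type u) [AddCommGroup G] [Fintype G] [DecidableEq G]
        (h t : ℕ) (k τ : ℝ) (F : AdditiveStructure.AdditiveFramework G h t) (Δ : Finset G),
        2 ≤ h → 2 ≤ t → 2 ≤ k → 0 < τ → τ ≤ 1 / 2 →
        (h : ℝ) ≤ C⁻¹ * (Real.log (Real.log k) / Real.log (Real.log (Real.log k))) →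
        C * Real.log k ≤ (t : ℝ) →
        AdditiveStructure.IsRobustlyNonSmoothing F (1 / 2) τ k Δ →
        ∃ X ⊆ Δ, ∃ H ⊆ Δ, ∃ δ : ℝ,
          δ ≤ 1 ∧
          (AdditiveStructure.loss A h t k τ)⁻¹ * τ ≤ δ ∧
          -- `|H| ≍ δ|Δ|`
          (AdditiveStructure.loss A h t k τ)⁻¹ * (δ * Δ.card) ≤ (H.card : ℝ) ∧
          (H.card : ℝ) ≤ AdditiveStructure.loss A h t k τ * (δ * Δ.card) ∧
          -- `|X| ≍ τδ⁻¹|Δ|`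
          (AdditiveStructure.loss A h t k τ)⁻¹ * (τ * δ⁻¹ * Δ.card) ≤ (X.card : ℝ) ∧
          (X.card : ℝ) ≤ AdditiveStructure.loss A h t k τ * (τ * δ⁻¹ * Δ.card) ∧
          -- the energy between `X` and `H`
          (AdditiveStructure.loss A h t k τ)⁻¹ * ((H.card : ℝ) ^ 2 * (X.card : ℝ)) ≤
            AdditiveStructure.inn
              (AdditiveStructure.dconv (AdditiveStructure.ind X) (AdditiveStructure.ind X))
              (AdditiveStructure.dconv
                (AdditiveStructure.dconv (AdditiveStructure.ind H) (AdditiveStructure.ind H))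
                (AdditiveStructure.ind F.top)) ∧
          -- a translate of `H` lies in a relative symmetry set of `X`
          ∃ z : G, ∀ x ∈ H,
            (AdditiveStructure.loss A h t k τ)⁻¹ * (X.card : ℝ) ≤
              AdditiveStructure.dconv
                (AdditiveStructure.dconv (AdditiveStructure.ind X) (AdditiveStructure.ind X))
                (AdditiveStructure.ind F.top) (x + z) := by
  refine ⟨100, by norm_num, 400, by norm_num, ?_⟩
  intro G _ _ _ h t k τ F Δ hh ht hk hτ hτ₂ hhk htk hrob
  have hτ' : τ ≤ 1 := by linarith
  have hk0 : 0 < k := by linarith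
  -- With C = 100 and h ≥ 2, the height bound forces the quotient to be at least 200.
  have hx1 : 1 < Real.log (Real.log k) := by
    refine AdditiveStructure.one_lt_of_two_hundred_le
      (AdditiveStructure.neg_half_le_log_log hk) ?_
    have h2 : (2 : ℝ) ≤ h := by exact_mod_cast hh
    linarith
  have hx0 : 0 < Real.log (Real.log k) := by linarith
  have hK1 := AdditiveStructure.one_le_loss (h := h) (t := t) (by omega) hk0.le hx0 hτ hτ'
    (A := 400) (by norm_num)
  have hΔ : AdditiveStructure.IsNonSmoothing F τ k Δ :=
    hrob Δ subset_rfl (by linarith [(Nat.cast_nonneg Δ.card : (0 : ℝ) ≤ Δ.card)])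
  rcases Δ.eq_empty_or_nonempty with rfl | hne
  · refine ⟨∅, subset_rfl, ∅, subset_rfl, 1, le_rfl, ?_, ?_⟩
    · rw [inv_mul_le_iff₀ (by linarith)]
      linarith
    · rw [AdditiveStructure.inn_dconv_dconv_ind]
      simp
  have hη1 := AdditiveStructure.one_le_rpow_neg_inv hk0 hτ hτ'
  rcases le_or_gt (Real.log (Real.log k)) 4 with hx4 | hx4
  · obtain ⟨X, hX, H, hH, z, h1, h2⟩ := hΔ.exists_pair_trivial hh ht hk0 hτ hτ' hne
    have hM : 1 + τ ^ (-(1 / k)) ≤ 16 / τ := by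
      have h3 : τ ^ (-(1 / k)) ≤ τ⁻¹ := by
        rw [← Real.rpow_neg_one]
        refine Real.rpow_le_rpow_of_exponent_ge hτ hτ' ?_
        rw [neg_le_neg_iff, div_le_one hk0]
        linarith
      have h4 : 1 ≤ τ⁻¹ := (one_le_inv₀ hτ).2 hτ'
      rw [div_eq_mul_inv 16 τ]
      linarith
    exact hΔ.exists_pair_of_symmetric hh hk0 hτ hτ' hne hX hH (by omega) hM
      (AdditiveStructure.sq_div_le_loss (by omega) hk0.le hx0 hx4 hτ hτ') h1 h2
  · obtain ⟨hR, h10, hhk'⟩ := AdditiveStructure.height_bounds (by linarith) rfl hx4 hhk htk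
    obtain ⟨Δ', hΔ', hcard, S⟩ := hΔ.exists_setup hh hk0 hτ hτ' hne
    obtain ⟨ρ, hρ, hρ1, hlev⟩ := hΔ.exists_level ht hk0 hτ hτ' hΔ' hcard S
    obtain ⟨X, hX, H, hH, z, h1, h2⟩ := S.exists_pair hh hρ hρ1 hlev hR le_rfl
    have hM : 1 + τ ^ (-(1 / k)) ≤
        ((1000 * τ ^ (-(1 / k))) ^ 12 ^ h * τ ^ (-(1 / (h : ℝ)))) ^ 100 := by
      have h3 := AdditiveStructure.one_le_rpow_neg_inv (k := h)
        (by exact_mod_cast (by omega : 0 < h)) hτ hτ'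
      have h4 : 1 ≤ 1000 * τ ^ (-(1 / k)) := by linarith
      have h5 : 1000 * τ ^ (-(1 / k)) ≤ (1000 * τ ^ (-(1 / k))) ^ 12 ^ h :=
        le_self_pow₀ h4 (by positivity)
      have h6 : 1000 * τ ^ (-(1 / k)) ≤
          (1000 * τ ^ (-(1 / k))) ^ 12 ^ h * τ ^ (-(1 / (h : ℝ))) :=
        h5.trans (le_mul_of_one_le_right (by linarith) h3)
      have h7 := h6.trans (le_self_pow₀ (h4.trans h6) (by norm_num : 100 ≠ 0))
      linarith
    exact hΔ.exists_pair_of_symmetric hh hk0 hτ hτ' hne (hX.trans hΔ') (hH.trans hΔ')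
      (r := 8 * 12 ^ h) (by omega) hM
      (AdditiveStructure.iterated_loss_le (by omega) (by omega) hk0 hx0 hτ hτ' h10 hhk') h1 h2
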